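/- Let $\mathbb{D}$ be the open unit disk and $\mathbb{T}$ the unit circle. Let $n\ge 1$ and let $\phi$ be a rational inner function on $\mathbb{D}^2$ of degree $(n,1)$; that is, $\phi=\gamma\,\tilde p/p$ on $\mathbb{D}^2$, where $\gamma\in\mathbb{T}$, $p\in\mathbb{C}[z_1,z_2]$ has degree at most $n$ in $z_1$ and at most $1$ in $z_2$ and has no zeros in $\mathbb{D}^2$, $\tilde p(z)=z_1^n z_2\,\overline{p(1/\bar z_1,1/\bar z_2)}$, and $p,\tilde p$ have no common factor. The singularities of $\phi$ are the zeros of $p$ on $\mathbb{T}^2$. For a function $f$ on $\mathbb{D}^2$ and $\zeta\in\mathbb{T}^2$, let $f^*(\zeta)$ denote the non-tangential limit of $f$ at $\zeta$, i.e. the common limit of $f(z)$ as $z\to\zeta$ within $\{z\in\mathbb{D}^2: |z_j-\zeta_j|<M(1-|z_j|),\ j=1,2\}$, for every $M>1$. Call $\alpha\in\mathbb{T}$ exceptional for $\phi$ if $\phi^*(\tau)=\alpha$ for some singularity $\tau$ of $\phi$, and generic otherwise. Let $H^2(\mathbb{D}^2)$ be the Hardy space of analytic $f$ on $\mathbb{D}^2$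 with $\|f\|^2=\sup_{0<r<1}\int_{\mathbb{T}^2}|f(r\zeta)|^2\,dm_2(\zeta)<\infty$, where $m_2$ is normalized Lebesgue measure, let $K_\phi=H^2(\mathbb{D}^2)\ominus\phi H^2(\mathbb{D}^2)$, and for $w\in\mathbb{D}^2$ put $$C_w(z)=\frac{1}{(1-z_1\bar w_1)(1-z_2\bar w_2)},\qquad k_w(z)=(1-\overline{\phi(w)}\phi(z))\,C_w(z).$$ Fix $\alpha\in\mathbb{T}$. There is a unique finite positive Borel measure $\sigma_\alpha$ on $\mathbb{T}^2$ (the Clark measure) such that $$\frac{1-|\phi(z)|^2}{|\alpha-\phi(z)|^2}=\int_{\mathbb{T}^2}\frac{(1-|z_1|^2)(1-|z_2|^2)}{|\zeta_1-z_1|^2|\zeta_2-z_2|^2}\,d\sigma_\alpha(\zeta)\qquad\text{for all } z\in\mathbb{D}^2,$$ and there is a unique linear isometry $J_\alpha:K_\phi\to L^2(\sigma_\alpha)$ such that, for all $w\in\mathbb{D}^2$, $k_w\in K_\phi$ and $J_\alpha k_w=(1-\alpha\overline{\phi(w)})\,C_w$ $\sigma_\alpha$-almost everywhere. Moreover: (i)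 for each $f\in K_\phi$, for $\sigma_\alpha$-almost every $\zeta\in\mathbb{T}^2$ the non-tangential limit $f^*(\zeta)$ exists and $(J_\alpha f)(\zeta)=f^*(\zeta)$; (ii) $J_\alpha$ is unitary (that is, onto $L^2(\sigma_\alpha)$) if and only if $\alpha$ is a generic value for $\phi$. -/

import Mathlib

open MeasureTheory Filter Topology Complex
open scoped ComplexConjugate

noncomputable section

namespace ClarkBidisk

instance instMeasurableSpaceCircle : MeasurableSpace Circle := borel Circle

instance instBorelSpaceCircle : BorelSpace Circle := ⟨rfl⟩

/-- The torus `𝕋²`, with its Borel `σ`-algebra. -/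
abbrev Torus : Type := Circle × Circle

/-- A point of the torus, seen as a point of `ℂ²`. -/
def Torus.pt (ζ : Torus) : ℂ × ℂ := ((ζ.1 : ℂ), (ζ.2 : ℂ))

/-- The open bidisk `𝔻²`. -/
def bidisk : Set (ℂ × ℂ) := {z | ‖z.1‖ < 1 ∧ ‖z.2‖ < 1}

/-- Normalized Lebesgue measure `m` on `𝕋`. -/
def circleMeasure : Measure Circle :=
  (AddCircle.haarAddCircle : Measure UnitAddCircle).map AddCircle.toCircle

instance instIsProbabilityMeasureCircle : IsProbabilityMeasure circleMeasure :=
  Measure.isProbabilityMeasure_map AddCircle.continuous_toCircle.measurable.aemeasurable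

/-- Normalized Lebesgue measure `m₂` on `𝕋²`. -/
def torusMeasure : Measure Torus := circleMeasure.prod circleMeasure

instance instIsProbabilityMeasureTorus : IsProbabilityMeasure torusMeasure :=
  inferInstanceAs (IsProbabilityMeasure (circleMeasure.prod circleMeasure))

/-! ### Kernels -/

/-- The Poisson kernel `P(z, ζ)` of the bidisk. -/
def bidiskPoissonKernel (z : ℂ × ℂ) (ζ : Torus) : ℝ :=
  ((1 - ‖z.1‖ ^ 2) * (1 - ‖z.2‖ ^ 2)) /
    (‖(ζ.1 : ℂ) - z.1‖ ^ 2 * ‖(ζ.2 : ℂ) - z.2‖ ^ 2)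

/-- The Cauchy kernel `C_w(z)` of the bidisk. -/
def bidiskCauchyKernel (w z : ℂ × ℂ) : ℂ :=
  1 / ((1 - z.1 * conj w.1) * (1 - z.2 * conj w.2))

/-! ### Hardy space and model space

Functions on `𝔻²` are represented by functions on `ℂ²` that vanish off `𝔻²`. -/

/-- `∫_{𝕋²} f(rζ) conj(g(rζ)) dm₂(ζ)`. -/
def hardyPairing (r : ℝ) (f g : ℂ × ℂ → ℂ) : ℂ :=
  ∫ ζ : Torus, f ((r : ℂ) • ζ.pt) * conj (g ((r : ℂ) • ζ.pt)) ∂torusMeasure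

/-- `∫_{𝕋²} |f(rζ)|² dm₂(ζ)`. -/
def hardyMean (r : ℝ) (f : ℂ × ℂ → ℂ) : ℝ :=
  ∫ ζ : Torus, ‖f ((r : ℂ) • ζ.pt)‖ ^ 2 ∂torusMeasure

/-- The Hardy space `H²(𝔻²)`, as a set. -/
structure MemHardy (f : ℂ × ℂ → ℂ) : Prop where
  analytic : DifferentiableOn ℂ f bidisk
  eq_zero : ∀ z ∉ bidisk, f z = 0
  bounded : BddAbove (Set.range fun r : Set.Ioo (0 : ℝ) 1 => hardyMean r f)

/-- The norm of `H²(𝔻²)`: `‖f‖² = sup_{0<r<1} ∫_{𝕋²} |f(rζ)|² dm₂(ζ)`. -/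
def hardyNorm (f : ℂ × ℂ → ℂ) : ℝ :=
  Real.sqrt (⨆ r : Set.Ioo (0 : ℝ) 1, hardyMean r f)

lemma smul_pt_mem_bidisk {r : ℝ} (h0 : 0 < r) (h1 : r < 1) (ζ : Torus) :
    (r : ℂ) • ζ.pt ∈ bidisk := by
  simp [bidisk, Torus.pt, abs_of_pos h0, Circle.norm_coe, h1]

lemma continuous_pt : Continuous Torus.pt := by
  unfold Torus.pt
  fun_prop

lemma continuous_dilate {f : ℂ × ℂ → ℂ} (hf : DifferentiableOn ℂ f bidisk) {r : ℝ}
    (h0 : 0 < r) (h1 : r < 1) : Continuous fun ζ : Torus => f ((r : ℂ) • ζ.pt) :=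
  hf.continuousOn.comp_continuous (by have := continuous_pt; fun_prop)
    (smul_pt_mem_bidisk h0 h1)

lemma integrable_torus {E : Type*} [NormedAddCommGroup E] {F : Torus → E} (hF : Continuous F) :
    Integrable F torusMeasure :=
  hF.integrable_of_hasCompactSupport (HasCompactSupport.of_compactSpace F)

lemma MemHardy.zero : MemHardy 0 where
  analytic := differentiableOn_const 0
  eq_zero := fun _ _ => rfl
  bounded := ⟨0, by rintro _ ⟨r, rfl⟩; simp [hardyMean]⟩

lemma MemHardy.add {f g : ℂ × ℂ → ℂ} (hf : MemHardy f) (hg : MemHardy g) :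
    MemHardy (f + g) where
  analytic := hf.analytic.add hg.analytic
  eq_zero := fun z hz => by simp [hf.eq_zero z hz, hg.eq_zero z hz]
  bounded := by
    obtain ⟨a, ha⟩ := hf.bounded
    obtain ⟨b, hb⟩ := hg.bounded
    refine ⟨2 * a + 2 * b, ?_⟩
    rintro _ ⟨r, rfl⟩
    have h1 := ha ⟨r, rfl⟩
    have h2 := hb ⟨r, rfl⟩
    have cf := continuous_dilate hf.analytic r.2.1 r.2.2
    have cg := continuous_dilate hg.analytic r.2.1 r.2.2
    have If : Integrable (fun ζ : Torus => 2 * ‖f ((r : ℂ) • ζ.pt)‖ ^ 2) torusMeasure :=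
      (integrable_torus (cf.norm.pow 2)).const_mul 2
    have Ig : Integrable (fun ζ : Torus => 2 * ‖g ((r : ℂ) • ζ.pt)‖ ^ 2) torusMeasure :=
      (integrable_torus (cg.norm.pow 2)).const_mul 2
    have key : hardyMean r (f + g) ≤ 2 * hardyMean r f + 2 * hardyMean r g := by
      unfold hardyMean
      rw [← integral_const_mul, ← integral_const_mul, ← integral_add If Ig]
      refine integral_mono (integrable_torus ((cf.add cg).norm.pow 2)) (If.add Ig) fun ζ => ?_
      have h := norm_add_le (f ((r : ℂ) • ζ.pt)) (g ((r : ℂ) • ζ.pt))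
      simp only [Pi.add_apply]
      nlinarith [sq_nonneg (‖f ((r : ℂ) • ζ.pt)‖ - ‖g ((r : ℂ) • ζ.pt)‖),
        norm_nonneg (f ((r : ℂ) • ζ.pt) + g ((r : ℂ) • ζ.pt))]
    simp only at h1 h2 ⊢
    linarith

lemma MemHardy.smul {f : ℂ × ℂ → ℂ} (c : ℂ) (hf : MemHardy f) : MemHardy (c • f) where
  analytic := hf.analytic.const_smul c
  eq_zero := fun z hz => by simp [hf.eq_zero z hz]
  bounded := by
    obtain ⟨a, ha⟩ := hf.bounded
    refine ⟨‖c‖ ^ 2 * a, ?_⟩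
    rintro _ ⟨r, rfl⟩
    have h1 := ha ⟨r, rfl⟩
    have key : hardyMean r (c • f) = ‖c‖ ^ 2 * hardyMean r f := by
      simp only [hardyMean, Pi.smul_apply, smul_eq_mul, norm_mul, mul_pow, integral_const_mul]
    simp only at h1 ⊢
    rw [key]
    gcongr

/-- The model space `K_φ = H²(𝔻²) ⊖ φ H²(𝔻²)`. The inner product of `f, h ∈ H²(𝔻²)` is
`lim_{r → 1} ∫_{𝕋²} f(rζ) conj(h(rζ)) dm₂(ζ)`. (If `φ` is bounded and analytic on `𝔻²`, then
`φ g ∈ H²(𝔻²)` for all `g ∈ H²(𝔻²)`.) -/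
def modelSpace (φ : ℂ × ℂ → ℂ) : Submodule ℂ (ℂ × ℂ → ℂ) where
  carrier := {f | MemHardy f ∧ ∀ g, MemHardy g → MemHardy (φ * g) →
    Tendsto (fun r : ℝ => hardyPairing r f (φ * g)) (𝓝[<] 1) (𝓝 0)}
  zero_mem' := ⟨MemHardy.zero, fun g _ _ => by simp [hardyPairing]⟩
  add_mem' := by
    rintro f₁ f₂ ⟨h₁, o₁⟩ ⟨h₂, o₂⟩
    refine ⟨h₁.add h₂, fun g hg hφ => ?_⟩
    have h := (o₁ g hg hφ).add (o₂ g hg hφ)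
    rw [add_zero] at h
    refine h.congr' ?_
    filter_upwards [Ioo_mem_nhdsLT (zero_lt_one' ℝ)] with r hr
    have cg := Complex.continuous_conj.comp (continuous_dilate hφ.analytic hr.1 hr.2)
    have h := integral_add
      (integrable_torus ((continuous_dilate h₁.analytic hr.1 hr.2).mul cg))
      (integrable_torus ((continuous_dilate h₂.analytic hr.1 hr.2).mul cg))
    simp only [Pi.mul_apply, Function.comp_apply] at h
    simp only [hardyPairing, Pi.add_apply, Pi.mul_apply, add_mul, ← h]
  smul_mem' := by
    rintro c f ⟨h₁, o₁⟩
    refine ⟨h₁.smul c, fun g hg hφ => ?_⟩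
    have h := (o₁ g hg hφ).const_mul c
    rw [mul_zero] at h
    refine h.congr fun r => ?_
    simp only [hardyPairing, ← integral_const_mul, Pi.smul_apply, smul_eq_mul, mul_assoc]

/-- The reproducing kernel `k_w(z) = (1 - conj(φ(w)) φ(z)) C_w(z)` of `K_φ`. -/
def modelKernel (φ : ℂ × ℂ → ℂ) (w : ℂ × ℂ) : ℂ × ℂ → ℂ :=
  bidisk.indicator fun z => (1 - conj (φ w) * φ z) * bidiskCauchyKernel w z

/-! ### Rational inner functions -/

/-- The value `p(z₁, z₂)`. -/
def evalAt (p : MvPolynomial (Fin 2) ℂ) (z : ℂ × ℂ) : ℂ := MvPolynomial.eval ![z.1, z.2] p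

/-- The `(m₁, m₂)`-reflection `z₁^{m₁} z₂^{m₂} conj(p(1 / conj z₁, 1 / conj z₂))` of a
polynomial `p` of degree at most `(m₁, m₂)`. -/
def reflection (m₁ m₂ : ℕ) (p : MvPolynomial (Fin 2) ℂ) : MvPolynomial (Fin 2) ℂ :=
  ∑ k ∈ p.support, MvPolynomial.C (conj (p.coeff k)) *
    MvPolynomial.X 0 ^ (m₁ - k 0) * MvPolynomial.X 1 ^ (m₂ - k 1)

/-- `φ` is, on `𝔻²`, the rational inner function `γ p̃ / p` of degree `(m₁, m₂)`: here
`γ ∈ 𝕋`, `p` has no zeros on `𝔻²`, `p̃` is the `(m₁, m₂)`-reflection of `p`, and `p`, `p̃` have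
no common factor. As `p(0, 0) ≠ 0`, the degree of `p̃` is exactly `(m₁, m₂)`. -/
structure IsRIF (φ : ℂ × ℂ → ℂ) (p : MvPolynomial (Fin 2) ℂ) (m₁ m₂ : ℕ) : Prop where
  degree_fst : p.degreeOf 0 ≤ m₁
  degree_snd : p.degreeOf 1 ≤ m₂
  ne_zero : ∀ z ∈ bidisk, evalAt p z ≠ 0
  no_common_factor : IsRelPrime (reflection m₁ m₂ p) p
  eq_div : ∃ γ : Circle, ∀ z ∈ bidisk,
    φ z = (γ : ℂ) * (evalAt (reflection m₁ m₂ p) z / evalAt p z)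

/-! ### Non-tangential limits, exceptional and generic values -/

/-- `f` has the non-tangential limit `L` at `ζ ∈ 𝕋²`: `f(z) → L` as `z ∈ 𝔻²` tends to `ζ` inside
any product `{z : |z_j - ζ_j| < M (1 - |z_j|), j = 1, 2}` of Stolz regions. -/
def HasNTLimit (f : ℂ × ℂ → ℂ) (ζ : Torus) (L : ℂ) : Prop :=
  ∀ M : ℝ, Tendsto f
    (𝓝[{z | z ∈ bidisk ∧ ‖z.1 - ζ.1‖ < M * (1 - ‖z.1‖) ∧ ‖z.2 - ζ.2‖ < M * (1 - ‖z.2‖)}] ζ.pt)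
    (𝓝 L)

/-- `α` is an exceptional value of the rational inner function `φ` with denominator `p`:
`φ*(τ) = α` at some singularity of `φ`, that is, at some zero `τ` of `p` on `𝕋²`. -/
def IsExceptional (φ : ℂ × ℂ → ℂ) (p : MvPolynomial (Fin 2) ℂ) (α : Circle) : Prop :=
  ∃ τ : Torus, evalAt p τ.pt = 0 ∧ HasNTLimit φ τ α

/-- `α` is a generic value if it is not exceptional. -/
def IsGeneric (φ : ℂ × ℂ → ℂ) (p : MvPolynomial (Fin 2) ℂ) (α : Circle) : Prop :=
  ¬ IsExceptional φ p α

/-! ### Clark measures and the embedding of the model space -/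

/-- `σ` is a Clark measure of `φ` at `α`. -/
structure IsClarkMeasure (φ : ℂ × ℂ → ℂ) (α : Circle) (σ : Measure Torus) : Prop where
  finite : IsFiniteMeasure σ
  poisson : ∀ z ∈ bidisk,
    ∫ ζ, bidiskPoissonKernel z ζ ∂σ = (1 - ‖φ z‖ ^ 2) / ‖(α : ℂ) - φ z‖ ^ 2

/-- `J` preserves norms, the model space carrying the norm of `H²(𝔻²)`. -/
def IsIsometric {φ : ℂ × ℂ → ℂ} {σ : Measure Torus} (J : modelSpace φ →ₗ[ℂ] Lp ℂ 2 σ) : Prop :=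
  ∀ f : modelSpace φ, ‖J f‖ = hardyNorm f

/-- `J` is unitary: an isometry onto `L²(σ)`. -/
def IsUnitaryMap {φ : ℂ × ℂ → ℂ} {σ : Measure Torus} (J : modelSpace φ →ₗ[ℂ] Lp ℂ 2 σ) : Prop :=
  IsIsometric J ∧ Function.Surjective J

/-- `J` is the isometric linear map `K_φ → L²(σ)` with `J k_w = (1 - α conj(φ(w))) C_w`
for all `w ∈ 𝔻²`. -/
structure IsClarkEmbedding (φ : ℂ × ℂ → ℂ) (α : Circle) (σ : Measure Torus)
    (J : modelSpace φ →ₗ[ℂ] Lp ℂ 2 σ) : Prop where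
  isometric : IsIsometric J
  kernel : ∀ w ∈ bidisk, ∃ hw : modelKernel φ w ∈ modelSpace φ,
    J ⟨modelKernel φ w, hw⟩ =ᵐ[σ]
      fun ζ : Torus => (1 - (α : ℂ) * conj (φ w)) * bidiskCauchyKernel w ζ.pt

end ClarkBidisk

end

open ClarkBidisk

open MeasureTheory Filter Topology Complex
open scoped ComplexConjugate

noncomputable section

namespace ClarkBidisk

section

open Metric

/-! ### Integration over the circle -/

/-! Write `p = p₀(z₁) + z₂ p₁(z₁)`. The level polynomial `α p - γ p̃` is again linear in `z₂`, and
on the circle its two coefficients have equal modulus. Hence over each `ζ₁ ∈ 𝕋` the level set is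
either one point `β(ζ₁)` or, when both coefficients vanish, a whole line `{τ} × 𝕋`. Let `Z` be the
finite set of such `τ`. A Hopf-type argument shows that these zeros are simple, and the residue `c τ
> 0` does not depend on `z₂`, because a fraction linear in `z₂` that is real on the disk is constant
(`RIFData.exists_pos_residue`). Partial fractions of `(α + φ) / (α - φ)` in `z₁` then give the Clark
measure explicitly: a continuous density `w` on the graph of `β`, plus `c τ` times Lebesgue measure
on each line over `Z` (`RIFData.exists_clarkData`). Uniqueness holds because Poisson integrals
determine Fourier coefficients.

Polarizing the Poisson identity that defines the measure shows that the vectors `(1 - α conj (φ w))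
C_w` in `L²(σ)` have the same Gram matrix as the kernels `k_w` (`IsClarkMeasure.inner_eq`). The
kernels are total in the model space, so there is exactly one isometry matching the two families;
its range is the closed span of these vectors (`IsClarkEmbedding.range_eq`), and `f z` is the inner
product of `J f` with the vector at `z`.

For the boundary values, `p(z) f(z)` is written as a finite combination of one-variable Cauchy
integrals of `L²` functions, with polynomial or rational coefficients. On the curve a Bezoutian
identity separates the two variables (`ClarkData.exists_curve_decomposition`). Fatou's theorem gives
non-tangential limits almost everywhere. The limit depends on `J f` through a bounded operator and
is the expected one on the kernels, hence on the whole range.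

If `Z` is empty, `b₁` has a zero in the disk, a Blaschke factor and its conjugate both lie in the
closed algebra generated by `ζ` and `β`, and Stone–Weierstrass makes the range of `J` dense, hence
everything. If `τ ∈ Z`, the range restricted to the line over `τ` contains only functions analytic
in `ζ₂`, so `J` is not onto. Finally `Z` is nonempty exactly when `α` is exceptional: the mass on a
line forces `φ → α` at all its points, and each singularity lies on a line of this kind for the
value that `φ` takes there. -/

lemma integral_circleMeasure {E : Type*} [NormedAddCommGroup E] [NormedSpace ℝ E]
    (f : ℂ → E) : ∫ ζ : Circle, f ζ ∂circleMeasure = Real.circleAverage f 0 1 := by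
  have hemb : MeasurableEmbedding (AddCircle.toCircle : UnitAddCircle → Circle) :=
    ((AddCircle.continuous_toCircle).isClosedEmbedding
      (AddCircle.injective_toCircle one_ne_zero)).measurableEmbedding
  rw [circleMeasure, hemb.integral_map, AddCircle.integral_haarAddCircle,
    ← AddCircle.intervalIntegral_preimage (1 : ℝ) 0, Real.circleAverage_def]
  simp only [AddCircle.toCircle_apply_mk, Circle.coe_exp, circleMap, inv_one, one_smul, zero_add,
    ofReal_one, one_mul, div_one]
  have := intervalIntegral.integral_comp_mul_left (a := 0) (b := 1)
    (fun θ : ℝ => f (cexp (θ * I))) (c := 2 * Real.pi) (by positivity)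
  simpa using this

instance instNoAtomsCircle : NullSingletonClass circleMeasure where
  measure_singleton x := by
    have hemb : MeasurableEmbedding (AddCircle.toCircle : UnitAddCircle → Circle) :=
      ((AddCircle.continuous_toCircle).isClosedEmbedding
        (AddCircle.injective_toCircle one_ne_zero)).measurableEmbedding
    rw [circleMeasure, hemb.map_apply]
    have hle : (AddCircle.haarAddCircle : Measure UnitAddCircle) = volume := by
      rw [AddCircle.volume_eq_smul_haarAddCircle]; simp
    rw [hle]
    have hs : (AddCircle.toCircle ⁻¹' {x} : Set UnitAddCircle).Subsingleton := fun a ha b hb =>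
      AddCircle.injective_toCircle one_ne_zero (ha.trans hb.symm)
    rcases hs.eq_empty_or_singleton with h | ⟨y, h⟩
    · simp [h]
    · rw [h, ← closedBall_zero, AddCircle.volume_closedBall]; simp

lemma integrable_circle {E : Type*} [NormedAddCommGroup E] {F : Circle → E} (hF : Continuous F) :
    Integrable F circleMeasure :=
  hF.integrable_of_hasCompactSupport (HasCompactSupport.of_compactSpace F)

/-- The Poisson kernel of the disk. -/
def poisson (z : ℂ) (ζ : Circle) : ℝ := (1 - ‖z‖ ^ 2) / ‖(ζ : ℂ) - z‖ ^ 2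

lemma circle_sub_ne_zero {z : ℂ} (hz : ‖z‖ < 1) (ζ : Circle) : (ζ : ℂ) - z ≠ 0 := by
  intro h
  have := Circle.norm_coe ζ
  rw [sub_eq_zero.1 h] at this
  linarith

lemma one_sub_mul_ne_zero {z w : ℂ} (hz : ‖z‖ < 1) (hw : ‖w‖ ≤ 1) : 1 - z * w ≠ 0 := by
  intro h
  have h1 : ‖z * w‖ = 1 := by rw [← sub_eq_zero.1 h]; simp
  rw [norm_mul] at h1
  nlinarith [norm_nonneg z, norm_nonneg w]

lemma norm_one_sub_mul_conj (z : ℂ) (ζ : Circle) :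
    ‖1 - z * conj (ζ : ℂ)‖ = ‖(ζ : ℂ) - z‖ := by
  have h : (ζ : ℂ) - z = ζ * (1 - z * conj (ζ : ℂ)) := by
    have : (ζ : ℂ) * conj (ζ : ℂ) = 1 := by
      rw [mul_conj, normSq_eq_norm_sq, Circle.norm_coe]; simp
    linear_combination z * this
  rw [h, norm_mul, Circle.norm_coe, one_mul]

lemma poisson_pos {z : ℂ} (hz : ‖z‖ < 1) (ζ : Circle) : 0 < poisson z ζ := by
  have := circle_sub_ne_zero hz ζ
  have h2 : 0 < 1 - ‖z‖ ^ 2 := by nlinarith [norm_nonneg z]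
  unfold poisson
  positivity

lemma continuous_poisson {z : ℂ} (hz : ‖z‖ < 1) : Continuous (poisson z) := by
  unfold poisson
  refine Continuous.div (by fun_prop) (by fun_prop) fun ζ => ?_
  have := circle_sub_ne_zero hz ζ
  positivity

lemma bidiskPoissonKernel_eq (z : ℂ × ℂ) (ζ : Torus) :
    bidiskPoissonKernel z ζ = poisson z.1 ζ.1 * poisson z.2 ζ.2 := by
  rw [bidiskPoissonKernel, poisson, poisson, div_mul_div_comm]

/-- Poisson formula for functions holomorphic in the disk and continuous up to the boundary. -/
lemma integral_poisson_mul {f : ℂ → ℂ} (hf : DiffContOnCl ℂ f (ball 0 1)) {z : ℂ} (hz : ‖z‖ < 1) :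
    ∫ ζ : Circle, (poisson z ζ : ℂ) * f ζ ∂circleMeasure = f z := by
  have h := hf.circleAverage_poissonKernel_smul (w := z) (by simpa using hz)
  rw [← h, ← integral_circleMeasure]
  refine integral_congr_ae (Eventually.of_forall fun ζ => ?_)
  simp [poissonKernel, poisson, Circle.norm_coe]

lemma integral_poisson {z : ℂ} (hz : ‖z‖ < 1) : ∫ ζ, poisson z ζ ∂circleMeasure = 1 := by
  have h := integral_poisson_mul (f := fun _ => 1) (diffContOnCl_const) hz
  simp only [mul_one] at h
  rw [integral_complex_ofReal] at h
  exact_mod_cast h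

/-- Cauchy formula. -/
lemma integral_cauchy {f : ℂ → ℂ} (hf : DiffContOnCl ℂ f (ball 0 1)) {z : ℂ} (hz : ‖z‖ < 1) :
    ∫ ζ : Circle, f ζ * (1 - z * conj (ζ : ℂ))⁻¹ ∂circleMeasure = f z := by
  have h := DiffContOnCl.circleAverage_smul_div (c := 0) (R := 1) (w := z) (f := f)
    (by simpa using hf) (by simpa using hz)
  rw [← h, ← integral_circleMeasure]
  refine integral_congr_ae (Eventually.of_forall fun ζ => ?_)
  have h1 : (ζ : ℂ) - z = ζ * (1 - z * conj (ζ : ℂ)) := by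
    have : (ζ : ℂ) * conj (ζ : ℂ) = 1 := by
      rw [mul_conj, normSq_eq_norm_sq, Circle.norm_coe]; simp
    linear_combination z * this
  simp only [sub_zero, smul_eq_mul]
  rw [h1, div_mul_eq_div_div, div_self ζ.coe_ne_zero]
  ring

/-- Mean value property. -/
lemma integral_circle_eq {f : ℂ → ℂ} (hf : DiffContOnCl ℂ f (ball 0 1)) :
    ∫ ζ : Circle, f ζ ∂circleMeasure = f 0 := by
  simpa using integral_cauchy hf (z := 0) (by simp)

lemma re_poisson_of_diffContOnCl {f : ℂ → ℂ} (hf : DiffContOnCl ℂ f (ball 0 1)) {z : ℂ}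
    (hz : ‖z‖ < 1) : ∫ ζ : Circle, poisson z ζ * (f ζ).re ∂circleMeasure = (f z).re := by
  rw [← integral_poisson_mul hf hz]
  have hc : Continuous fun ζ : Circle => f ζ :=
    hf.continuousOn.comp_continuous (by fun_prop) fun ζ => by
      rw [closure_ball _ one_ne_zero]; simp [Circle.norm_coe]
  have hi : Integrable (fun ζ : Circle => (poisson z ζ : ℂ) * f ζ) circleMeasure :=
    integrable_circle ((continuous_ofReal.comp (continuous_poisson hz)).mul hc)
  rw [← RCLike.re_eq_complex_re, ← integral_re hi]
  simp

lemma conj_coe_circle (ζ : Circle) : conj (ζ : ℂ) = ((ζ⁻¹ : Circle) : ℂ) := by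
  rw [Circle.coe_inv_eq_conj]

lemma circle_mul_conj (ζ : Circle) : (ζ : ℂ) * conj (ζ : ℂ) = 1 := by
  rw [mul_conj, normSq_eq_norm_sq, Circle.norm_coe]; simp

/-- Splits the kernel into the Cauchy kernel and a co-analytic remainder that vanishes at `z = 0`.
On the Hardy space the remainder is invisible, which makes Cauchy integrals accessible to Fatou's
theorem. -/
lemma poisson_eq_add {z : ℂ} (hz : ‖z‖ < 1) (ζ : Circle) :
    (poisson z ζ : ℂ) = (1 - z * conj (ζ : ℂ))⁻¹ + conj z * ζ * (1 - conj z * ζ)⁻¹ := by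
  have h1 : 1 - z * conj (ζ : ℂ) ≠ 0 := one_sub_mul_ne_zero hz (by simp [Circle.norm_coe])
  have h2 : 1 - conj z * (ζ : ℂ) ≠ 0 := one_sub_mul_ne_zero (by simpa using hz) (by simp [Circle.norm_coe])
  have h3 : (‖(ζ : ℂ) - z‖ : ℂ) ^ 2 = (1 - z * conj (ζ : ℂ)) * (1 - conj z * ζ) := by
    rw [← norm_one_sub_mul_conj, ← Complex.mul_conj']; simp
  have h4 : (‖z‖ : ℂ) ^ 2 = z * conj z := by rw [← Complex.mul_conj']
  rw [poisson]
  push_cast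
  rw [h3, h4]
  field_simp
  linear_combination (z * conj z) * circle_mul_conj ζ

end

section

open Metric

/-! ### Measures determined by Fourier coefficients or Poisson integrals -/

open BoundedContinuousFunction in
/-- A finite measure is determined by the integrals of the characters `u ^ j * v ^ k` if the
unimodular functions `u, v` separate points. -/
lemma measure_ext_of_characters {X : Type*} [TopologicalSpace X] [PolishSpace X]
    [MeasurableSpace X] [BorelSpace X] {u v : X → Circle} (hu : Continuous u) (hv : Continuous v)
    (huv : ∀ x y, u x = u y → v x = v y → x = y) {μ ν : Measure X} [IsFiniteMeasure μ]
    [IsFiniteMeasure ν]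
    (h : ∀ j k : ℤ, ∫ x, ((u x ^ j * v x ^ k : Circle) : ℂ) ∂μ
      = ∫ x, ((u x ^ j * v x ^ k : Circle) : ℂ) ∂ν) : μ = ν := by
  let U : X →ᵇ ℂ := BoundedContinuousFunction.ofNormedAddCommGroup (fun x => (u x : ℂ))
    (by fun_prop) 1 (by simp [Circle.norm_coe])
  let V : X →ᵇ ℂ := BoundedContinuousFunction.ofNormedAddCommGroup (fun x => (v x : ℂ))
    (by fun_prop) 1 (by simp [Circle.norm_coe])
  let A : StarSubalgebra ℂ (X →ᵇ ℂ) := StarAlgebra.adjoin ℂ {U, V}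
  refine ext_of_forall_mem_subalgebra_integral_eq_of_polish (𝕜 := ℂ) (A := A) ?_ ?_
  · intro x y hxy
    have hor : u x ≠ u y ∨ v x ≠ v y := by
      by_contra hcon
      push Not at hcon
      exact hxy (huv x y hcon.1 hcon.2)
    rcases hor with h1 | h1
    · refine ⟨_, ⟨toContinuousMapStarₐ ℂ U, ⟨U, ?_, rfl⟩, rfl⟩, ?_⟩
      · exact StarAlgebra.subset_adjoin ℂ _ (by simp)
      · simpa [U] using fun hh => h1 (Circle.ext hh)
    · refine ⟨_, ⟨toContinuousMapStarₐ ℂ V, ⟨V, ?_, rfl⟩, rfl⟩, ?_⟩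
      · exact StarAlgebra.subset_adjoin ℂ _ (by simp)
      · simpa [V] using fun hh => h1 (Circle.ext hh)
  · intro g hg
    have hg' : g ∈ Submodule.span ℂ
        (Submonoid.closure (({U, V} : Set (X →ᵇ ℂ)) ∪ star {U, V}) : Set (X →ᵇ ℂ)) := by
      rw [← Algebra.adjoin_eq_span]
      exact hg
    -- The conjugate of a unimodular function is its inverse, so the star-closed monoid consists of
    -- integer powers.
    have hmon : ∀ q ∈ Submonoid.closure (({U, V} : Set (X →ᵇ ℂ)) ∪ star {U, V}),
        ∃ j k : ℤ, ∀ x, q x = ((u x ^ j * v x ^ k : Circle) : ℂ) := by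
      intro q hq
      induction hq using Submonoid.closure_induction with
      | mem q hq =>
        rcases hq with hq | hq
        · rcases hq with rfl | rfl
          · exact ⟨1, 0, fun x => by simp [U]⟩
          · exact ⟨0, 1, fun x => by simp [V]⟩
        · rw [Set.mem_star] at hq
          rcases hq with hq | hq
          · refine ⟨-1, 0, fun x => ?_⟩
            rw [← star_star q, hq]
            simp [U, ← Circle.coe_inv_eq_conj]
          · refine ⟨0, -1, fun x => ?_⟩
            rw [← star_star q, Set.mem_singleton_iff.1 hq]
            simp [V, ← Circle.coe_inv_eq_conj]
      | one => exact ⟨0, 0, fun x => by simp⟩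
      | mul a b _ _ ha hb =>
        obtain ⟨j, k, h1⟩ := ha
        obtain ⟨j', k', h2⟩ := hb
        refine ⟨j + j', k + k', fun x => ?_⟩
        rw [BoundedContinuousFunction.mul_apply, h1, h2, ← Circle.coe_mul, zpow_add, zpow_add]
        congr 1
        exact mul_mul_mul_comm _ _ _ _
    clear hg
    induction hg' using Submodule.span_induction with
    | mem q hq =>
      obtain ⟨j, k, h1⟩ := hmon q hq
      simp_rw [h1]
      exact h j k
    | zero => simp
    | add a b _ _ ha hb =>
      simp only [BoundedContinuousFunction.add_apply]
      rw [integral_add (a.integrable μ) (b.integrable μ),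
        integral_add (a.integrable ν) (b.integrable ν), ha, hb]
    | smul c a _ ha =>
      simp only [BoundedContinuousFunction.smul_apply, integral_smul, ha]

/-- This symmetry turns an integral over the base point of the kernel into an ordinary Poisson
integral. -/
lemma poisson_smul_comm (r : ℝ) (η ζ : Circle) :
    poisson ((r : ℂ) * η) ζ = poisson ((r : ℂ) * ζ) η := by
  have h : ‖(ζ : ℂ) - r * η‖ = ‖(η : ℂ) - r * ζ‖ := by
    rw [← norm_one_sub_mul_conj, ← norm_one_sub_mul_conj, ← Complex.norm_conj]
    congr 1
    simp
    ring
  simp only [poisson, h, norm_mul, Circle.norm_coe]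

lemma norm_ofReal_mul_circle_lt {r : ℝ} (h0 : 0 ≤ r) (h1 : r < 1) (ζ : Circle) :
    ‖(r : ℂ) * ζ‖ < 1 := by
  rw [norm_mul, Circle.norm_coe, mul_one, Complex.norm_real, Real.norm_of_nonneg h0]; exact h1

/-- Nonnegative powers are analytic and obey the Poisson formula; negative powers follow by
conjugation, the kernel being real. -/
lemma integral_poisson_zpow {r : ℝ} (h0 : 0 ≤ r) (h1 : r < 1) (ζ : Circle) (j : ℤ) :
    ∫ η : Circle, (poisson ((r : ℂ) * η) ζ : ℂ) * ((η ^ j : Circle) : ℂ) ∂circleMeasure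
      = (r : ℂ) ^ j.natAbs * ((ζ ^ j : Circle) : ℂ) := by
  have hz := norm_ofReal_mul_circle_lt h0 h1 ζ
  simp_rw [poisson_smul_comm r _ ζ]
  have hnat : ∀ k : ℕ, ∫ η : Circle, (poisson ((r : ℂ) * ζ) η : ℂ) * (η : ℂ) ^ k ∂circleMeasure
      = (r : ℂ) ^ k * (ζ : ℂ) ^ k := fun k => by
    rw [integral_poisson_mul (f := fun z => z ^ k) ((differentiable_id.pow k).diffContOnCl) hz,
      mul_pow]
  obtain ⟨k, rfl | rfl⟩ := j.eq_nat_or_neg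
  · simpa using hnat k
  · have h := congrArg conj (hnat k)
    rw [← integral_conj] at h
    simpa [Circle.coe_inv_eq_conj, ← Circle.coe_inv, ← inv_pow] using h

/-- The characters of the torus. -/
def character (j k : ℤ) (ζ : Torus) : ℂ := ((ζ.1 ^ j * ζ.2 ^ k : Circle) : ℂ)

lemma continuous_character (j k : ℤ) : Continuous (character j k) := by
  unfold character
  have h : Continuous fun ζ : Torus => ζ.1 ^ j * ζ.2 ^ k :=
    (continuous_fst.zpow j).mul (continuous_snd.zpow k)
  exact continuous_subtype_val.comp h

lemma continuous_poisson_dilate {X : Type*} [TopologicalSpace X] {r : ℝ} (h0 : 0 ≤ r) (h1 : r < 1)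
    {f g : X → Circle} (hf : Continuous f) (hg : Continuous g) :
    Continuous fun x => poisson ((r : ℂ) * f x) (g x) := by
  unfold poisson
  refine Continuous.div (by fun_prop) (by fun_prop) fun x => ?_
  have := circle_sub_ne_zero (norm_ofReal_mul_circle_lt h0 h1 (f x)) (g x)
  positivity

lemma integral_torusMeasure_mul (f g : Circle → ℂ) :
    ∫ η : Torus, f η.1 * g η.2 ∂torusMeasure =
      (∫ x, f x ∂circleMeasure) * ∫ y, g y ∂circleMeasure :=
  integral_prod_mul f g

lemma integral_bidiskPoissonKernel_character {r : ℝ} (h0 : 0 ≤ r) (h1 : r < 1) (j k : ℤ)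
    (ζ : Torus) :
    ∫ η : Torus, (bidiskPoissonKernel ((r : ℂ) • η.pt) ζ : ℂ) * character j k η ∂torusMeasure
      = (r : ℂ) ^ (j.natAbs + k.natAbs) * character j k ζ := by
  have := integral_torusMeasure_mul
    (fun x => (poisson ((r : ℂ) * x) ζ.1 : ℂ) * ((x ^ j : Circle) : ℂ))
    (fun x => (poisson ((r : ℂ) * x) ζ.2 : ℂ) * ((x ^ k : Circle) : ℂ))
  rw [integral_poisson_zpow h0 h1, integral_poisson_zpow h0 h1] at this
  calc _ = _ := by
        refine integral_congr_ae (Eventually.of_forall fun η => ?_)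
        simp only [bidiskPoissonKernel_eq, character, Torus.pt, Prod.smul_mk, smul_eq_mul]
        push_cast
        rw [mul_mul_mul_comm]
    _ = _ := this
    _ = _ := by
        simp only [character]; push_cast; rw [pow_add]; ring

/-- Fubini: the Poisson integral on the torus of radius `r` has the Fourier coefficients of the
measure, damped by powers of `r`. -/
lemma integral_character_of_poisson {σ : Measure Torus} [IsFiniteMeasure σ] {r : ℝ} (h0 : 0 ≤ r)
    (h1 : r < 1) (j k : ℤ) :
    (r : ℂ) ^ (j.natAbs + k.natAbs) * ∫ ζ, character j k ζ ∂σ =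
      ∫ η : Torus, ((∫ ζ, bidiskPoissonKernel ((r : ℂ) • η.pt) ζ ∂σ : ℝ) : ℂ) * character j k η
        ∂torusMeasure := by
  rw [← integral_const_mul]
  simp_rw [← integral_bidiskPoissonKernel_character h0 h1 j k, ← integral_complex_ofReal,
    ← integral_mul_const]
  rw [integral_integral_swap]
  have hP1 : Continuous fun x : Torus × Torus => poisson ((r : ℂ) * x.2.1) x.1.1 :=
    continuous_poisson_dilate h0 h1 continuous_snd.fst continuous_fst.fst
  have hP2 : Continuous fun x : Torus × Torus => poisson ((r : ℂ) * x.2.2) x.1.2 :=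
    continuous_poisson_dilate h0 h1 continuous_snd.snd continuous_fst.snd
  have hc : Continuous fun x : Torus × Torus =>
      ((poisson ((r : ℂ) * x.2.1) x.1.1 * poisson ((r : ℂ) * x.2.2) x.1.2 : ℝ) : ℂ) *
        character j k x.2 :=
    (continuous_ofReal.comp (hP1.mul hP2)).mul ((continuous_character j k).comp continuous_snd)
  have hi : Integrable (fun x : Torus × Torus =>
      ((poisson ((r : ℂ) * x.2.1) x.1.1 * poisson ((r : ℂ) * x.2.2) x.1.2 : ℝ) : ℂ) *
        character j k x.2) (σ.prod torusMeasure) :=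
    hc.integrable_of_hasCompactSupport (HasCompactSupport.of_compactSpace _)
  refine hi.congr (Eventually.of_forall fun x => ?_)
  simp only [Function.uncurry_def, bidiskPoissonKernel_eq, Torus.pt, Prod.smul_mk, smul_eq_mul]

/-- A finite measure on the torus is determined by its Poisson integral. -/
lemma measure_ext_of_poisson {σ σ' : Measure Torus} [IsFiniteMeasure σ] [IsFiniteMeasure σ']
    (h : ∀ z ∈ bidisk, ∫ ζ, bidiskPoissonKernel z ζ ∂σ = ∫ ζ, bidiskPoissonKernel z ζ ∂σ') :
    σ = σ' := by
  refine measure_ext_of_characters (u := Prod.fst) (v := Prod.snd) continuous_fst continuous_snd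
    (fun x y h1 h2 => Prod.ext h1 h2) fun j k => ?_
  -- Any radius strictly between `0` and `1` would serve; the damping factor only has to be nonzero.
  have e := integral_character_of_poisson (σ := σ) (r := 1 / 2) (by norm_num) (by norm_num) j k
  have e' := integral_character_of_poisson (σ := σ') (r := 1 / 2) (by norm_num) (by norm_num) j k
  have hη : ∀ η : Torus, ∫ ζ, bidiskPoissonKernel (((1 / 2 : ℝ) : ℂ) • η.pt) ζ ∂σ =
      ∫ ζ, bidiskPoissonKernel (((1 / 2 : ℝ) : ℂ) • η.pt) ζ ∂σ' := fun η =>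
    h _ (smul_pt_mem_bidisk (by norm_num) (by norm_num) η)
  simp_rw [hη] at e
  exact mul_left_cancel₀ (by simp) (e.trans e'.symm)

end

section

open Metric

/-! ### Power series on the bidisk -/

/-- The monomial `z₁ ^ i₁ * z₂ ^ i₂`. -/
def mono (i : ℕ × ℕ) (z : ℂ × ℂ) : ℂ := z.1 ^ i.1 * z.2 ^ i.2

lemma continuous_mono (i : ℕ × ℕ) : Continuous (mono i) := by unfold mono; fun_prop

lemma mono_smul (i : ℕ × ℕ) (c : ℂ) (z : ℂ × ℂ) :
    mono i (c • z) = c ^ (i.1 + i.2) * mono i z := by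
  simp only [mono, Prod.smul_fst, Prod.smul_snd, smul_eq_mul, mul_pow, pow_add]
  ring

lemma norm_mono_pt (i : ℕ × ℕ) (ζ : Torus) : ‖mono i ζ.pt‖ = 1 := by
  simp [mono, Torus.pt, Circle.norm_coe]

lemma norm_mono (i : ℕ × ℕ) (z : ℂ × ℂ) : ‖mono i z‖ = ‖z.1‖ ^ i.1 * ‖z.2‖ ^ i.2 := by
  simp [mono]

lemma integral_circle_pow_mul_conj (a b : ℕ) :
    ∫ ζ : Circle, (ζ : ℂ) ^ a * conj ((ζ : ℂ) ^ b) ∂circleMeasure = if a = b then 1 else 0 := by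
  have key : ∀ a b : ℕ, b ≤ a →
      ∫ ζ : Circle, (ζ : ℂ) ^ a * conj ((ζ : ℂ) ^ b) ∂circleMeasure = if a = b then 1 else 0 := by
    intro a b hab
    obtain ⟨c, rfl⟩ := Nat.exists_eq_add_of_le hab
    have h : ∀ ζ : Circle, (ζ : ℂ) ^ (b + c) * conj ((ζ : ℂ) ^ b) = (ζ : ℂ) ^ c := fun ζ => by
      rw [pow_add, map_pow, mul_right_comm, ← mul_pow, circle_mul_conj, one_pow, one_mul]
    simp_rw [h]
    rw [integral_circle_eq (f := fun z => z ^ c) ((differentiable_id.pow c).diffContOnCl)]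
    rcases Nat.eq_zero_or_pos c with rfl | hc
    · simp
    · simp [hc.ne']
  rcases le_total b a with h | h
  · exact key a b h
  · have := congrArg conj (key b a h)
    rw [← integral_conj] at this
    simp only [map_mul, conj_conj, map_pow] at this ⊢
    rw [show (∫ ζ : Circle, (ζ : ℂ) ^ a * conj (ζ : ℂ) ^ b ∂circleMeasure) =
      ∫ ζ : Circle, conj (ζ : ℂ) ^ b * (ζ : ℂ) ^ a ∂circleMeasure by simp_rw [mul_comm], this]
    by_cases hab : a = b
    · simp [hab]
    · simp [hab, Ne.symm hab]

lemma integral_mono_mul_conj (i j : ℕ × ℕ) :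
    ∫ ζ : Torus, mono i ζ.pt * conj (mono j ζ.pt) ∂torusMeasure = if i = j then 1 else 0 := by
  have := integral_torusMeasure_mul (fun x => (x : ℂ) ^ i.1 * conj ((x : ℂ) ^ j.1))
    (fun x => (x : ℂ) ^ i.2 * conj ((x : ℂ) ^ j.2))
  rw [integral_circle_pow_mul_conj, integral_circle_pow_mul_conj] at this
  calc _ = _ := by
        refine integral_congr_ae (Eventually.of_forall fun ζ => ?_)
        simp only [mono, Torus.pt, map_mul]
        rw [mul_mul_mul_comm]
    _ = _ := this
    _ = _ := by
        by_cases h1 : i.1 = j.1 <;> by_cases h2 : i.2 = j.2 <;> simp [h1, h2, Prod.ext_iff]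

/-- Fourier coefficients of the dilate `ζ ↦ f (r ζ)`. -/
def dilateCoeff (r : ℝ) (f : ℂ × ℂ → ℂ) (i : ℕ × ℕ) : ℂ :=
  ∫ ζ : Torus, f ((r : ℂ) • ζ.pt) * conj (mono i ζ.pt) ∂torusMeasure

/-- The sequence `a` consists of the Taylor coefficients of `f` on the bidisk. -/
def HasTaylor (f : ℂ × ℂ → ℂ) (a : ℕ × ℕ → ℂ) : Prop :=
  ∀ z ∈ bidisk, HasSum (fun i => a i * mono i z) (f z)

lemma ofReal_mem_bidisk {r : ℝ} (h0 : 0 ≤ r) (h1 : r < 1) : ((r : ℂ), (r : ℂ)) ∈ bidisk := by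
  simp [bidisk, abs_of_nonneg h0, h1]

lemma mono_ofReal (i : ℕ × ℕ) (r : ℝ) : mono i ((r : ℂ), (r : ℂ)) = (r : ℂ) ^ (i.1 + i.2) := by
  simp [mono, pow_add]

lemma HasTaylor.summable {f : ℂ × ℂ → ℂ} {a : ℕ × ℕ → ℂ} (h : HasTaylor f a) {r : ℝ} (h0 : 0 ≤ r)
    (h1 : r < 1) : Summable fun i => ‖a i‖ * r ^ (i.1 + i.2) := by
  have := (h _ (ofReal_mem_bidisk h0 h1)).summable.norm
  simpa only [norm_mul, mono_ofReal, norm_pow, Complex.norm_real, Real.norm_of_nonneg h0] using this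

lemma HasTaylor.hasSum_dilate {f : ℂ × ℂ → ℂ} {a : ℕ × ℕ → ℂ} (h : HasTaylor f a) {r : ℝ}
    (h0 : 0 < r) (h1 : r < 1) (ζ : Torus) :
    HasSum (fun i => a i * (r : ℂ) ^ (i.1 + i.2) * mono i ζ.pt) (f ((r : ℂ) • ζ.pt)) := by
  have := h _ (smul_pt_mem_bidisk h0 h1 ζ)
  simpa only [mono_smul, mul_assoc] using this

/-- Termwise integration over the torus. -/
lemma hasSum_integral_torus {ι : Type*} [Countable ι] {F : ι → Torus → ℂ} {G : Torus → ℂ}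
    {b : ι → ℝ}
    (hF : ∀ i, Continuous (F i)) (hb : Summable b) (hle : ∀ i ζ, ‖F i ζ‖ ≤ b i)
    (hs : ∀ ζ, HasSum (fun i => F i ζ) (G ζ)) :
    HasSum (fun i => ∫ ζ, F i ζ ∂torusMeasure) (∫ ζ, G ζ ∂torusMeasure) := by
  refine hasSum_integral_of_dominated_convergence (fun i _ => b i)
    (fun i => (hF i).aestronglyMeasurable) (fun i => Eventually.of_forall (hle i))
    (Eventually.of_forall fun _ => hb) (integrable_const _) (Eventually.of_forall hs)

/-- Parseval for dilates. -/
lemma HasTaylor.hasSum_pairing {f g : ℂ × ℂ → ℂ} {b : ℕ × ℕ → ℂ}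
    (hf : DifferentiableOn ℂ f bidisk) (hg : HasTaylor g b) {r : ℝ}
    (h0 : 0 < r) (h1 : r < 1) :
    HasSum (fun i => dilateCoeff r f i * conj (b i * (r : ℂ) ^ (i.1 + i.2)))
      (hardyPairing r f g) := by
  have cf := continuous_dilate hf h0 h1
  obtain ⟨C, hC⟩ := isCompact_univ.exists_bound_of_continuousOn cf.continuousOn
  have h := hasSum_integral_torus
    (F := fun i ζ => f ((r : ℂ) • ζ.pt) * conj (b i * (r : ℂ) ^ (i.1 + i.2) * mono i ζ.pt))
    (G := fun ζ => f ((r : ℂ) • ζ.pt) * conj (g ((r : ℂ) • ζ.pt)))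
    (b := fun i => C * (‖b i‖ * r ^ (i.1 + i.2))) ?_ ((hg.summable h0.le h1).mul_left C) ?_ ?_
  · refine h.congr_fun ?_ |> fun h => h
    intro i
    simp only [dilateCoeff, map_mul]
    rw [← integral_mul_const]
    refine integral_congr_ae (Eventually.of_forall fun ζ => ?_)
    simp only
    ring
  · intro i
    exact cf.mul (continuous_conj.comp
      (continuous_const.mul ((continuous_mono i).comp continuous_pt)))
  · intro i ζ
    simp only [norm_mul, RCLike.norm_conj, norm_mono_pt, norm_pow, Complex.norm_real,
      Real.norm_of_nonneg h0.le, mul_one]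
    gcongr
    exact hC ζ (Set.mem_univ _)
  · intro ζ
    exact ((Complex.hasSum_conj'.2 (hg.hasSum_dilate h0 h1 ζ))).mul_left _

lemma HasTaylor.dilateCoeff_eq {f : ℂ × ℂ → ℂ} {a : ℕ × ℕ → ℂ} (h : HasTaylor f a) {r : ℝ}
    (h0 : 0 < r) (h1 : r < 1) (j : ℕ × ℕ) :
    dilateCoeff r f j = a j * (r : ℂ) ^ (j.1 + j.2) := by
  have h := hasSum_integral_torus
    (F := fun i ζ => a i * (r : ℂ) ^ (i.1 + i.2) * mono i ζ.pt * conj (mono j ζ.pt))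
    (G := fun ζ => f ((r : ℂ) • ζ.pt) * conj (mono j ζ.pt))
    (b := fun i => ‖a i‖ * r ^ (i.1 + i.2)) ?_ (h.summable h0.le h1) ?_ ?_
  · have h2 := h.unique (hasSum_single j fun i hi => ?_)
    · rw [dilateCoeff, h2]
      simp_rw [mul_assoc]
      rw [integral_const_mul, integral_const_mul, integral_mono_mul_conj]
      simp
    · simp_rw [mul_assoc]
      rw [integral_const_mul, integral_const_mul, integral_mono_mul_conj]
      simp [hi]
  · intro i
    exact (continuous_const.mul ((continuous_mono i).comp continuous_pt)).mul
      (continuous_conj.comp ((continuous_mono j).comp continuous_pt))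
  · intro i ζ
    simp [norm_mono_pt, abs_of_pos h0]
  · intro ζ
    exact (h.hasSum_dilate h0 h1 ζ).mul_right _

lemma HasTaylor.unique {f : ℂ × ℂ → ℂ} {a b : ℕ × ℕ → ℂ} (ha : HasTaylor f a)
    (hb : HasTaylor f b) : a = b := by
  funext i
  have h1 := ha.dilateCoeff_eq (r := 1 / 2) (by norm_num) (by norm_num) i
  have h2 := hb.dilateCoeff_eq (r := 1 / 2) (by norm_num) (by norm_num) i
  exact mul_right_cancel₀ (by simp) (h1.symm.trans h2)

lemma isOpen_bidisk : IsOpen bidisk :=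
  (isOpen_lt continuous_fst.norm continuous_const).inter
    (isOpen_lt continuous_snd.norm continuous_const)

lemma diffContOnCl_of_differentiableOn_bidisk {f : ℂ × ℂ → ℂ} (hf : DifferentiableOn ℂ f bidisk)
    {g : ℂ → ℂ × ℂ} (hg : Differentiable ℂ g) (h : ∀ z, ‖z‖ ≤ 1 → g z ∈ bidisk) :
    DiffContOnCl ℂ (fun z => f (g z)) (ball 0 1) := by
  refine DifferentiableOn.diffContOnCl ?_
  rw [closure_ball _ one_ne_zero]
  exact hf.comp hg.differentiableOn fun z hz => h z (by simpa using hz)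

/-- Cauchy formula on the bidisk. -/
lemma cauchy_bidisk {f : ℂ × ℂ → ℂ} (hf : DifferentiableOn ℂ f bidisk) {r : ℝ}
    (h0 : 0 < r) (h1 : r < 1) {z : ℂ × ℂ} (hz : z ∈ bidisk) :
    ∫ ζ : Torus, f ((r : ℂ) • ζ.pt) *
      ((1 - z.1 * conj (ζ.1 : ℂ))⁻¹ * (1 - z.2 * conj (ζ.2 : ℂ))⁻¹) ∂torusMeasure
      = f ((r : ℂ) • z) := by
  have hr : ∀ w : ℂ, ‖w‖ ≤ 1 → ‖(r : ℂ) * w‖ < 1 := fun w hw => by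
    rw [norm_mul, Complex.norm_real, Real.norm_of_nonneg h0.le]
    nlinarith [norm_nonneg w]
  have hc : Continuous fun ζ : Torus => f ((r : ℂ) • ζ.pt) *
      ((1 - z.1 * conj (ζ.1 : ℂ))⁻¹ * (1 - z.2 * conj (ζ.2 : ℂ))⁻¹) := by
    refine (continuous_dilate hf h0 h1).mul (Continuous.mul ?_ ?_)
    · exact Continuous.inv₀ (by fun_prop) fun ζ =>
        one_sub_mul_ne_zero hz.1 (by simp [Circle.norm_coe])
    · exact Continuous.inv₀ (by fun_prop) fun ζ =>
        one_sub_mul_ne_zero hz.2 (by simp [Circle.norm_coe])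
  rw [torusMeasure, integral_prod _ (integrable_torus hc)]
  have hin : ∀ x : Circle, ∫ y : Circle, f ((r : ℂ) • Torus.pt (x, y)) *
      ((1 - z.1 * conj (x : ℂ))⁻¹ * (1 - z.2 * conj (y : ℂ))⁻¹) ∂circleMeasure
      = f ((r : ℂ) * x, (r : ℂ) * z.2) * (1 - z.1 * conj (x : ℂ))⁻¹ := by
    intro x
    have h := integral_cauchy (f := fun w => f ((r : ℂ) * x, (r : ℂ) * w))
      (diffContOnCl_of_differentiableOn_bidisk hf (g := fun w => ((r : ℂ) * x, (r : ℂ) * w))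
        (by fun_prop) fun w hw => ⟨hr _ (by simp [Circle.norm_coe]), hr _ hw⟩) hz.2
    rw [← h, ← integral_mul_const]
    refine integral_congr_ae (Eventually.of_forall fun y => ?_)
    simp only [Torus.pt, Prod.smul_mk, smul_eq_mul]
    ring
  simp only at hin ⊢
  simp_rw [hin]
  exact integral_cauchy (f := fun w => f ((r : ℂ) * w, (r : ℂ) * z.2))
    (diffContOnCl_of_differentiableOn_bidisk hf (g := fun w => ((r : ℂ) * w, (r : ℂ) * z.2))
      (by fun_prop) fun w hw => ⟨hr _ hw, hr _ hz.2.le⟩) hz.1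

lemma hasSum_cauchy {z : ℂ × ℂ} (hz : z ∈ bidisk) (ζ : Torus) :
    HasSum (fun i : ℕ × ℕ => mono i z * conj (mono i ζ.pt))
      ((1 - z.1 * conj (ζ.1 : ℂ))⁻¹ * (1 - z.2 * conj (ζ.2 : ℂ))⁻¹) := by
  have h1 : ‖z.1 * conj (ζ.1 : ℂ)‖ < 1 := by simpa [Circle.norm_coe] using hz.1
  have h2 : ‖z.2 * conj (ζ.2 : ℂ)‖ < 1 := by simpa [Circle.norm_coe] using hz.2
  have g1 := hasSum_geometric_of_norm_lt_one h1
  have g2 := hasSum_geometric_of_norm_lt_one h2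
  refine (g1.mul g2 (summable_mul_of_summable_norm g1.summable.norm g2.summable.norm)).congr_fun ?_
  intro i
  simp only [mono, Torus.pt, map_mul, map_pow, mul_pow]
  ring

lemma summable_norm_mono {z : ℂ × ℂ} (hz : z ∈ bidisk) : Summable fun i => ‖mono i z‖ := by
  simp_rw [norm_mono]
  exact (summable_geometric_of_lt_one (norm_nonneg _) hz.1).mul_of_nonneg
    (summable_geometric_of_lt_one (norm_nonneg _) hz.2) (fun _ => by positivity)
    (fun _ => by positivity)

/-- The geometric expansion of the Cauchy kernel, inserted in the Cauchy formula and integrated term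
by term. -/
lemma hasSum_dilateCoeff {f : ℂ × ℂ → ℂ} (hf : DifferentiableOn ℂ f bidisk) {r : ℝ}
    (h0 : 0 < r) (h1 : r < 1) {z : ℂ × ℂ} (hz : z ∈ bidisk) :
    HasSum (fun i => dilateCoeff r f i * mono i z) (f ((r : ℂ) • z)) := by
  have cf := continuous_dilate hf h0 h1
  obtain ⟨C, hC⟩ := isCompact_univ.exists_bound_of_continuousOn cf.continuousOn
  have h := hasSum_integral_torus
    (F := fun i ζ => f ((r : ℂ) • ζ.pt) * (mono i z * conj (mono i ζ.pt)))
    (G := fun ζ => f ((r : ℂ) • ζ.pt) *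
      ((1 - z.1 * conj (ζ.1 : ℂ))⁻¹ * (1 - z.2 * conj (ζ.2 : ℂ))⁻¹))
    (b := fun i => C * ‖mono i z‖) ?_ ((summable_norm_mono hz).mul_left C) ?_ ?_
  · rw [cauchy_bidisk hf h0 h1 hz] at h
    convert h using 2 with i
    rw [dilateCoeff, ← integral_mul_const]
    refine integral_congr_ae (Eventually.of_forall fun ζ => ?_)
    simp only
    ring
  · intro i
    exact cf.mul (continuous_const.mul (continuous_conj.comp
      ((continuous_mono i).comp continuous_pt)))
  · intro i ζ
    simp only [norm_mul, RCLike.norm_conj, norm_mono_pt, mul_one]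
    gcongr
    exact hC ζ (Set.mem_univ _)
  · intro ζ
    exact (hasSum_cauchy hz ζ).mul_left _

end

/-! ### Taylor coefficients and holomorphy of power series on the bidisk -/

section

open Metric

/-- The Taylor coefficients of a function holomorphic on the bidisk. -/
def taylorCoeff (f : ℂ × ℂ → ℂ) (i : ℕ × ℕ) : ℂ := 2 ^ (i.1 + i.2) * dilateCoeff (1 / 2) f i

lemma dilateCoeff_mul {f : ℂ × ℂ → ℂ} (hf : DifferentiableOn ℂ f bidisk) {r s : ℝ}
    (h0 : 0 < r) (h1 : r < 1) (s0 : 0 < s) (s1 : s < 1) (i : ℕ × ℕ) :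
    dilateCoeff (r * s) f i = dilateCoeff r f i * (s : ℂ) ^ (i.1 + i.2) := by
  have h : HasTaylor (fun z => f ((r : ℂ) • z)) (dilateCoeff r f) := fun z hz =>
    hasSum_dilateCoeff hf h0 h1 hz
  rw [← h.dilateCoeff_eq s0 s1 i]
  simp only [dilateCoeff, smul_smul]
  push_cast
  rfl

lemma dilateCoeff_eq_taylorCoeff {f : ℂ × ℂ → ℂ} (hf : DifferentiableOn ℂ f bidisk) {r : ℝ}
    (h0 : 0 < r) (h1 : r < 1) (i : ℕ × ℕ) :
    dilateCoeff r f i = taylorCoeff f i * (r : ℂ) ^ (i.1 + i.2) := by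
  -- A radius above both `r` and `1 / 2`: either coefficient is the one at `R` times a power of the
  -- ratio of radii.
  obtain ⟨R, hR, hR1⟩ := exists_between (max_lt h1 (by norm_num : (1 / 2 : ℝ) < 1))
  have hr : r < R := (le_max_left _ _).trans_lt hR
  have hh : 1 / 2 < R := (le_max_right _ _).trans_lt hR
  have hR0 : 0 < R := h0.trans hr
  have hRC : (R : ℂ) ≠ 0 := by exact_mod_cast hR0.ne'
  have e1 := dilateCoeff_mul hf hR0 hR1 (div_pos h0 hR0) ((div_lt_one hR0).2 hr) i
  have e2 := dilateCoeff_mul hf hR0 hR1 (div_pos one_half_pos hR0) ((div_lt_one hR0).2 hh) i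
  rw [mul_div_cancel₀ _ hR0.ne'] at e1 e2
  rw [taylorCoeff, e1, e2]
  push_cast
  simp only [div_pow, one_pow]
  field_simp

lemma hasTaylor_taylorCoeff {f : ℂ × ℂ → ℂ} (hf : DifferentiableOn ℂ f bidisk) :
    HasTaylor f (taylorCoeff f) := by
  intro z hz
  obtain ⟨r, hr, hr1⟩ := exists_between (max_lt hz.1 hz.2)
  have h1 : ‖z.1‖ < r := (le_max_left _ _).trans_lt hr
  have h2 : ‖z.2‖ < r := (le_max_right _ _).trans_lt hr
  have hr0 : 0 < r := (norm_nonneg _).trans_lt h1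
  have hrC : (r : ℂ) ≠ 0 := by exact_mod_cast hr0.ne'
  have hmem : ((r : ℂ)⁻¹ • z) ∈ bidisk := by
    constructor
    · simp only [Prod.smul_fst, norm_smul, norm_inv, Complex.norm_real, Real.norm_of_nonneg hr0.le]
      rw [inv_mul_lt_iff₀ hr0]; simpa using h1
    · simp only [Prod.smul_snd, norm_smul, norm_inv, Complex.norm_real, Real.norm_of_nonneg hr0.le]
      rw [inv_mul_lt_iff₀ hr0]; simpa using h2
  have h := hasSum_dilateCoeff hf hr0 hr1 hmem
  rw [smul_smul, mul_inv_cancel₀ hrC, one_smul] at h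
  refine h.congr_fun fun i => ?_
  rw [dilateCoeff_eq_taylorCoeff hf hr0 hr1, mono_smul, inv_pow]
  field_simp

/-! ### The Cauchy kernel as a holomorphic function with values in `C(𝕋², ℂ)` -/

/-- The function `ζ ↦ 1 / ((1 - z₁ conj ζ₁) (1 - z₂ conj ζ₂))` on the torus. -/
def cauchyMap (z : ℂ × ℂ) : C(Torus, ℂ) :=
  Ring.inverse ((1 - z.1 • (⟨fun ζ => conj (ζ.1 : ℂ), by fun_prop⟩ : C(Torus, ℂ))) *
    (1 - z.2 • (⟨fun ζ => conj (ζ.2 : ℂ), by fun_prop⟩ : C(Torus, ℂ))))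

lemma isUnit_cauchyMap_denom {z : ℂ × ℂ} (hz : z ∈ bidisk) :
    IsUnit ((1 - z.1 • (⟨fun ζ => conj (ζ.1 : ℂ), by fun_prop⟩ : C(Torus, ℂ))) *
    (1 - z.2 • (⟨fun ζ => conj (ζ.2 : ℂ), by fun_prop⟩ : C(Torus, ℂ)))) := by
  rw [ContinuousMap.isUnit_iff_forall_ne_zero]
  intro ζ
  exact mul_ne_zero (one_sub_mul_ne_zero hz.1 (by simp [Circle.norm_coe]))
    (one_sub_mul_ne_zero hz.2 (by simp [Circle.norm_coe]))

lemma cauchyMap_apply {z : ℂ × ℂ} (hz : z ∈ bidisk) (ζ : Torus) :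
    cauchyMap z ζ = (1 - z.1 * conj (ζ.1 : ℂ))⁻¹ * (1 - z.2 * conj (ζ.2 : ℂ))⁻¹ := by
  have h := congrArg (fun F : C(Torus, ℂ) => F ζ)
    (Ring.mul_inverse_cancel _ (isUnit_cauchyMap_denom hz))
  simp only [ContinuousMap.mul_apply, ContinuousMap.sub_apply, ContinuousMap.one_apply,
    ContinuousMap.smul_apply, ContinuousMap.coe_mk, smul_eq_mul] at h
  rw [← mul_inv]
  exact eq_inv_of_mul_eq_one_right h

/-- Inversion in the Banach algebra `C(𝕋², ℂ)` is differentiable at units, which is why the kernel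
is defined through `Ring.inverse`. -/
lemma differentiableOn_cauchyMap : DifferentiableOn ℂ cauchyMap bidisk := by
  intro z hz
  refine DifferentiableAt.differentiableWithinAt ?_
  refine DifferentiableAt.comp z (differentiableAt_inverse (𝕜 := ℂ) (isUnit_cauchyMap_denom hz)) ?_
  fun_prop

/-- Integration of continuous functions against an integrable density. -/
def integralCLM {X : Type*} [TopologicalSpace X] [CompactSpace X] [MeasurableSpace X]
    [BorelSpace X] (μ : Measure X) (g : X → ℂ) (hg : Integrable g μ) : C(X, ℂ) →L[ℂ] ℂ :=
  LinearMap.mkContinuous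
    { toFun := fun F => ∫ x, g x * F x ∂μ
      map_add' := fun F G => by
        have hi : ∀ F : C(X, ℂ), Integrable (fun x => g x * F x) μ := fun F =>
          hg.mul_bdd (c := ‖F‖) F.continuous.aestronglyMeasurable
            (Eventually.of_forall fun x => F.norm_coe_le_norm x)
        simp only [ContinuousMap.add_apply, mul_add]
        exact integral_add (hi F) (hi G)
      map_smul' := fun c F => by
        simp only [ContinuousMap.smul_apply, smul_eq_mul, RingHom.id_apply]
        rw [← integral_const_mul]
        congr 1
        ext x
        ring }
    (∫ x, ‖g x‖ ∂μ) (fun F => by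
      simp only [LinearMap.coe_mk, AddHom.coe_mk]
      rw [← integral_mul_const]
      refine norm_integral_le_of_norm_le (hg.norm.mul_const _) (Eventually.of_forall fun x => ?_)
      rw [norm_mul]
      gcongr
      exact F.norm_coe_le_norm x)

lemma integralCLM_apply {X : Type*} [TopologicalSpace X] [CompactSpace X] [MeasurableSpace X]
    [BorelSpace X] (μ : Measure X) (g : X → ℂ) (hg : Integrable g μ) (F : C(X, ℂ)) :
    integralCLM μ g hg F = ∫ x, g x * F x ∂μ := rfl

/-- Power series on the bidisk are holomorphic. -/
lemma HasTaylor.differentiableOn {f : ℂ × ℂ → ℂ} {a : ℕ × ℕ → ℂ} (h : HasTaylor f a) :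
    DifferentiableOn ℂ f bidisk := by
  intro z hz
  obtain ⟨r, hr, hr1⟩ := exists_between (max_lt hz.1 hz.2)
  have h1 : ‖z.1‖ < r := (le_max_left _ _).trans_lt hr
  have h2 : ‖z.2‖ < r := (le_max_right _ _).trans_lt hr
  have hr0 : 0 < r := (norm_nonneg _).trans_lt h1
  have hrC : (r : ℂ) ≠ 0 := by exact_mod_cast hr0.ne'
  have hmem : ∀ w : ℂ × ℂ, ‖w.1‖ < r → ‖w.2‖ < r → ((r : ℂ)⁻¹ • w) ∈ bidisk := by
    intro w hw1 hw2
    constructor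
    · simp only [Prod.smul_fst, norm_smul, norm_inv, Complex.norm_real, Real.norm_of_nonneg hr0.le]
      rw [inv_mul_lt_iff₀ hr0]; simpa using hw1
    · simp only [Prod.smul_snd, norm_smul, norm_inv, Complex.norm_real, Real.norm_of_nonneg hr0.le]
      rw [inv_mul_lt_iff₀ hr0]; simpa using hw2
  have hcont : Continuous fun ζ : Torus => f ((r : ℂ) • ζ.pt) := by
    have : (fun ζ : Torus => f ((r : ℂ) • ζ.pt)) =
        fun ζ => ∑' i, a i * (r : ℂ) ^ (i.1 + i.2) * mono i ζ.pt :=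
      funext fun ζ => (h.hasSum_dilate hr0 hr1 ζ).tsum_eq.symm
    rw [this]
    refine continuous_tsum (fun i => ?_) (h.summable hr0.le hr1) fun i ζ => ?_
    · exact continuous_const.mul ((continuous_mono i).comp continuous_pt)
    · simp [norm_mono_pt, abs_of_pos hr0]
  -- Near `z`, `f` is a bounded functional applied to the rescaled holomorphic map `cauchyMap`, so
  -- no series has to be differentiated.
  let Λ := integralCLM torusMeasure _ (integrable_torus hcont)
  have key : ∀ w : ℂ × ℂ, ‖w.1‖ < r → ‖w.2‖ < r → f w = Λ (cauchyMap ((r : ℂ)⁻¹ • w)) := by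
    intro w hw1 hw2
    have hw := hmem w hw1 hw2
    obtain ⟨C, hC⟩ := isCompact_univ.exists_bound_of_continuousOn hcont.continuousOn
    have hs := hasSum_integral_torus
      (F := fun i ζ => f ((r : ℂ) • ζ.pt) * (mono i ((r : ℂ)⁻¹ • w) * conj (mono i ζ.pt)))
      (G := fun ζ => f ((r : ℂ) • ζ.pt) * cauchyMap ((r : ℂ)⁻¹ • w) ζ)
      (b := fun i => C * ‖mono i ((r : ℂ)⁻¹ • w)‖) ?_ ((summable_norm_mono hw).mul_left C) ?_ ?_
    · refine HasSum.unique (h w ⟨hw1.trans hr1, hw2.trans hr1⟩) (hs.congr_fun fun i => ?_)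
      have e := h.dilateCoeff_eq hr0 hr1 i
      have e2 : ∫ ζ : Torus, f ((r : ℂ) • ζ.pt) *
          (mono i ((r : ℂ)⁻¹ • w) * conj (mono i ζ.pt)) ∂torusMeasure =
          dilateCoeff r f i * mono i ((r : ℂ)⁻¹ • w) := by
        rw [dilateCoeff, ← integral_mul_const]
        refine integral_congr_ae (Eventually.of_forall fun ζ => ?_)
        simp only
        ring
      rw [e2, e, mono_smul, inv_pow]
      field_simp
    · intro i
      exact hcont.mul (continuous_const.mul (continuous_conj.comp
        ((continuous_mono i).comp continuous_pt)))
    · intro i ζ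
      simp only [norm_mul, RCLike.norm_conj, norm_mono_pt, mul_one]
      gcongr
      exact hC ζ (Set.mem_univ _)
    · intro ζ
      simp only [cauchyMap_apply hw]
      exact (hasSum_cauchy hw ζ).mul_left _
  have hev : (fun w => Λ (cauchyMap ((r : ℂ)⁻¹ • w))) =ᶠ[𝓝 z] f := by
    have o1 : {w : ℂ × ℂ | ‖w.1‖ < r} ∈ 𝓝 z :=
      (isOpen_lt continuous_fst.norm continuous_const).mem_nhds h1
    have o2 : {w : ℂ × ℂ | ‖w.2‖ < r} ∈ 𝓝 z :=
      (isOpen_lt continuous_snd.norm continuous_const).mem_nhds h2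
    filter_upwards [o1, o2] with w hw1 hw2 using (key w hw1 hw2).symm
  refine (DifferentiableAt.congr_of_eventuallyEq ?_ hev.symm).differentiableWithinAt
  have hd : DifferentiableAt ℂ cauchyMap ((r : ℂ)⁻¹ • z) :=
    differentiableOn_cauchyMap.differentiableAt (isOpen_bidisk.mem_nhds (hmem z h1 h2))
  exact Λ.differentiableAt.comp z (hd.comp z (f := fun w => (r : ℂ)⁻¹ • w) (by fun_prop))

end

section

open Metric

/-! ### The Hardy space as a sequence space -/

lemma hasSum_hardyPairing {f g : ℂ × ℂ → ℂ} (hf : DifferentiableOn ℂ f bidisk)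
    (hg : DifferentiableOn ℂ g bidisk) {r : ℝ} (h0 : 0 < r) (h1 : r < 1) :
    HasSum (fun i => taylorCoeff f i * conj (taylorCoeff g i) * (r : ℂ) ^ (2 * (i.1 + i.2)))
      (hardyPairing r f g) := by
  refine (HasTaylor.hasSum_pairing hf (hasTaylor_taylorCoeff hg) h0 h1).congr_fun fun i => ?_
  rw [dilateCoeff_eq_taylorCoeff hf h0 h1, map_mul, map_pow, conj_ofReal, two_mul, pow_add]
  ring

lemma hardyPairing_self (r : ℝ) (f : ℂ × ℂ → ℂ) : hardyPairing r f f = (hardyMean r f : ℂ) := by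
  rw [hardyPairing, hardyMean, ← integral_complex_ofReal]
  congr 1
  ext ζ
  rw [mul_conj']
  push_cast
  rfl

lemma hasSum_hardyMean {f : ℂ × ℂ → ℂ} (hf : DifferentiableOn ℂ f bidisk) {r : ℝ} (h0 : 0 < r)
    (h1 : r < 1) :
    HasSum (fun i => ‖taylorCoeff f i‖ ^ 2 * r ^ (2 * (i.1 + i.2))) (hardyMean r f) := by
  have h := hasSum_hardyPairing hf hf h0 h1
  rw [hardyPairing_self] at h
  rw [← Complex.hasSum_ofReal]
  refine h.congr_fun fun i => ?_
  rw [mul_conj']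
  push_cast
  rfl

/-- Let `r → 1` in finite partial sums of Parseval's identity, which the Hardy means bound
uniformly. -/
lemma MemHardy.summable {f : ℂ × ℂ → ℂ} (hf : MemHardy f) :
    Summable fun i => ‖taylorCoeff f i‖ ^ 2 := by
  obtain ⟨C, hC⟩ := hf.bounded
  refine summable_of_sum_le (c := C) (fun i => by positivity) fun s => ?_
  have ht : Tendsto (fun r : ℝ => ∑ i ∈ s, ‖taylorCoeff f i‖ ^ 2 * r ^ (2 * (i.1 + i.2)))
      (𝓝[<] 1) (𝓝 (∑ i ∈ s, ‖taylorCoeff f i‖ ^ 2)) := by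
    have hc : Continuous fun r : ℝ => ∑ i ∈ s, ‖taylorCoeff f i‖ ^ 2 * r ^ (2 * (i.1 + i.2)) := by
      fun_prop
    have := (hc.tendsto 1).mono_left (nhdsWithin_le_nhds (s := Set.Iio 1))
    simpa using this
  refine le_of_tendsto ht ?_
  filter_upwards [Ioo_mem_nhdsLT (zero_lt_one' ℝ)] with r hr
  exact (sum_le_hasSum s (fun i _ => by have := hr.1; positivity)
    (hasSum_hardyMean hf.analytic hr.1 hr.2)).trans (hC ⟨⟨r, hr⟩, rfl⟩)

lemma hardyMean_le_tsum {f : ℂ × ℂ → ℂ} (hf : DifferentiableOn ℂ f bidisk)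
    (hs : Summable fun i => ‖taylorCoeff f i‖ ^ 2) {r : ℝ} (h0 : 0 < r) (h1 : r < 1) :
    hardyMean r f ≤ ∑' i, ‖taylorCoeff f i‖ ^ 2 := by
  refine hasSum_le (fun i => ?_) (hasSum_hardyMean hf h0 h1) hs.hasSum
  exact mul_le_of_le_one_right (by positivity) (pow_le_one₀ h0.le h1.le)

lemma memHardy_of_summable {f : ℂ × ℂ → ℂ} (hf : DifferentiableOn ℂ f bidisk)
    (hz : ∀ z ∉ bidisk, f z = 0) (hs : Summable fun i => ‖taylorCoeff f i‖ ^ 2) : MemHardy f where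
  analytic := hf
  eq_zero := hz
  bounded := ⟨_, by rintro _ ⟨r, rfl⟩; exact hardyMean_le_tsum hf hs r.2.1 r.2.2⟩

lemma memHardy_of_bounded {f : ℂ × ℂ → ℂ} (hf : DifferentiableOn ℂ f bidisk)
    (hz : ∀ z ∉ bidisk, f z = 0) {C : ℝ} (hC : ∀ z ∈ bidisk, ‖f z‖ ≤ C) : MemHardy f where
  analytic := hf
  eq_zero := hz
  bounded := by
    refine ⟨C ^ 2, ?_⟩
    rintro _ ⟨r, rfl⟩
    have h : hardyMean r f ≤ ∫ _ : Torus, C ^ 2 ∂torusMeasure := by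
      refine integral_mono (integrable_torus
        ((continuous_dilate hf r.2.1 r.2.2).norm.pow 2)) (integrable_const _) fun ζ => ?_
      have := hC _ (smul_pt_mem_bidisk r.2.1 r.2.2 ζ)
      simp only
      gcongr
    simpa using h

lemma MemHardy.hardyNorm_sq {f : ℂ × ℂ → ℂ} (hf : MemHardy f) :
    hardyNorm f ^ 2 = ∑' i, ‖taylorCoeff f i‖ ^ 2 := by
  have hne : Nonempty (Set.Ioo (0 : ℝ) 1) := ⟨⟨1 / 2, by norm_num, by norm_num⟩⟩
  have hnn : 0 ≤ ⨆ r : Set.Ioo (0 : ℝ) 1, hardyMean r f :=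
    Real.iSup_nonneg fun r => integral_nonneg fun ζ => by positivity
  rw [hardyNorm, Real.sq_sqrt hnn]
  refine le_antisymm (ciSup_le fun r => hardyMean_le_tsum hf.analytic hf.summable r.2.1 r.2.2) ?_
  refine hf.summable.tsum_le_of_sum_le fun s => ?_
  have ht : Tendsto (fun r : ℝ => ∑ i ∈ s, ‖taylorCoeff f i‖ ^ 2 * r ^ (2 * (i.1 + i.2)))
      (𝓝[<] 1) (𝓝 (∑ i ∈ s, ‖taylorCoeff f i‖ ^ 2)) := by
    have hc : Continuous fun r : ℝ => ∑ i ∈ s, ‖taylorCoeff f i‖ ^ 2 * r ^ (2 * (i.1 + i.2)) := by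
      fun_prop
    have := (hc.tendsto 1).mono_left (nhdsWithin_le_nhds (s := Set.Iio 1))
    simpa using this
  refine le_of_tendsto ht ?_
  filter_upwards [Ioo_mem_nhdsLT (zero_lt_one' ℝ)] with r hr
  exact (sum_le_hasSum s (fun i _ => by have := hr.1; positivity)
    (hasSum_hardyMean hf.analytic hr.1 hr.2)).trans (le_ciSup hf.bounded ⟨r, hr⟩)

/-- Square-summable double sequences. -/
abbrev Ell : Type := lp (fun _ : ℕ × ℕ => ℂ) 2

lemma memℓp_two_iff {a : ℕ × ℕ → ℂ} : Memℓp a 2 ↔ Summable fun i => ‖a i‖ ^ 2 := by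
  rw [memℓp_gen_iff (by norm_num)]
  norm_num

/-- The Hardy space as a subspace of the space of functions. -/
def hardySpace : Submodule ℂ (ℂ × ℂ → ℂ) where
  carrier := {f | MemHardy f}
  zero_mem' := MemHardy.zero
  add_mem' := fun hf hg => hf.add hg
  smul_mem' := fun c _ hf => hf.smul c

lemma taylorCoeff_add {f g : ℂ × ℂ → ℂ} (hf : DifferentiableOn ℂ f bidisk)
    (hg : DifferentiableOn ℂ g bidisk) :
    taylorCoeff (f + g) = taylorCoeff f + taylorCoeff g := by
  refine (hasTaylor_taylorCoeff (hf.add hg)).unique fun z hz => ?_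
  have := (hasTaylor_taylorCoeff hf z hz).add (hasTaylor_taylorCoeff hg z hz)
  simpa only [Pi.add_apply, add_mul] using this

lemma taylorCoeff_smul {f : ℂ × ℂ → ℂ} (c : ℂ) (hf : DifferentiableOn ℂ f bidisk) :
    taylorCoeff (c • f) = c • taylorCoeff f := by
  refine (hasTaylor_taylorCoeff (hf.const_smul c)).unique fun z hz => ?_
  have := (hasTaylor_taylorCoeff hf z hz).mul_left c
  simpa only [Pi.smul_apply, smul_eq_mul, mul_assoc] using this

/-- The sequence of Taylor coefficients, as a linear map. -/
def toEll : hardySpace →ₗ[ℂ] Ell where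
  toFun f := ⟨taylorCoeff f, memℓp_two_iff.2 (MemHardy.summable f.2)⟩
  map_add' f g := by
    ext1
    exact taylorCoeff_add (MemHardy.analytic f.2) (MemHardy.analytic g.2)
  map_smul' c f := by
    ext1
    exact taylorCoeff_smul c (MemHardy.analytic f.2)

lemma toEll_apply (f : hardySpace) (i : ℕ × ℕ) : toEll f i = taylorCoeff f i := rfl

lemma hardyNorm_nonneg (f : ℂ × ℂ → ℂ) : 0 ≤ hardyNorm f := Real.sqrt_nonneg _

lemma norm_toEll (f : hardySpace) : ‖toEll f‖ = hardyNorm f := by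
  have h1 := lp.norm_rpow_eq_tsum (p := 2) (by norm_num) (toEll f)
  have h2 := MemHardy.hardyNorm_sq f.2
  have h3 : ‖toEll f‖ ^ 2 = hardyNorm f ^ 2 := by
    rw [h2]
    norm_num at h1
    rw [h1]
    rfl
  exact (sq_eq_sq₀ (norm_nonneg _) (hardyNorm_nonneg _)).1 h3

lemma summable_norm_mono_sq {z : ℂ × ℂ} (hz : z ∈ bidisk) :
    Summable fun i => ‖mono i z‖ ^ 2 := by
  have h := summable_norm_mono (z := (z.1 ^ 2, z.2 ^ 2)) (by
    constructor <;> simp only [norm_pow]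
    · exact pow_lt_one₀ (norm_nonneg _) hz.1 two_ne_zero
    · exact pow_lt_one₀ (norm_nonneg _) hz.2 two_ne_zero)
  refine h.congr fun i => ?_
  simp only [norm_mono, norm_pow]
  ring

/-- The sequence of Taylor coefficients of the Cauchy kernel. -/
def cauchyEll (w : ℂ × ℂ) (hw : w ∈ bidisk) : Ell :=
  ⟨fun i => conj (mono i w), memℓp_two_iff.2 (by simpa using summable_norm_mono_sq hw)⟩

/-- The inner product is conjugate-linear in its first argument, so its series is the Taylor series
at `w`. This is the reproducing property of `H²`. -/
lemma inner_cauchyEll_toEll {w : ℂ × ℂ} (hw : w ∈ bidisk) (f : hardySpace) :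
    inner ℂ (cauchyEll w hw) (toEll f) = (f : ℂ × ℂ → ℂ) w := by
  have h := lp.hasSum_inner (𝕜 := ℂ) (cauchyEll w hw) (toEll f)
  refine h.unique ((hasTaylor_taylorCoeff (MemHardy.analytic f.2) w hw).congr_fun fun i => ?_)
  simp [cauchyEll, toEll_apply]

/-- Every square-summable sequence is the sequence of Taylor coefficients of a Hardy function. -/
lemma surjective_toEll : Function.Surjective toEll := by
  intro e
  let f : ℂ × ℂ → ℂ := bidisk.indicator fun z => ∑' i, e i * mono i z
  have hT : HasTaylor f e := by
    intro z hz
    simp only [f, Set.indicator_of_mem hz]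
    refine Summable.hasSum ?_
    have h := (lp.summable_inner (𝕜 := ℂ) (cauchyEll z hz) e)
    refine h.congr fun i => ?_
    simp [cauchyEll]
  have hd := hT.differentiableOn
  have hc : taylorCoeff f = e := (hasTaylor_taylorCoeff hd).unique hT
  have hm : MemHardy f := memHardy_of_summable hd (fun z hz => by simp [f, hz])
    (by rw [hc]; exact memℓp_two_iff.1 e.2)
  refine ⟨⟨f, hm⟩, ?_⟩
  ext1
  exact hc

lemma injective_toEll : Function.Injective toEll := by
  intro f g h
  ext z
  by_cases hz : z ∈ bidisk
  · rw [← inner_cauchyEll_toEll hz, ← inner_cauchyEll_toEll hz, h]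
  · rw [MemHardy.eq_zero f.2 z hz, MemHardy.eq_zero g.2 z hz]

/-- The inner product of the Hardy space is the limit of the pairings. -/
lemma tendsto_hardyPairing (f g : hardySpace) :
    Tendsto (fun r : ℝ => hardyPairing r f g) (𝓝[<] 1) (𝓝 (inner ℂ (toEll g) (toEll f))) := by
  have h := lp.hasSum_inner (𝕜 := ℂ) (toEll g) (toEll f)
  rw [← h.tsum_eq]
  have hs := h.summable.norm
  have ht := tendsto_tsum_of_dominated_convergence (𝓕 := 𝓝[<] (1 : ℝ))
    (f := fun (r : ℝ) i => taylorCoeff f i * conj (taylorCoeff g i) * (r : ℂ) ^ (2 * (i.1 + i.2)))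
    (g := fun i => inner ℂ (toEll g i) (toEll f i)) hs ?_ ?_
  · refine ht.congr' ?_
    filter_upwards [Ioo_mem_nhdsLT (zero_lt_one' ℝ)] with r hr
    exact (hasSum_hardyPairing (MemHardy.analytic f.2) (MemHardy.analytic g.2) hr.1 hr.2).tsum_eq
  · intro i
    have hc : Continuous fun r : ℝ =>
        taylorCoeff f i * conj (taylorCoeff g i) * (r : ℂ) ^ (2 * (i.1 + i.2)) := by fun_prop
    have := (hc.tendsto 1).mono_left (nhdsWithin_le_nhds (s := Set.Iio 1))
    simpa [toEll_apply] using this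
  · filter_upwards [Ioo_mem_nhdsLT (zero_lt_one' ℝ)] with r hr i
    have : ‖(r : ℂ) ^ (2 * (i.1 + i.2))‖ ≤ 1 := by
      rw [norm_pow, Complex.norm_real, Real.norm_of_nonneg hr.1.le]
      exact pow_le_one₀ hr.1.le hr.2.le
    rw [norm_mul]
    refine (mul_le_of_le_one_right (norm_nonneg _) this).trans (le_of_eq ?_)
    simp [toEll_apply]

end

section

open Metric

/-! ### Polarization -/

lemma eq_zero_of_eq_zero_on_real {g : ℂ → ℂ} {ρ : ℝ} (hg : DifferentiableOn ℂ g (ball 0 ρ))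
    (h : ∀ x : ℝ, |x| < ρ → g x = 0) {z : ℂ} (hz : ‖z‖ < ρ) : g z = 0 := by
  have hρ : 0 < ρ := (norm_nonneg _).trans_lt hz
  have ha := hg.analyticOnNhd isOpen_ball
  refine ha.eqOn_zero_of_preconnected_of_frequently_eq_zero (convex_ball 0 ρ).isPreconnected
    (z₀ := 0) (by simpa using hρ) ?_ (by simpa using hz)
  rw [frequently_nhdsWithin_iff, Metric.nhds_basis_ball.frequently_iff]
  intro ε hε
  have hm : 0 < min ε ρ := lt_min hε hρ
  refine ⟨((min ε ρ / 2 : ℝ) : ℂ), ?_, h _ ?_, ?_⟩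
  · rw [mem_ball_zero_iff, Complex.norm_real, Real.norm_of_nonneg (by positivity)]
    linarith [min_le_left ε ρ]
  · rw [abs_of_nonneg (by positivity)]
    linarith [min_le_right ε ρ]
  · simp only [Set.mem_compl_iff, Set.mem_singleton_iff, ofReal_eq_zero]
    positivity

lemma eq_zero_of_eq_zero_on_ball {g : ℂ → ℂ} (hg : DifferentiableOn ℂ g (ball 0 1)) {ρ : ℝ}
    (hρ : 0 < ρ) (h : ∀ z, ‖z‖ < ρ → g z = 0) {z : ℂ} (hz : ‖z‖ < 1) : g z = 0 := by
  refine (hg.analyticOnNhd isOpen_ball).eqOn_zero_of_preconnected_of_eventuallyEq_zero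
    (convex_ball 0 1).isPreconnected (z₀ := 0) (by simp) ?_ (by simpa using hz)
  filter_upwards [ball_mem_nhds (0 : ℂ) hρ] with w hw
  exact h w (by simpa using hw)

/-- A function `H(s, t)`, holomorphic on the bidisk, that vanishes for `s = conj t` is zero. -/
lemma eq_zero_of_conj_diagonal {H : ℂ × ℂ → ℂ} (hH : DifferentiableOn ℂ H bidisk)
    (h : ∀ t : ℂ, ‖t‖ < 1 → H (conj t, t) = 0) {z : ℂ × ℂ} (hz : z ∈ bidisk) : H z = 0 := by
  -- In the coordinates `s = x - iy`, `t = x + iy` the set `s = conj t` becomes the set of real `x,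
  -- y`, so the one-variable identity theorem applies first in `x`, then in `y`. The radius `1 / 2`
  -- keeps `x ± iy` in the unit disk.
  have hmem : ∀ x y : ℂ, ‖x‖ < 1 / 2 → ‖y‖ < 1 / 2 → (x - I * y, x + I * y) ∈ bidisk := by
    intro x y hx hy
    have hy' : ‖I * y‖ < 1 / 2 := by simpa using hy
    exact ⟨(norm_sub_le _ _).trans_lt (by linarith), (norm_add_le _ _).trans_lt (by linarith)⟩
  have s1 : ∀ y : ℝ, |y| < 1 / 2 → ∀ x : ℂ, ‖x‖ < 1 / 2 → H (x - I * y, x + I * y) = 0 := by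
    intro y hy x hx
    refine eq_zero_of_eq_zero_on_real (ρ := 1 / 2)
      (g := fun x => H (x - I * y, x + I * y)) ?_ ?_ hx
    · exact hH.comp (f := fun x : ℂ => (x - I * y, x + I * y)) (by fun_prop) fun w hw =>
        hmem w y (by simpa using hw) (by simpa using hy)
    · intro t ht
      have := h ((t : ℂ) + I * y) (hmem t y (by simpa using ht) (by simpa using hy)).2
      rw [← this]
      simp [sub_eq_add_neg]
  have s2 : ∀ x : ℂ, ‖x‖ < 1 / 2 → ∀ y : ℂ, ‖y‖ < 1 / 2 → H (x - I * y, x + I * y) = 0 := by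
    intro x hx y hy
    refine eq_zero_of_eq_zero_on_real (ρ := 1 / 2)
      (g := fun y => H (x - I * y, x + I * y)) ?_ (fun t ht => s1 t ht x hx) hy
    exact hH.comp (f := fun y : ℂ => (x - I * y, x + I * y)) (by fun_prop) fun w hw =>
        hmem x w hx (by simpa using hw)
  have s3 : ∀ s t : ℂ, ‖s‖ < 1 / 2 → ‖t‖ < 1 / 2 → H (s, t) = 0 := by
    intro s t hs ht
    have hx : ‖(s + t) / 2‖ < 1 / 2 := by
      rw [norm_div, Complex.norm_two]
      linarith [norm_add_le s t]
    have hy : ‖(t - s) / (2 * I)‖ < 1 / 2 := by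
      rw [norm_div, norm_mul, Complex.norm_two, norm_I]
      linarith [norm_sub_le t s]
    have := s2 _ hx _ hy
    rw [← this]
    congr 2 <;> field_simp <;> ring
  have s4 : ∀ s t : ℂ, ‖s‖ < 1 → ‖t‖ < 1 / 2 → H (s, t) = 0 := by
    intro s t hs ht
    refine eq_zero_of_eq_zero_on_ball (g := fun s => H (s, t)) ?_ one_half_pos
      (fun z hz => s3 z t hz ht) hs
    exact hH.comp (f := fun s : ℂ => (s, t)) (by fun_prop) fun w hw =>
        ⟨by simpa using hw, by simp only; linarith⟩
  refine eq_zero_of_eq_zero_on_ball (g := fun t => H (z.1, t)) ?_ one_half_pos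
      (fun t ht => s4 z.1 t hz.1 ht) hz.2
  exact hH.comp (f := fun t : ℂ => (z.1, t)) (by fun_prop) fun w hw =>
        ⟨hz.1, by simpa using hw⟩

/-- The coordinatewise complex conjugate. -/
def conjPt (z : ℂ × ℂ) : ℂ × ℂ := (conj z.1, conj z.2)

lemma conjPt_mem {z : ℂ × ℂ} (hz : z ∈ bidisk) : conjPt z ∈ bidisk := by
  simpa [bidisk, conjPt] using hz

@[simp] lemma conjPt_conjPt (z : ℂ × ℂ) : conjPt (conjPt z) = z := by simp [conjPt]

/-- Polarization on the bidisk. -/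
lemma eq_zero_of_conj_diagonal_bidisk {G : (ℂ × ℂ) × (ℂ × ℂ) → ℂ}
    (hG : DifferentiableOn ℂ G (bidisk ×ˢ bidisk))
    (h : ∀ t ∈ bidisk, G (conjPt t, t) = 0) {s t : ℂ × ℂ} (hs : s ∈ bidisk) (ht : t ∈ bidisk) :
    G (s, t) = 0 := by
  -- The first coordinates are freed while the second ones stay conjugate; a second application
  -- frees those.
  have h1 : ∀ (s₁ t₁ t₂ : ℂ), ‖s₁‖ < 1 → ‖t₁‖ < 1 → ‖t₂‖ < 1 →
      G ((s₁, conj t₂), (t₁, t₂)) = 0 := by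
    intro s₁ t₁ t₂ hs₁ ht₁ ht₂
    refine eq_zero_of_conj_diagonal (H := fun x => G ((x.1, conj t₂), (x.2, t₂))) ?_ ?_
      (z := (s₁, t₁)) ⟨hs₁, ht₁⟩
    · exact hG.comp (f := fun x : ℂ × ℂ => ((x.1, conj t₂), (x.2, t₂))) (by fun_prop) fun x hx =>
        ⟨⟨hx.1, by simpa using ht₂⟩, ⟨hx.2, ht₂⟩⟩
    · intro t ht
      exact h (t, t₂) ⟨ht, ht₂⟩
  refine eq_zero_of_conj_diagonal (H := fun x => G ((s.1, x.1), (t.1, x.2))) ?_ ?_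
      (z := (s.2, t.2)) ⟨hs.2, ht.2⟩
  · exact hG.comp (f := fun x : ℂ × ℂ => ((s.1, x.1), (t.1, x.2))) (by fun_prop) fun x hx =>
        ⟨⟨hs.1, hx.1⟩, ⟨ht.1, hx.2⟩⟩
  · intro y hy
    exact h1 s.1 t.1 y hs.1 ht.1 hy

/-! ### Isometries determined by Gram matrices -/

/-- Two families with the same Gram matrix, the first of them total, are related by an isometry. -/
lemma exists_isometry_of_inner_eq {W K L : Type*} [NormedAddCommGroup K] [InnerProductSpace ℂ K]
    [NormedAddCommGroup L] [InnerProductSpace ℂ L] [CompleteSpace L]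
    {κ : W → K} {v : W → L} (hκ : Dense (Submodule.span ℂ (Set.range κ) : Set K))
    (h : ∀ x y, inner ℂ (κ x) (κ y) = inner ℂ (v x) (v y)) :
    ∃ J : K →ₗᵢ[ℂ] L, ∀ x, J (κ x) = v x := by
  let e : (W →₀ ℂ) →ₗ[ℂ] K := Finsupp.linearCombination ℂ κ
  let f : (W →₀ ℂ) →ₗ[ℂ] L := Finsupp.linearCombination ℂ v
  -- Equal Gram matrices give equal norms on all finite combinations: this is well-definedness and
  -- isometry at once.
  have hnorm : ∀ x, ‖f x‖ = ‖e x‖ := by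
    intro x
    have : inner ℂ (f x) (f x) = inner ℂ (e x) (e x) := by
      simp only [f, e, Finsupp.linearCombination_apply, Finsupp.sum, sum_inner, inner_sum,
        inner_smul_left, inner_smul_right, h]
    rw [inner_self_eq_norm_sq_to_K, inner_self_eq_norm_sq_to_K] at this
    have h2 : ‖f x‖ ^ 2 = ‖e x‖ ^ 2 := by exact_mod_cast this
    exact (sq_eq_sq₀ (norm_nonneg _) (norm_nonneg _)).1 h2
  have hd : DenseRange e := by
    have : Set.range e = (Submodule.span ℂ (Set.range κ) : Set K) := by
      rw [← Finsupp.range_linearCombination]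
      rfl
    rw [DenseRange, this]
    exact hκ
  have hb : ∀ x, ‖f x‖ ≤ 1 * ‖e x‖ := fun x => by rw [one_mul, hnorm]
  have heq := LinearMap.extendOfNorm_eq hd ⟨1, hb⟩
  refine ⟨⟨(f.extendOfNorm e).toLinearMap, fun x => ?_⟩, fun x => ?_⟩
  · refine hd.induction_on (p := fun x => ‖f.extendOfNorm e x‖ = ‖x‖) x ?_ ?_
    · exact isClosed_eq (by fun_prop) (by fun_prop)
    · intro y
      rw [heq, hnorm]
  · have := heq (Finsupp.single x 1)
    simpa [e, f] using this

end

section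

open Metric Polynomial

/-! ### Reflection of polynomials in one variable -/

/-- The reflection `z ^ n * conj (q (1 / conj z))` of a polynomial of degree at most `n`. -/
def crev (n : ℕ) (q : ℂ[X]) : ℂ[X] :=
  ∑ k ∈ Finset.range (n + 1), C (conj (q.coeff k)) * X ^ (n - k)

lemma coeff_crev (n : ℕ) (q : ℂ[X]) (j : ℕ) :
    (crev n q).coeff j = if j ≤ n then conj (q.coeff (n - j)) else 0 := by
  simp only [crev, finsetSum_coeff, coeff_C_mul, coeff_X_pow, mul_ite, mul_one, mul_zero]
  split_ifs with h
  · rw [Finset.sum_eq_single (n - j)]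
    · rw [if_pos (by omega)]
    · intro k hk hne
      rw [if_neg]
      rw [Finset.mem_range] at hk
      omega
    · intro hk
      exact absurd (Finset.mem_range.2 (by omega)) hk
  · refine Finset.sum_eq_zero fun k hk => if_neg ?_
    omega

lemma crev_add (n : ℕ) (q r : ℂ[X]) : crev n (q + r) = crev n q + crev n r := by
  ext j
  simp only [coeff_crev, coeff_add]
  split_ifs <;> simp

lemma crev_C_mul (n : ℕ) (a : ℂ) (q : ℂ[X]) : crev n (C a * q) = C (conj a) * crev n q := by
  ext j
  simp only [coeff_crev, coeff_C_mul]
  split_ifs <;> simp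

lemma crev_zero (n : ℕ) : crev n 0 = 0 := by ext j; simp [coeff_crev]

lemma crev_sum {ι : Type*} (n : ℕ) (s : Finset ι) (q : ι → ℂ[X]) :
    crev n (∑ i ∈ s, q i) = ∑ i ∈ s, crev n (q i) := by
  classical
  induction s using Finset.induction_on with
  | empty => simp [crev_zero]
  | insert a s ha ih => rw [Finset.sum_insert ha, Finset.sum_insert ha, crev_add, ih]

lemma crev_C_mul_X_pow {n j : ℕ} (h : j ≤ n) (a : ℂ) :
    crev n (C a * X ^ j) = C (conj a) * X ^ (n - j) := by
  ext i
  simp only [coeff_crev, coeff_C_mul_X_pow]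
  split_ifs <;> first | rfl | omega | simp

lemma crev_crev {n : ℕ} {q : ℂ[X]} (hq : q.natDegree ≤ n) : crev n (crev n q) = q := by
  ext j
  simp only [coeff_crev]
  by_cases hj : j ≤ n
  · rw [if_pos hj, if_pos (by omega), conj_conj]
    congr 1
    omega
  · rw [if_neg hj, coeff_eq_zero_of_natDegree_lt (by omega)]

lemma natDegree_crev_le (n : ℕ) (q : ℂ[X]) : (crev n q).natDegree ≤ n := by
  rw [natDegree_le_iff_coeff_eq_zero]
  intro j hj
  rw [coeff_crev, if_neg (by omega)]

lemma eval_crev {n : ℕ} {q : ℂ[X]} (hq : q.natDegree ≤ n) {z : ℂ} (hz : z ≠ 0) :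
    (crev n q).eval z = z ^ n * conj (q.eval (conj z)⁻¹) := by
  rw [eval_eq_sum_range' (Nat.lt_succ_of_le hq), crev, eval_finsetSum, map_sum, Finset.mul_sum]
  refine Finset.sum_congr rfl fun k hk => ?_
  have hk' : k ≤ n := Nat.lt_succ_iff.1 (Finset.mem_range.1 hk)
  simp only [eval_mul, eval_C, eval_pow, eval_X, map_mul, map_pow, map_inv₀, conj_conj]
  rw [pow_sub₀ z hz hk', inv_pow]
  ring

lemma eval_crev_circle {n : ℕ} {q : ℂ[X]} (hq : q.natDegree ≤ n) (ζ : Circle) :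
    (crev n q).eval (ζ : ℂ) = (ζ : ℂ) ^ n * conj (q.eval (ζ : ℂ)) := by
  rw [eval_crev hq ζ.coe_ne_zero]
  congr 3
  exact (eq_inv_of_mul_eq_one_left (circle_mul_conj ζ)).symm

/-! ### Rational inner functions of degree `(n, 1)` -/

/-- The denominator `p₀(z₁) + z₂ p₁(z₁)` of a rational inner function of degree `(n, 1)`. -/
structure RIFData (n : ℕ) (p₀ p₁ : ℂ[X]) : Prop where
  deg₀ : p₀.natDegree ≤ n
  deg₁ : p₁.natDegree ≤ n
  ne_zero : ∀ z ∈ bidisk, p₀.eval z.1 + z.2 * p₁.eval z.1 ≠ 0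
  no_common : ∀ ζ : Circle, p₀.eval (ζ : ℂ) = 0 → p₁.eval (ζ : ℂ) ≠ 0
  nonconst : ∀ c : ℂ, crev n p₁ = C c * p₀ → crev n p₀ ≠ C c * p₁

/-- The coefficient of `z₂ ^ j` in a polynomial in two variables. -/
def sndCoeff (p : MvPolynomial (Fin 2) ℂ) (j : ℕ) : ℂ[X] :=
  ∑ k ∈ p.support with k 1 = j, C (p.coeff k) * X ^ (k 0)

lemma evalAt_eq_sum (p : MvPolynomial (Fin 2) ℂ) (z : ℂ × ℂ) :
    evalAt p z = ∑ k ∈ p.support, p.coeff k * z.1 ^ (k 0) * z.2 ^ (k 1) := by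
  rw [evalAt, MvPolynomial.eval_eq']
  refine Finset.sum_congr rfl fun k _ => ?_
  simp [Fin.prod_univ_two, mul_assoc]

lemma support_le {p : MvPolynomial (Fin 2) ℂ} {i : Fin 2} {m : ℕ} (h : p.degreeOf i ≤ m)
    {k : Fin 2 →₀ ℕ} (hk : k ∈ p.support) : k i ≤ m :=
  (MvPolynomial.degreeOf_le_iff.1 h) k hk

lemma sum_support_split {p : MvPolynomial (Fin 2) ℂ} (h : p.degreeOf 1 ≤ 1)
    (F : (Fin 2 →₀ ℕ) → ℂ) :
    ∑ k ∈ p.support, F k =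
      ∑ k ∈ p.support with k 1 = 0, F k + ∑ k ∈ p.support with k 1 = 1, F k := by
  rw [← Finset.sum_filter_add_sum_filter_not p.support (fun k => k 1 = 0)]
  congr 1
  refine Finset.sum_congr ?_ fun _ _ => rfl
  ext k
  simp only [Finset.mem_filter, and_congr_right_iff]
  intro hk
  have := support_le h hk
  omega

lemma evalAt_eq_sndCoeff {p : MvPolynomial (Fin 2) ℂ} (h : p.degreeOf 1 ≤ 1) (z : ℂ × ℂ) :
    evalAt p z = (sndCoeff p 0).eval z.1 + z.2 * (sndCoeff p 1).eval z.1 := by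
  rw [evalAt_eq_sum, sum_support_split h, sndCoeff, sndCoeff, eval_finsetSum, eval_finsetSum,
    Finset.mul_sum]
  congr 1 <;> refine Finset.sum_congr rfl fun k hk => ?_ <;> rw [(Finset.mem_filter.1 hk).2]
  · simp
  · simp only [pow_one, eval_mul, eval_C, eval_pow, eval_X]
    ring

lemma evalAt_reflection {p : MvPolynomial (Fin 2) ℂ} {n : ℕ} (h₀ : p.degreeOf 0 ≤ n)
    (h : p.degreeOf 1 ≤ 1) (z : ℂ × ℂ) :
    evalAt (reflection n 1 p) z =
      (crev n (sndCoeff p 1)).eval z.1 + z.2 * (crev n (sndCoeff p 0)).eval z.1 := by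
  have e : evalAt (reflection n 1 p) z =
      ∑ k ∈ p.support, conj (p.coeff k) * z.1 ^ (n - k 0) * z.2 ^ (1 - k 1) := by
    simp [evalAt, reflection, map_sum]
  rw [e, sum_support_split h, add_comm, sndCoeff, sndCoeff, crev_sum, crev_sum, eval_finsetSum,
    eval_finsetSum, Finset.mul_sum]
  congr 1 <;> refine Finset.sum_congr rfl fun k hk => ?_ <;>
    rw [(Finset.mem_filter.1 hk).2, crev_C_mul_X_pow (support_le h₀ (Finset.mem_filter.1 hk).1)]
  · simp
  · simp only [tsub_zero, pow_one, eval_mul, eval_C, eval_pow, eval_X]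
    ring

lemma natDegree_sndCoeff_le {p : MvPolynomial (Fin 2) ℂ} {n : ℕ} (h₀ : p.degreeOf 0 ≤ n) (j : ℕ) :
    (sndCoeff p j).natDegree ≤ n :=
  natDegree_sum_le_of_forall_le _ _ fun _ hk => (natDegree_C_mul_X_pow_le _ _).trans
    (support_le h₀ (Finset.mem_filter.1 hk).1)

lemma mvPolynomial_ext_evalAt {p q : MvPolynomial (Fin 2) ℂ} (h : ∀ z, evalAt p z = evalAt q z) :
    p = q := by
  refine MvPolynomial.funext fun x => ?_
  have := h (x 0, x 1)
  have hx : ![x 0, x 1] = x := by ext i; fin_cases i <;> rfl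
  simpa only [evalAt, hx] using this

lemma evalAt_add (p q : MvPolynomial (Fin 2) ℂ) (z : ℂ × ℂ) :
    evalAt (p + q) z = evalAt p z + evalAt q z := map_add _ _ _

lemma evalAt_mul (p q : MvPolynomial (Fin 2) ℂ) (z : ℂ × ℂ) :
    evalAt (p * q) z = evalAt p z * evalAt q z := map_mul _ _ _

lemma evalAt_aeval_X (q : ℂ[X]) (z : ℂ × ℂ) :
    evalAt (aeval (MvPolynomial.X 0) q) z = q.eval z.1 := by
  induction q using Polynomial.induction_on' with
  | add a b ha hb => rw [map_add, evalAt_add, ha, hb, eval_add]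
  | monomial k a =>
    simp [evalAt, aeval_monomial, MvPolynomial.algebraMap_eq]

lemma X_sub_C_dvd_of_evalAt {p : MvPolynomial (Fin 2) ℂ} {q₀ q₁ : ℂ[X]}
    (hp : ∀ z, evalAt p z = q₀.eval z.1 + z.2 * q₁.eval z.1) {τ : ℂ} (h₀ : q₀.eval τ = 0)
    (h₁ : q₁.eval τ = 0) : (MvPolynomial.X 0 - MvPolynomial.C τ) ∣ p := by
  obtain ⟨s₀, rfl⟩ := dvd_iff_isRoot.2 h₀
  obtain ⟨s₁, rfl⟩ := dvd_iff_isRoot.2 h₁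
  refine ⟨aeval (MvPolynomial.X 0) s₀ + MvPolynomial.X 1 * aeval (MvPolynomial.X 0) s₁, ?_⟩
  refine mvPolynomial_ext_evalAt fun z => ?_
  rw [hp, evalAt_mul, evalAt_add, evalAt_mul, evalAt_aeval_X, evalAt_aeval_X]
  simp [evalAt]
  ring

/-- The two one-variable coefficients of the denominator of a rational inner function. -/
lemma IsRIF.rifData {φ : ℂ × ℂ → ℂ} {p : MvPolynomial (Fin 2) ℂ} {n : ℕ} (h : IsRIF φ p n 1) :
    RIFData n (sndCoeff p 0) (sndCoeff p 1) where
  deg₀ := natDegree_sndCoeff_le h.degree_fst 0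
  deg₁ := natDegree_sndCoeff_le h.degree_fst 1
  ne_zero z hz := by
    rw [← evalAt_eq_sndCoeff h.degree_snd]
    exact h.ne_zero z hz
  -- On the circle reflection conjugates values up to a unimodular factor, so a common zero `ζ` of
  -- `p₀` and `p₁` makes `z₁ - ζ` divide both `p` and `p̃`.
  no_common ζ h₀ h₁ := by
    have d1 : (MvPolynomial.X 0 - MvPolynomial.C (ζ : ℂ)) ∣ p :=
      X_sub_C_dvd_of_evalAt (evalAt_eq_sndCoeff h.degree_snd) h₀ h₁
    have d2 : (MvPolynomial.X 0 - MvPolynomial.C (ζ : ℂ)) ∣ reflection n 1 p := by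
      refine X_sub_C_dvd_of_evalAt (evalAt_reflection h.degree_fst h.degree_snd) (τ := ζ) ?_ ?_
      · rw [eval_crev_circle (natDegree_sndCoeff_le h.degree_fst 1), h₁]; simp
      · rw [eval_crev_circle (natDegree_sndCoeff_le h.degree_fst 0), h₀]; simp
    have hu := (h.no_common_factor d2 d1).map (MvPolynomial.eval ![(ζ : ℂ), 0])
    simp at hu
  -- If `p̃ = c p`, then `p` divides both and is a nonzero constant. Its `z₂`-coefficient vanishes,
  -- and reflecting back kills the constant coefficient too.
  nonconst c h₁ h₀ := by
    have he : reflection n 1 p = MvPolynomial.C c * p := by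
      refine mvPolynomial_ext_evalAt fun z => ?_
      rw [evalAt_reflection h.degree_fst h.degree_snd, h₀, h₁, evalAt_mul,
        evalAt_eq_sndCoeff h.degree_snd]
      simp [evalAt]
      ring
    have hu := h.no_common_factor (he ▸ Dvd.intro_left _ rfl) dvd_rfl
    obtain ⟨a, -, ha⟩ := MvPolynomial.isUnit_iff_eq_C_of_isReduced.1 hu
    have hev : ∀ z : ℂ × ℂ, (sndCoeff p 0).eval z.1 + z.2 * (sndCoeff p 1).eval z.1 = a := by
      intro z
      rw [← evalAt_eq_sndCoeff h.degree_snd, ha]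
      simp [evalAt]
    have hz1 : sndCoeff p 1 = 0 := by
      refine Polynomial.funext fun x => ?_
      have e1 := hev (x, 0)
      have e2 := hev (x, 1)
      simp only [zero_mul, add_zero, one_mul] at e1 e2
      rw [e1] at e2
      simpa using e2
    have hz0 : sndCoeff p 0 = 0 := by
      rw [← crev_crev (natDegree_sndCoeff_le h.degree_fst 0), h₀, hz1, mul_zero, crev_zero]
    refine h.ne_zero (0, 0) (by simp [bidisk]) ?_
    rw [evalAt_eq_sndCoeff h.degree_snd, hz0, hz1]
    simp

end

/-! ### The inequality between a polynomial and its reflection on the bidisk -/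

section

open Metric Polynomial

lemma exists_circle {z : ℂ} (h : ‖z‖ = 1) : ∃ ζ : Circle, (ζ : ℂ) = z :=
  ⟨⟨z, mem_sphere_zero_iff_norm.2 h⟩, rfl⟩

/-- A quotient of polynomials is bounded on the closed disk by its bound on the circle. -/
lemma norm_eval_le_of_circle {f g : ℂ → ℂ} (hf : Differentiable ℂ f) (hg : Differentiable ℂ g)
    (hne : ∀ z, ‖z‖ ≤ 1 → g z ≠ 0) (h : ∀ ζ : Circle, ‖f ζ‖ ≤ ‖g ζ‖) {z : ℂ} (hz : ‖z‖ ≤ 1) :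
    ‖f z‖ ≤ ‖g z‖ := by
  have hd : DiffContOnCl ℂ (fun z => f z / g z) (ball 0 1) := by
    refine DifferentiableOn.diffContOnCl ?_
    rw [closure_ball _ one_ne_zero]
    exact hf.differentiableOn.div hg.differentiableOn fun z hz => hne z (by simpa using hz)
  have hb := Complex.norm_le_of_forall_mem_frontier_norm_le (C := 1) isBounded_ball hd ?_
    (z := z) (by rw [closure_ball _ one_ne_zero]; simpa using hz)
  · rwa [norm_div, div_le_one (norm_pos_iff.2 (hne z hz))] at hb
  · intro w hw
    rw [frontier_ball _ one_ne_zero, mem_sphere_zero_iff_norm] at hw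
    obtain ⟨ζ, rfl⟩ := exists_circle hw
    rw [norm_div]
    exact div_le_one_of_le₀ (h ζ) (norm_nonneg _)

/-- Equality of moduli on the torus, carried inside by the maximum principle in one variable after
the other. -/
lemma norm_reflection_le_of_ne_zero {n : ℕ} {q₀ q₁ : ℂ[X]} (h₀ : q₀.natDegree ≤ n)
    (h₁ : q₁.natDegree ≤ n)
    (hne : ∀ z₁ z₂ : ℂ, ‖z₁‖ ≤ 1 → ‖z₂‖ ≤ 1 → q₀.eval z₁ + z₂ * q₁.eval z₁ ≠ 0) {z₁ z₂ : ℂ}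
    (hz₁ : ‖z₁‖ ≤ 1) (hz₂ : ‖z₂‖ ≤ 1) :
    ‖(crev n q₁).eval z₁ + z₂ * (crev n q₀).eval z₁‖ ≤ ‖q₀.eval z₁ + z₂ * q₁.eval z₁‖ := by
  refine norm_eval_le_of_circle
    (f := fun z₂ => (crev n q₁).eval z₁ + z₂ * (crev n q₀).eval z₁)
    (g := fun z₂ => q₀.eval z₁ + z₂ * q₁.eval z₁) (by fun_prop) (by fun_prop)
    (fun z hz => hne z₁ z hz₁ hz) (fun η => ?_) hz₂
  refine norm_eval_le_of_circle
    (f := fun z₁ => (crev n q₁).eval z₁ + η * (crev n q₀).eval z₁)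
    (g := fun z₁ => q₀.eval z₁ + η * q₁.eval z₁) (by fun_prop) (by fun_prop)
    (fun z hz => hne z η hz (Circle.norm_coe η).le) (fun ζ => ?_) hz₁
  simp only [eval_crev_circle h₀, eval_crev_circle h₁]
  have : (ζ : ℂ) ^ n * conj (q₁.eval (ζ : ℂ)) + η * ((ζ : ℂ) ^ n * conj (q₀.eval (ζ : ℂ))) =
      (ζ : ℂ) ^ n * η * conj (q₀.eval (ζ : ℂ) + η * q₁.eval (ζ : ℂ)) := by
    simp only [map_add, map_mul]
    linear_combination -(ζ : ℂ) ^ n * conj (q₁.eval (ζ : ℂ)) * circle_mul_conj η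
  rw [this, norm_mul, norm_mul, norm_pow, Circle.norm_coe, Circle.norm_coe, RCLike.norm_conj]
  simp

namespace RIFData

variable {n : ℕ} {p₀ p₁ : ℂ[X]} (D : RIFData n p₀ p₁)

include D

/-- The dilates `p(rz)` have no zeros on the closed bidisk, where the previous bound applies; then
`r → 1`. The dilation contributes a factor `r` to the `z₂`-coefficient. -/
lemma norm_reflection_le {z₁ z₂ : ℂ} (hz₁ : ‖z₁‖ ≤ 1) (hz₂ : ‖z₂‖ ≤ 1) :
    ‖(crev n p₁).eval z₁ + z₂ * (crev n p₀).eval z₁‖ ≤ ‖p₀.eval z₁ + z₂ * p₁.eval z₁‖ := by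
  have key : ∀ r : ℝ, r ∈ Set.Ioo (0 : ℝ) 1 →
      ‖(crev n (C (r : ℂ) * p₁.comp (C (r : ℂ) * X))).eval z₁ +
        z₂ * (crev n (p₀.comp (C (r : ℂ) * X))).eval z₁‖ ≤
      ‖(p₀.comp (C (r : ℂ) * X)).eval z₁ +
        z₂ * (C (r : ℂ) * p₁.comp (C (r : ℂ) * X)).eval z₁‖ := by
    intro r hr
    have hdeg : ∀ q : ℂ[X], q.natDegree ≤ n → (q.comp (C (r : ℂ) * X)).natDegree ≤ n := by
      intro q hq
      refine natDegree_comp_le.trans ?_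
      calc _ ≤ q.natDegree * 1 := by gcongr; simpa using natDegree_C_mul_X_pow_le (r : ℂ) 1
        _ ≤ n := by simpa using hq
    refine norm_reflection_le_of_ne_zero (hdeg _ D.deg₀)
      ((natDegree_C_mul_le _ _).trans (hdeg _ D.deg₁)) ?_ hz₁ hz₂
    intro w₁ w₂ h1 h2
    have hr' : ∀ w : ℂ, ‖w‖ ≤ 1 → ‖(r : ℂ) * w‖ < 1 := fun w hw => by
      rw [norm_mul, Complex.norm_real, Real.norm_of_nonneg hr.1.le]
      nlinarith [hr.1, hr.2, norm_nonneg w]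
    have := D.ne_zero ((r : ℂ) * w₁, (r : ℂ) * w₂) ⟨hr' _ h1, hr' _ h2⟩
    simp only [eval_comp, eval_mul, eval_C, eval_X] at this ⊢
    convert this using 2
    ring
  have hcl : ∀ (F G : ℝ → ℂ), Continuous F → Continuous G →
      (∀ r ∈ Set.Ioo (0 : ℝ) 1, ‖F r‖ ≤ ‖G r‖) → ‖F 1‖ ≤ ‖G 1‖ := by
    intro F G hF hG h
    refine le_of_tendsto_of_tendsto ((hF.norm.tendsto 1).mono_left nhdsWithin_le_nhds)
      ((hG.norm.tendsto 1).mono_left (nhdsWithin_le_nhds (s := Set.Iio 1))) ?_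
    filter_upwards [Ioo_mem_nhdsLT (zero_lt_one' ℝ)] with r hr using h r hr
  have := hcl _ _ ?_ ?_ key
  · simpa using this
  · have : ∀ q : ℂ[X], Continuous fun r : ℝ => (crev n (q.comp (C (r : ℂ) * X))).eval z₁ := by
      intro q
      simp only [crev, eval_finsetSum, comp_C_mul_X_coeff, eval_mul, eval_C, eval_pow, eval_X,
        map_mul, map_pow, conj_ofReal]
      fun_prop
    simp only [crev_C_mul, eval_mul, eval_C, conj_ofReal]
    exact ((continuous_ofReal).mul (this p₁)).add (continuous_const.mul (this p₀))
  · simp only [eval_comp, eval_mul, eval_C, eval_X]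
    fun_prop

/-- Equality at an interior point would make `p̃ / p` constant by the maximum principle, contrary to
`nonconst`. -/
lemma norm_reflection_lt {z : ℂ × ℂ} (hz : z ∈ bidisk) :
    ‖(crev n p₁).eval z.1 + z.2 * (crev n p₀).eval z.1‖ < ‖p₀.eval z.1 + z.2 * p₁.eval z.1‖ := by
  refine lt_of_le_of_ne (D.norm_reflection_le hz.1.le hz.2.le) fun heq => ?_
  let f : ℂ × ℂ → ℂ := fun z => ((crev n p₁).eval z.1 + z.2 * (crev n p₀).eval z.1) /
    (p₀.eval z.1 + z.2 * p₁.eval z.1)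
  have hd : DifferentiableOn ℂ f bidisk := by
    simp only [f, div_eq_mul_inv]
    refine DifferentiableOn.mul ?_ (DifferentiableOn.inv ?_ D.ne_zero)
    · have h1 : Differentiable ℂ fun z : ℂ × ℂ => (crev n p₁).eval z.1 :=
        (crev n p₁).differentiable.comp differentiable_fst
      have h2 : Differentiable ℂ fun z : ℂ × ℂ => (crev n p₀).eval z.1 :=
        (crev n p₀).differentiable.comp differentiable_fst
      exact (h1.add (differentiable_snd.mul h2)).differentiableOn
    · have h1 : Differentiable ℂ fun z : ℂ × ℂ => p₀.eval z.1 :=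
        p₀.differentiable.comp differentiable_fst
      have h2 : Differentiable ℂ fun z : ℂ × ℂ => p₁.eval z.1 :=
        p₁.differentiable.comp differentiable_fst
      exact (h1.add (differentiable_snd.mul h2)).differentiableOn
  have hconv : IsPreconnected bidisk := by
    have : bidisk = ball (0 : ℂ) 1 ×ˢ ball (0 : ℂ) 1 := by
      ext w; simp [bidisk]
    rw [this]
    exact ((convex_ball 0 1).prod (convex_ball 0 1)).isPreconnected
  have hmax : IsMaxOn (norm ∘ f) bidisk z := by
    intro w hw
    simp only [f, Function.comp_apply, Set.mem_ofPred_eq, norm_div, heq]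
    rw [div_self (norm_ne_zero_iff.2 (D.ne_zero z hz))]
    exact div_le_one_of_le₀ (D.norm_reflection_le hw.1.le hw.2.le) (norm_nonneg _)
  have hE := Complex.eqOn_of_isPreconnected_of_isMaxOn_norm hconv isOpen_bidisk hd hz hmax
  have hmul : ∀ w ∈ bidisk, (crev n p₁).eval w.1 + w.2 * (crev n p₀).eval w.1 =
      f z * (p₀.eval w.1 + w.2 * p₁.eval w.1) := by
    intro w hw
    have := hE hw
    simp only [Function.const_apply] at this
    rw [← this]
    exact (div_mul_cancel₀ _ (D.ne_zero w hw)).symm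
  have hinf : (ball (0 : ℂ) 1).Infinite :=
    infinite_of_mem_nhds 0 (ball_mem_nhds _ one_pos)
  have e1 : crev n p₁ = C (f z) * p₀ := by
    refine Polynomial.eq_of_infinite_eval_eq _ _ (hinf.mono fun x hx => ?_)
    have := hmul (x, 0) ⟨by simpa using hx, by simp⟩
    simpa using this
  refine D.nonconst (f z) e1 ?_
  refine Polynomial.eq_of_infinite_eval_eq _ _ (hinf.mono fun x hx => ?_)
  -- Any nonzero value of `z₂` in the disk reads off the linear coefficient, the constant one being
  -- known.
  have := hmul (x, 1 / 2) ⟨by simpa using hx, by norm_num⟩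
  rw [e1] at this
  simp only [eval_mul, eval_C, Set.mem_ofPred_eq] at this ⊢
  linear_combination 2 * this

lemma norm_p₁_le (ζ : Circle) : ‖p₁.eval (ζ : ℂ)‖ ≤ ‖p₀.eval (ζ : ℂ)‖ := by
  have := D.norm_reflection_le (z₁ := ζ) (z₂ := 0) (Circle.norm_coe ζ).le (by simp)
  simpa [eval_crev_circle D.deg₁, Circle.norm_coe] using this

/-- On the circle `|p₁| ≤ |p₀|`, so a zero of `p₀` there would be a common zero. -/
lemma p₀_ne_zero {z : ℂ} (hz : ‖z‖ ≤ 1) : p₀.eval z ≠ 0 := by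
  rcases hz.lt_or_eq with h | h
  · have := D.ne_zero (z, 0) ⟨h, by simp⟩
    simpa using this
  · obtain ⟨ζ, rfl⟩ := exists_circle h
    intro h0
    have := D.norm_p₁_le ζ
    rw [h0, norm_zero] at this
    exact D.no_common ζ h0 (norm_le_zero_iff.1 this)

lemma p_ne_zero (ζ : Circle) {z₂ : ℂ} (h₂ : ‖z₂‖ < 1) :
    p₀.eval (ζ : ℂ) + z₂ * p₁.eval (ζ : ℂ) ≠ 0 := by
  intro h
  have h0 := norm_pos_iff.2 (D.p₀_ne_zero (Circle.norm_coe ζ).le)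
  have h1 := D.norm_p₁_le ζ
  have : ‖p₀.eval (ζ : ℂ)‖ = ‖z₂‖ * ‖p₁.eval (ζ : ℂ)‖ := by
    rw [← norm_mul, ← norm_neg (z₂ * _)]
    congr 1
    linear_combination h
  nlinarith [norm_nonneg z₂, norm_nonneg (p₁.eval (ζ : ℂ))]

end RIFData

end

section

open Metric Polynomial

instance instIsOpenPosMeasureCircle : circleMeasure.IsOpenPosMeasure := by
  have hs : Function.Surjective (AddCircle.toCircle : UnitAddCircle → Circle) := fun x =>
    ⟨(AddCircle.homeomorphCircle one_ne_zero).symm x, by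
      rw [← AddCircle.homeomorphCircle_apply one_ne_zero, Homeomorph.apply_symm_apply]⟩
  exact AddCircle.continuous_toCircle.isOpenPosMeasure_map hs

lemma ae_notMem_finset (Z : Finset Circle) : ∀ᵐ ζ ∂circleMeasure, ζ ∉ Z := by
  have h : circleMeasure (Z : Set Circle) = 0 := Z.finite_toSet.measure_zero _
  exact measure_eq_zero_iff_ae_notMem.1 h

/-- Finite sets are null while nonempty open sets are not, so the complement of `Z` is dense. -/
lemma eq_of_eq_off_finset {E : Type*} [TopologicalSpace E] [T2Space E] {f g : Circle → E}
    (hf : Continuous f) (hg : Continuous g) (Z : Finset Circle) (h : ∀ ζ ∉ Z, f ζ = g ζ) :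
    f = g := by
  refine (Continuous.ae_eq_iff_eq circleMeasure hf hg).1 ?_
  filter_upwards [ae_notMem_finset Z] with ζ hζ using h ζ hζ

/-! ### Boundary derivatives of functions with nonnegative real part -/

/-- The quantity is the derivative of `g` along the segment `τ (1 - ε v)`, which enters the disk
when `Re v > 0`; the difference quotients have nonnegative real part. -/
lemma re_mul_nonneg_of_hasDerivAt {g : ℂ → ℂ} {g' : ℂ} {τ : Circle} (hg : HasDerivAt g g' τ)
    (h0 : g τ = 0) (hre : ∀ z, ‖z‖ < 1 → 0 ≤ (g z).re) {v : ℂ} (hv : 0 < v.re) :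
    0 ≤ (-τ * g' * v).re := by
  have hd : HasDerivAt (fun ε : ℝ => g (τ * (1 - ε * v))) (-τ * g' * v) 0 := by
    have h1 : HasDerivAt (fun ε : ℂ => (τ : ℂ) * (1 - ε * v)) (-(τ * v)) ((0 : ℝ) : ℂ) := by
      have := (((hasDerivAt_id ((0 : ℝ) : ℂ)).mul_const v).const_sub 1).const_mul (τ : ℂ)
      simpa using this
    have h2 : HasDerivAt g g' ((τ : ℂ) * (1 - ((0 : ℝ) : ℂ) * v)) := by simpa using hg
    have h3 := (h2.comp ((0 : ℝ) : ℂ) (h := fun ε : ℂ => (τ : ℂ) * (1 - ε * v)) h1).comp_ofReal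
    rw [show -(τ : ℂ) * g' * v = g' * -((τ : ℂ) * v) by ring]
    exact h3
  have ht := (hasDerivAt_iff_tendsto_slope.1 hd).mono_left
    (nhdsWithin_mono 0 (fun x (hx : 0 < x) => ne_of_gt hx) : 𝓝[>] (0 : ℝ) ≤ 𝓝[≠] 0)
  have ht' := (continuous_re.tendsto _).comp ht
  refine ge_of_tendsto ht' ?_
  have hv2 : 0 < ‖v‖ ^ 2 := by
    have : v ≠ 0 := fun h => by simp [h] at hv
    positivity
  -- From `|1 - ε v|² = 1 - 2 ε Re v + ε² |v|²`, these are exactly the `ε > 0` for which the point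
  -- lies in the disk.
  filter_upwards [Ioo_mem_nhdsGT (show (0 : ℝ) < 2 * v.re / ‖v‖ ^ 2 by positivity)] with ε hε
  have hlt : ‖(τ : ℂ) * (1 - ε * v)‖ < 1 := by
    rw [norm_mul, Circle.norm_coe, one_mul, ← sq_lt_one_iff₀ (norm_nonneg _), ← normSq_eq_norm_sq,
      normSq_apply]
    have h1 := (lt_div_iff₀ hv2).1 hε.2
    rw [← normSq_eq_norm_sq, normSq_apply] at h1
    have h2 := mul_lt_mul_of_pos_left h1 hε.1
    simp
    nlinarith
  have := hre _ hlt
  simp only [Function.comp_apply, slope, vsub_eq_sub, sub_zero, real_smul, ofReal_zero, zero_mul,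
    mul_one, h0]
  rw [re_ofReal_mul]
  exact mul_nonneg (inv_nonneg.2 hε.1.le) this

lemma real_of_hasDerivAt {g : ℂ → ℂ} {g' : ℂ} {τ : Circle} (hg : HasDerivAt g g' τ)
    (h0 : g τ = 0) (hre : ∀ z, ‖z‖ < 1 → 0 ≤ (g z).re) :
    (-τ * g').im = 0 ∧ 0 ≤ (-τ * g').re := by
  have key := fun v hv => re_mul_nonneg_of_hasDerivAt hg h0 hre (v := v) hv
  set s := -τ * g' with hs
  constructor
  · by_contra him
    -- This direction is chosen to make the real part of `s v` equal to `-1`.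
    have := key (1 + ((s.re + 1) / s.im : ℝ) * I) (by simp)
    have h2 : (s * (1 + ((s.re + 1) / s.im : ℝ) * I)).re = s.re - s.im * ((s.re + 1) / s.im) := by
      simp only [mul_re, add_re, one_re, add_im, one_im, mul_im, ofReal_re, ofReal_im, I_re, I_im]
      ring
    rw [h2, mul_div_cancel₀ _ him] at this
    linarith
  · simpa using key 1 (by simp)

/-- A fraction linear in `z` that is real on the disk is constant. -/
lemma linear_fraction_const {A A₁ P P₁ : ℂ} (hP : ∀ z : ℂ, ‖z‖ < 1 → P + z * P₁ ≠ 0)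
    (him : ∀ z : ℂ, ‖z‖ < 1 → ((A + z * A₁) / (P + z * P₁)).im = 0) {z : ℂ} :
    A + z * A₁ = A / P * (P + z * P₁) := by
  have hP0 : P ≠ 0 := by simpa using hP 0 (by simp)
  set s := A / P with hs
  have hA : A = s * P := (div_mul_cancel₀ A hP0).symm
  have hsim : s.im = 0 := by simpa [hs] using him 0 (by simp)
  -- The fraction is `s + z E / (P + z P₁)`. Dividing the imaginary part by `|z|` and letting `z →
  -- 0` along a direction `v` makes `v E / P` real; the directions `1` and `i` together force `E =
  -- 0`.
  set E := A₁ - s * P₁ with hE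
  have hreal : ∀ z : ℂ, ‖z‖ < 1 → (z * (E / (P + z * P₁))).im = 0 := by
    intro z hz
    have h1 : (A + z * A₁) / (P + z * P₁) = s + z * (E / (P + z * P₁)) := by
      have := hP z hz
      rw [hA, hE]
      field_simp
      ring
    have := him z hz
    rw [h1, add_im, hsim, zero_add] at this
    exact this
  have hlim : ∀ v : ℂ, ‖v‖ = 1 → (v * (E / P)).im = 0 := by
    intro v hv
    have hc : ContinuousAt (fun x : ℝ => (v * (E / (P + (x * v) * P₁))).im) 0 := by
      refine continuous_im.continuousAt.comp ?_
      refine ContinuousAt.mul continuousAt_const (ContinuousAt.div (by fun_prop) (by fun_prop) ?_)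
      simpa using hP0
    have ht := hc.tendsto.mono_left (nhdsWithin_le_nhds (s := Set.Ioi 0))
    have h0 : Tendsto (fun x : ℝ => (v * (E / (P + (x * v) * P₁))).im) (𝓝[>] 0) (𝓝 0) := by
      refine tendsto_const_nhds.congr' ?_
      filter_upwards [Ioo_mem_nhdsGT (zero_lt_one' ℝ)] with x hx
      have := hreal (x * v) (by
        rw [norm_mul, hv, mul_one, Complex.norm_real, Real.norm_of_nonneg hx.1.le]; exact hx.2)
      rw [mul_assoc, im_ofReal_mul] at this
      exact ((mul_eq_zero.1 this).resolve_left hx.1.ne').symm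
    have := tendsto_nhds_unique ht h0
    simpa using this
  have h1 := hlim 1 (by simp)
  have h2 := hlim I (by simp)
  have hE0 : E / P = 0 := by
    apply Complex.ext
    · simpa using h2
    · simpa using h1
  have hE00 : E = 0 := (div_eq_zero_iff.1 hE0).resolve_right hP0
  rw [hA]
  linear_combination z * (hE.symm.trans hE00)

/-- Harnack's lower bound with a cruder constant. -/
lemma poisson_ge {z : ℂ} (hz : ‖z‖ < 1) (ζ : Circle) : (1 - ‖z‖) / 2 ≤ poisson z ζ := by
  have h1 := norm_pos_iff.2 (circle_sub_ne_zero hz ζ)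
  have h2 : ‖(ζ : ℂ) - z‖ ≤ 1 + ‖z‖ := (norm_sub_le _ _).trans (by rw [Circle.norm_coe])
  rw [poisson, div_le_div_iff₀ two_pos (by positivity)]
  have h3 : ‖(ζ : ℂ) - z‖ ^ 2 ≤ (1 + ‖z‖) ^ 2 := by gcongr
  have h4 := mul_le_mul_of_nonneg_left h3 (sub_nonneg.2 hz.le)
  have h5 : 0 ≤ (1 - ‖z‖) * (1 - ‖z‖) * (1 + ‖z‖) := by
    have := norm_nonneg z
    have := sub_nonneg.2 hz.le
    positivity
  nlinarith

/-- A function with nonnegative real part, not identically imaginary, has nonzero derivative at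
a boundary zero. -/
lemma deriv_ne_zero_of_re_nonneg {g : ℂ → ℂ} (hd : DiffContOnCl ℂ g (ball 0 1)) {g' : ℂ}
    {τ : Circle} (hg : HasDerivAt g g' τ) (h0 : g τ = 0) (hre : ∀ ζ : Circle, 0 ≤ (g ζ).re)
    (hpos : 0 < (g 0).re) : g' ≠ 0 := by
  rintro rfl
  -- Harnack bounds the real part along the radius below by a positive multiple of `1 - r`, which a
  -- vanishing derivative at `τ` would contradict.
  have hH : ∀ r : ℝ, r ∈ Set.Ioo (0 : ℝ) 1 → (1 - r) / 2 * (g 0).re ≤ (g (r * τ)).re := by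
    intro r hr
    have hn : ‖(r : ℂ) * τ‖ = r := by
      rw [norm_mul, Circle.norm_coe, mul_one, Complex.norm_real, Real.norm_of_nonneg hr.1.le]
    have hlt : ‖(r : ℂ) * τ‖ < 1 := hn.trans_lt hr.2
    have hc : Continuous fun ζ : Circle => g ζ :=
      hd.continuousOn.comp_continuous (by fun_prop) fun ζ => by
        rw [closure_ball _ one_ne_zero]; simp [Circle.norm_coe]
    rw [← re_poisson_of_diffContOnCl hd hlt, ← re_poisson_of_diffContOnCl hd (z := 0) (by simp),
      ← integral_const_mul]
    refine integral_mono (integrable_circle ?_) (integrable_circle ?_) fun ζ => ?_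
    · exact continuous_const.mul ((continuous_poisson (by simp)).mul (continuous_re.comp hc))
    · exact (continuous_poisson hlt).mul (continuous_re.comp hc)
    · have h1 := poisson_ge hlt ζ
      rw [hn] at h1
      have h2 : poisson 0 ζ = 1 := by simp [poisson, Circle.norm_coe]
      simp only [h2, one_mul]
      exact mul_le_mul_of_nonneg_right h1 (hre ζ)
  have hdr : HasDerivAt (fun r : ℝ => g (r * τ)) 0 1 := by
    have h1 : HasDerivAt (fun r : ℂ => r * (τ : ℂ)) (τ : ℂ) ((1 : ℝ) : ℂ) := by
      simpa using (hasDerivAt_id ((1 : ℝ) : ℂ)).mul_const (τ : ℂ)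
    have h2 : HasDerivAt g 0 (((1 : ℝ) : ℂ) * τ) := by simpa using hg
    simpa using (h2.comp ((1 : ℝ) : ℂ) (h := fun r : ℂ => r * (τ : ℂ)) h1).comp_ofReal
  have ht := ((hasDerivAt_iff_tendsto_slope.1 hdr).mono_left
    (nhdsWithin_mono 1 (fun x (hx : x < 1) => ne_of_lt hx) : 𝓝[<] (1 : ℝ) ≤ 𝓝[≠] 1)).norm
  rw [norm_zero] at ht
  have := ge_of_tendsto ht (b := (g 0).re / 2) ?_
  · linarith
  · filter_upwards [Ioo_mem_nhdsLT (zero_lt_one' ℝ)] with r hr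
    have h1 := (hH r hr).trans (re_le_norm _)
    simp only [slope, vsub_eq_sub, ofReal_one, one_mul, h0, sub_zero, norm_smul, norm_inv,
      Real.norm_eq_abs]
    rw [abs_of_neg (by linarith [hr.2]), inv_mul_eq_div, le_div_iff₀ (by linarith [hr.2])]
    linarith

lemma re_add_div_sub (x y : ℂ) : ((x + y) / (x - y)).re = (‖x‖ ^ 2 - ‖y‖ ^ 2) / ‖x - y‖ ^ 2 := by
  rw [div_re, normSq_eq_norm_sq (x - y), ← add_div, add_re, sub_re, add_im, sub_im,
    ← normSq_eq_norm_sq x, ← normSq_eq_norm_sq y, normSq_apply, normSq_apply]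
  congr 1
  ring

end

section

open Metric Polynomial

/-! ### Level sets of rational inner functions of degree `(n, 1)` -/

/-- The constant coefficient in `z₂` of `α p - γ p̃`. -/
def level₀ (n : ℕ) (p₀ p₁ : ℂ[X]) (γ α : Circle) : ℂ[X] := C (α : ℂ) * p₀ - C (γ : ℂ) * crev n p₁

/-- The linear coefficient in `z₂` of `α p - γ p̃`. -/
def level₁ (n : ℕ) (p₀ p₁ : ℂ[X]) (γ α : Circle) : ℂ[X] := C (α : ℂ) * p₁ - C (γ : ℂ) * crev n p₀

lemma eval_level (n : ℕ) (p₀ p₁ : ℂ[X]) (γ α : Circle) (z₁ z₂ : ℂ) :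
    (level₀ n p₀ p₁ γ α).eval z₁ + z₂ * (level₁ n p₀ p₁ γ α).eval z₁ =
      α * (p₀.eval z₁ + z₂ * p₁.eval z₁) -
      γ * ((crev n p₁).eval z₁ + z₂ * (crev n p₀).eval z₁) := by
  simp [level₀, level₁]
  ring

lemma conj_mul_circle (ζ : Circle) : conj (ζ : ℂ) * (ζ : ℂ) = 1 := by
  rw [mul_comm, circle_mul_conj]

namespace RIFData

variable {n : ℕ} {p₀ p₁ : ℂ[X]} (D : RIFData n p₀ p₁) (γ α : Circle)

include D

lemma level_ne_zero {z : ℂ × ℂ} (hz : z ∈ bidisk) :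
    (level₀ n p₀ p₁ γ α).eval z.1 + z.2 * (level₁ n p₀ p₁ γ α).eval z.1 ≠ 0 := by
  rw [eval_level, sub_ne_zero]
  intro h
  have h1 := D.norm_reflection_lt hz
  have h2 := congrArg norm h
  rw [norm_mul, norm_mul, Circle.norm_coe, Circle.norm_coe, one_mul, one_mul] at h2
  linarith

/-- Up to a unimodular constant, `α p - γ p̃` is its own reflection. This gives the equality of
moduli on the circle, and later places a root of `b₁` inside the disk. -/
lemma level₁_eq : level₁ n p₀ p₁ γ α = C (-(α * γ : ℂ)) * crev n (level₀ n p₀ p₁ γ α) := by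
  have h : level₀ n p₀ p₁ γ α = C (α : ℂ) * p₀ + C (-(γ : ℂ)) * crev n p₁ := by
    rw [level₀, C_neg]; ring
  rw [h, crev_add, crev_C_mul, crev_C_mul, crev_crev D.deg₁, level₁, mul_add, ← mul_assoc,
    ← mul_assoc, ← C_mul, ← C_mul]
  have e1 : -((α : ℂ) * γ) * conj (α : ℂ) = -γ := by
    linear_combination -(γ : ℂ) * circle_mul_conj α
  have e2 : -((α : ℂ) * γ) * conj (-(γ : ℂ)) = α := by
    rw [map_neg]
    linear_combination (α : ℂ) * circle_mul_conj γ
  rw [e1, e2, C_neg]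
  ring

lemma natDegree_level₀ : (level₀ n p₀ p₁ γ α).natDegree ≤ n :=
  (natDegree_sub_le _ _).trans (max_le ((natDegree_C_mul_le _ _).trans D.deg₀)
    ((natDegree_C_mul_le _ _).trans (natDegree_crev_le _ _)))

lemma level₀_ne_zero {z : ℂ} (hz : ‖z‖ < 1) : (level₀ n p₀ p₁ γ α).eval z ≠ 0 := by
  have := D.level_ne_zero γ α (z := (z, 0)) ⟨hz, by simp⟩
  simpa using this

lemma norm_level₁_circle (ζ : Circle) :
    ‖(level₁ n p₀ p₁ γ α).eval (ζ : ℂ)‖ = ‖(level₀ n p₀ p₁ γ α).eval (ζ : ℂ)‖ := by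
  rw [D.level₁_eq, eval_mul, eval_crev_circle (D.natDegree_level₀ γ α)]
  simp [Circle.norm_coe]

/-- On `𝕋 × 𝔻` one has `|p|² - |p̃|² = (|p₀|² - |p₁|²) (1 - |z₂|²)`. -/
lemma normSq_sub_circle (ζ : Circle) (z₂ : ℂ) :
    ‖p₀.eval (ζ : ℂ) + z₂ * p₁.eval (ζ : ℂ)‖ ^ 2 -
      ‖(crev n p₁).eval (ζ : ℂ) + z₂ * (crev n p₀).eval (ζ : ℂ)‖ ^ 2 =
      (‖p₀.eval (ζ : ℂ)‖ ^ 2 - ‖p₁.eval (ζ : ℂ)‖ ^ 2) * (1 - ‖z₂‖ ^ 2) := by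
  rw [eval_crev_circle D.deg₀, eval_crev_circle D.deg₁]
  have h : (ζ : ℂ) ^ n * conj (p₁.eval (ζ : ℂ)) + z₂ * ((ζ : ℂ) ^ n * conj (p₀.eval (ζ : ℂ))) =
      (ζ : ℂ) ^ n * (conj (p₁.eval (ζ : ℂ)) + z₂ * conj (p₀.eval (ζ : ℂ))) := by ring
  rw [h, norm_mul, norm_pow, Circle.norm_coe, one_pow, one_mul]
  simp only [← normSq_eq_norm_sq, normSq_apply, add_re, add_im, mul_re, mul_im, conj_re, conj_im]
  ring

/-- The quotient is `1 - conj α · γ p̃ / p`, and `|p̃| ≤ |p|` on the closed bidisk. -/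
lemma re_level_nonneg {z : ℂ × ℂ} (h1 : ‖z.1‖ ≤ 1) (h2 : ‖z.2‖ ≤ 1)
    (hne : p₀.eval z.1 + z.2 * p₁.eval z.1 ≠ 0) :
    0 ≤ (conj (α : ℂ) * ((level₀ n p₀ p₁ γ α).eval z.1 + z.2 * (level₁ n p₀ p₁ γ α).eval z.1) /
      (p₀.eval z.1 + z.2 * p₁.eval z.1)).re := by
  rw [eval_level]
  have h3 := D.norm_reflection_le h1 h2
  set P := p₀.eval z.1 + z.2 * p₁.eval z.1
  set Q := (crev n p₁).eval z.1 + z.2 * (crev n p₀).eval z.1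
  have e : conj (α : ℂ) * (α * P - γ * Q) / P = 1 - conj (α : ℂ) * γ * Q / P := by
    field_simp
    linear_combination P * conj_mul_circle α
  rw [e, sub_re, one_re, sub_nonneg]
  refine (re_le_norm _).trans ?_
  rw [norm_div, norm_mul, norm_mul, RCLike.norm_conj, Circle.norm_coe, Circle.norm_coe, one_mul,
    one_mul]
  exact div_le_one_of_le₀ h3 (norm_nonneg _)

lemma re_level_pos {z : ℂ × ℂ} (hz : z ∈ bidisk) :
    0 < (conj (α : ℂ) * ((level₀ n p₀ p₁ γ α).eval z.1 + z.2 * (level₁ n p₀ p₁ γ α).eval z.1) /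
      (p₀.eval z.1 + z.2 * p₁.eval z.1)).re := by
  rw [eval_level]
  have h3 := D.norm_reflection_lt hz
  have hne := D.ne_zero z hz
  set P := p₀.eval z.1 + z.2 * p₁.eval z.1
  set Q := (crev n p₁).eval z.1 + z.2 * (crev n p₀).eval z.1
  have e : conj (α : ℂ) * (α * P - γ * Q) / P = 1 - conj (α : ℂ) * γ * Q / P := by
    field_simp
    linear_combination P * conj_mul_circle α
  rw [e, sub_re, one_re, sub_pos]
  refine (re_le_norm _).trans_lt ?_
  rw [norm_div, norm_mul, norm_mul, RCLike.norm_conj, Circle.norm_coe, Circle.norm_coe, one_mul,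
    one_mul]
  exact (div_lt_one (norm_pos_iff.2 hne)).2 h3

lemma level₁_eq_zero {τ : Circle} (h : (level₀ n p₀ p₁ γ α).eval (τ : ℂ) = 0) :
    (level₁ n p₀ p₁ γ α).eval (τ : ℂ) = 0 := by
  rw [← norm_eq_zero, D.norm_level₁_circle, h, norm_zero]

/-- Both coefficients of the level polynomial vanish at `τ`, so the quotient rule loses the term
with the derivative of `p`. -/
lemma hasDerivAt_level (τ : Circle) {z₂ : ℂ} (h₂ : ‖z₂‖ < 1)
    (h : (level₀ n p₀ p₁ γ α).eval (τ : ℂ) = 0) :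
    HasDerivAt (fun z => conj (α : ℂ) *
      ((level₀ n p₀ p₁ γ α).eval z + z₂ * (level₁ n p₀ p₁ γ α).eval z) /
      (p₀.eval z + z₂ * p₁.eval z))
      (conj (α : ℂ) * ((level₀ n p₀ p₁ γ α).derivative.eval (τ : ℂ) +
        z₂ * (level₁ n p₀ p₁ γ α).derivative.eval (τ : ℂ)) /
      (p₀.eval (τ : ℂ) + z₂ * p₁.eval (τ : ℂ))) τ := by
  have hne := D.p_ne_zero τ h₂
  have h1 := D.level₁_eq_zero γ α h
  have := ((((level₀ n p₀ p₁ γ α).hasDerivAt (τ : ℂ)).add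
    (((level₁ n p₀ p₁ γ α).hasDerivAt (τ : ℂ)).const_mul z₂)).const_mul (conj (α : ℂ))).div
    ((p₀.hasDerivAt (τ : ℂ)).add ((p₁.hasDerivAt (τ : ℂ)).const_mul z₂)) hne
  refine this.congr_deriv ?_
  simp only [Pi.add_apply, h, h1]
  field_simp
  ring

/-- Boundary zeros of the level polynomial are simple. -/
lemma derivative_level₀_ne_zero {τ : Circle} (h : (level₀ n p₀ p₁ γ α).eval (τ : ℂ) = 0) :
    (level₀ n p₀ p₁ γ α).derivative.eval (τ : ℂ) ≠ 0 := by
  have hd := D.hasDerivAt_level γ α τ (z₂ := 0) (by simp) h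
  simp only [zero_mul, add_zero] at hd
  have hre : ∀ z : ℂ, ‖z‖ ≤ 1 →
      0 ≤ (conj (α : ℂ) * (level₀ n p₀ p₁ γ α).eval z / p₀.eval z).re := by
    intro z hz
    have := D.re_level_nonneg γ α (z := (z, 0)) hz (by simp) (by simpa using D.p₀_ne_zero hz)
    simpa using this
  have hpos := D.re_level_pos γ α (z := (0, 0)) (by simp [bidisk])
  simp only [zero_mul, add_zero] at hpos
  have hcl : DiffContOnCl ℂ (fun z => conj (α : ℂ) * (level₀ n p₀ p₁ γ α).eval z / p₀.eval z)
      (ball 0 1) := by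
    refine DifferentiableOn.diffContOnCl ?_
    rw [closure_ball _ one_ne_zero]
    refine DifferentiableOn.div (by fun_prop) (by fun_prop) fun z hz => ?_
    exact D.p₀_ne_zero (by simpa using hz)
  have := deriv_ne_zero_of_re_nonneg hcl hd (by simp [h])
    (fun ζ => hre ζ (Circle.norm_coe ζ).le) hpos
  intro h'
  simp [h'] at this

/-- The derivative of `φ(·, z₂)` at a boundary zero of the level polynomial is, up to a unimodular
factor, positive and independent of `z₂`. -/
lemma exists_pos_residue {τ : Circle} (h : (level₀ n p₀ p₁ γ α).eval (τ : ℂ) = 0) :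
    ∃ c : ℝ, 0 < c ∧ ∀ z₂ : ℂ, c * (-(τ : ℂ) * conj (α : ℂ)) *
      ((level₀ n p₀ p₁ γ α).derivative.eval (τ : ℂ) +
        z₂ * (level₁ n p₀ p₁ γ α).derivative.eval (τ : ℂ)) =
      p₀.eval (τ : ℂ) + z₂ * p₁.eval (τ : ℂ) := by
  set a := (level₀ n p₀ p₁ γ α).derivative.eval (τ : ℂ) with ha
  set a₁ := (level₁ n p₀ p₁ γ α).derivative.eval (τ : ℂ)
  have hreal : ∀ z₂ : ℂ, ‖z₂‖ < 1 →
      ((-(τ : ℂ) * conj (α : ℂ) * a + z₂ * (-(τ : ℂ) * conj (α : ℂ) * a₁)) /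
        (p₀.eval (τ : ℂ) + z₂ * p₁.eval (τ : ℂ))).im = 0 ∧
      0 ≤ ((-(τ : ℂ) * conj (α : ℂ) * a + z₂ * (-(τ : ℂ) * conj (α : ℂ) * a₁)) /
        (p₀.eval (τ : ℂ) + z₂ * p₁.eval (τ : ℂ))).re := by
    intro z₂ hz₂
    have := real_of_hasDerivAt (D.hasDerivAt_level γ α τ hz₂ h)
      (by simp [h, D.level₁_eq_zero γ α h])
      (fun z hz => D.re_level_nonneg γ α (z := (z, z₂)) hz.le hz₂.le (D.ne_zero (z, z₂) ⟨hz, hz₂⟩))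
    convert this using 3 <;> ring
  -- The boundary derivative is real for every `z₂` in the disk and is a fraction linear in `z₂`,
  -- hence constant: the mass of a line is uniform along it.
  have hlin := fun z => linear_fraction_const (z := z) (fun z hz => D.p_ne_zero τ hz)
    (fun z hz => (hreal z hz).1)
  have h0 := hreal 0 (by simp)
  simp only [zero_mul, add_zero] at h0
  set s := -(τ : ℂ) * conj (α : ℂ) * a / p₀.eval (τ : ℂ) with hs
  have hs0 : s ≠ 0 := by
    refine div_ne_zero (mul_ne_zero (mul_ne_zero (neg_ne_zero.2 τ.coe_ne_zero) ?_)
      (D.derivative_level₀_ne_zero γ α h)) (D.p₀_ne_zero (Circle.norm_coe τ).le)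
    simp
  have hsre : s = (s.re : ℂ) := Complex.ext (by simp) (by simp [h0.1])
  have hpos : 0 < s.re := lt_of_le_of_ne h0.2 fun hh => hs0 (by rw [hsre, ← hh]; simp)
  refine ⟨s.re⁻¹, inv_pos.2 hpos, fun z₂ => ?_⟩
  have := hlin z₂
  rw [hsre] at this
  have hC : (s.re : ℂ) ≠ 0 := by exact_mod_cast hpos.ne'
  push_cast
  field_simp
  linear_combination this

end RIFData

end

/-! ### Partial fractions and the ingredients of the Clark measure -/

section

open Metric Polynomial

/-- The polynomial with simple zeros at the points of `Z`. -/
def nodal (Z : Finset Circle) : ℂ[X] := ∏ τ ∈ Z, (X - C (τ : ℂ))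

lemma eval_nodal (Z : Finset Circle) (z : ℂ) : (nodal Z).eval z = ∏ τ ∈ Z, (z - τ) := by
  simp [nodal, eval_prod]

lemma eval_nodal_eq_zero {Z : Finset Circle} {τ : Circle} (h : τ ∈ Z) :
    (nodal Z).eval (τ : ℂ) = 0 := by
  rw [eval_nodal]
  exact Finset.prod_eq_zero h (sub_self _)

lemma eval_nodal_ne_zero {Z : Finset Circle} {z : ℂ} (h : ∀ τ ∈ Z, z ≠ τ) :
    (nodal Z).eval z ≠ 0 := by
  rw [eval_nodal]
  exact Finset.prod_ne_zero_iff.2 fun τ hτ => sub_ne_zero.2 (h τ hτ)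

lemma nodal_eq_mul_erase [DecidableEq Circle] {Z : Finset Circle} {τ : Circle} (h : τ ∈ Z) :
    nodal Z = (X - C (τ : ℂ)) * nodal (Z.erase τ) :=
  (Finset.mul_prod_erase Z _ h).symm

lemma nodal_dvd {Z : Finset Circle} {q : ℂ[X]} (h : ∀ τ ∈ Z, q.eval (τ : ℂ) = 0) :
    nodal Z ∣ q := by
  refine Finset.prod_dvd_of_coprime ?_ fun τ hτ => dvd_iff_isRoot.2 (h τ hτ)
  intro a _ b _ hab
  exact pairwise_coprime_X_sub_C (fun x y hxy => Circle.ext hxy) hab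

lemma derivative_eval_of_nodal [DecidableEq Circle] {Z : Finset Circle} {τ : Circle} (h : τ ∈ Z)
    (b : ℂ[X]) :
    (nodal Z * b).derivative.eval (τ : ℂ) = (nodal (Z.erase τ)).eval (τ : ℂ) * b.eval (τ : ℂ) := by
  rw [nodal_eq_mul_erase h, mul_assoc]
  simp

/-- The explicit form of the Clark measure: its density `w` on the graph of `β`, which is the level
curve `b₀(ζ₁) + ζ₂ b₁(ζ₁) = 0`, and its masses `c` on the lines `{τ} × 𝕋`, `τ ∈ Z`. -/
structure ClarkData (n : ℕ) (p₀ p₁ : ℂ[X]) (γ α : Circle) where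
  Z : Finset Circle
  c : Circle → ℝ
  b₀ : ℂ[X]
  b₁ : ℂ[X]
  w : Circle → ℝ
  β : Circle → Circle
  c_pos : ∀ τ, 0 < c τ
  mem_Z : ∀ τ, τ ∈ Z ↔ (level₀ n p₀ p₁ γ α).eval (τ : ℂ) = 0
  level₀_eq : level₀ n p₀ p₁ γ α = nodal Z * b₀
  level₁_eq : level₁ n p₀ p₁ γ α = nodal Z * b₁
  b₀_ne_zero : ∀ z, ‖z‖ ≤ 1 → b₀.eval z ≠ 0
  curve : ∀ ζ : Circle, b₀.eval (ζ : ℂ) + β ζ * b₁.eval (ζ : ℂ) = 0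
  continuous_β : Continuous β
  continuous_w : Continuous w
  w_nonneg : ∀ ζ, 0 ≤ w ζ
  w_eq : ∀ ζ ∉ Z, w ζ * ‖(level₀ n p₀ p₁ γ α).eval (ζ : ℂ)‖ ^ 2 =
    ‖p₀.eval (ζ : ℂ)‖ ^ 2 - ‖p₁.eval (ζ : ℂ)‖ ^ 2
  poisson_eq : ∀ z ∈ bidisk,
    ∑ τ ∈ Z, c τ * poisson z.1 τ +
      ∫ ζ, w ζ * (poisson z.1 ζ * poisson z.2 (β ζ)) ∂circleMeasure =
    (‖p₀.eval z.1 + z.2 * p₁.eval z.1‖ ^ 2 -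
      ‖(crev n p₁).eval z.1 + z.2 * (crev n p₀).eval z.1‖ ^ 2) /
    ‖(level₀ n p₀ p₁ γ α).eval z.1 + z.2 * (level₁ n p₀ p₁ γ α).eval z.1‖ ^ 2

/-- The fraction is `1` plus the Herglotz kernel. The extra `1` is why the sum of the masses appears
as a constant in the partial fractions. -/
lemma re_two_mul_div (τ : Circle) {z : ℂ} (hz : z ≠ τ) :
    (2 * (τ : ℂ) / (τ - z)).re = 1 + (1 - ‖z‖ ^ 2) / ‖(τ : ℂ) - z‖ ^ 2 := by
  have h : (τ : ℂ) - z ≠ 0 := sub_ne_zero.2 hz.symm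
  have e : 2 * (τ : ℂ) / (τ - z) = 1 + (τ + z) / (τ - z) := by
    field_simp
    ring
  rw [e, add_re, one_re, re_add_div_sub, Circle.norm_coe, one_pow]

/-- Partial fraction decomposition of `(α + φ) / (α - φ)` in the variable `z₁`. -/
lemma exists_partial_fraction [DecidableEq Circle] {n : ℕ} {p₀ p₁ : ℂ[X]} {γ α : Circle}
    {Z : Finset Circle} {c : Circle → ℝ}
    {b₀ b₁ : ℂ[X]}
    (hc : ∀ τ ∈ Z, ∀ z₂ : ℂ, c τ * (-(τ : ℂ) * conj (α : ℂ)) *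
      ((level₀ n p₀ p₁ γ α).derivative.eval (τ : ℂ) +
        z₂ * (level₁ n p₀ p₁ γ α).derivative.eval (τ : ℂ)) =
      p₀.eval (τ : ℂ) + z₂ * p₁.eval (τ : ℂ))
    (h₀ : level₀ n p₀ p₁ γ α = nodal Z * b₀) (h₁ : level₁ n p₀ p₁ γ α = nodal Z * b₁) (z₂ : ℂ) :
    ∃ R : ℂ[X], ∀ z : ℂ, (∀ τ ∈ Z, z ≠ τ) → b₀.eval z + z₂ * b₁.eval z ≠ 0 →
      (R.eval z / (b₀.eval z + z₂ * b₁.eval z) + ∑ τ ∈ Z, (c τ : ℂ)).re +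
        ∑ τ ∈ Z, c τ * ((1 - ‖z‖ ^ 2) / ‖(τ : ℂ) - z‖ ^ 2) =
      (‖p₀.eval z + z₂ * p₁.eval z‖ ^ 2 -
        ‖(crev n p₁).eval z + z₂ * (crev n p₀).eval z‖ ^ 2) /
      ‖(level₀ n p₀ p₁ γ α).eval z + z₂ * (level₁ n p₀ p₁ γ α).eval z‖ ^ 2 := by
  -- `N` is the numerator `α p + γ p̃`, `u` the level polynomial without its circle zeros, and `L`
  -- the Lagrange form of the polar part.
  let N : ℂ[X] := (C (α : ℂ) * p₀ + C (γ : ℂ) * crev n p₁) +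
    C z₂ * (C (α : ℂ) * p₁ + C (γ : ℂ) * crev n p₀)
  let u : ℂ[X] := b₀ + C z₂ * b₁
  let L : ℂ[X] := ∑ τ ∈ Z, C (-2 * (c τ : ℂ) * τ) * nodal (Z.erase τ)
  -- At `τ ∈ Z` one has `α p = γ p̃`, so `N = 2 α p`, and the residue formula identifies this with
  -- `u L`.
  have hdvd : nodal Z ∣ N - u * L := by
    refine nodal_dvd fun τ hτ => ?_
    have hL : L.eval (τ : ℂ) = -2 * (c τ : ℂ) * τ * (nodal (Z.erase τ)).eval (τ : ℂ) := by
      simp only [L, eval_finsetSum, eval_mul, eval_C]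
      refine Finset.sum_eq_single_of_mem τ hτ fun σ _ hne => ?_
      rw [eval_nodal_eq_zero (Finset.mem_erase.2 ⟨hne.symm, hτ⟩), mul_zero]
    have hz0 : (level₀ n p₀ p₁ γ α).eval (τ : ℂ) = 0 := by
      rw [h₀, eval_mul, eval_nodal_eq_zero hτ, zero_mul]
    have hz1 : (level₁ n p₀ p₁ γ α).eval (τ : ℂ) = 0 := by
      rw [h₁, eval_mul, eval_nodal_eq_zero hτ, zero_mul]
    have hd := hc τ hτ z₂
    rw [h₀, h₁, derivative_eval_of_nodal hτ, derivative_eval_of_nodal hτ] at hd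
    have hl := eval_level n p₀ p₁ γ α τ z₂
    rw [hz0, hz1, mul_zero, add_zero] at hl
    rw [eval_sub, eval_mul, hL]
    simp only [N, u, eval_add, eval_mul, eval_C]
    linear_combination hl - 2 * (α : ℂ) * hd + (-2) * (c τ : ℂ) * τ *
      (nodal (Z.erase τ)).eval (τ : ℂ) * (b₀.eval (τ : ℂ) + z₂ * b₁.eval (τ : ℂ)) *
        circle_mul_conj α
  obtain ⟨R, hR⟩ := hdvd
  refine ⟨R, fun z hz hu => ?_⟩
  have hd : (nodal Z).eval z ≠ 0 := eval_nodal_ne_zero hz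
  have hN : N.eval z = (b₀.eval z + z₂ * b₁.eval z) * L.eval z + (nodal Z).eval z * R.eval z := by
    have := congrArg (eval z) hR
    simp only [eval_sub, eval_mul] at this
    simp only [u, eval_add, eval_mul, eval_C] at this
    linear_combination this
  have hlev : (level₀ n p₀ p₁ γ α).eval z + z₂ * (level₁ n p₀ p₁ γ α).eval z =
      (nodal Z).eval z * (b₀.eval z + z₂ * b₁.eval z) := by
    rw [h₀, h₁, eval_mul, eval_mul]; ring
  have hfrac : N.eval z / ((nodal Z).eval z * (b₀.eval z + z₂ * b₁.eval z)) =
      L.eval z / (nodal Z).eval z + R.eval z / (b₀.eval z + z₂ * b₁.eval z) := by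
    rw [hN]
    field_simp
  have hLd : L.eval z / (nodal Z).eval z = ∑ τ ∈ Z, (c τ : ℂ) * (2 * (τ : ℂ) / (τ - z)) := by
    simp only [L, eval_finsetSum, eval_mul, eval_C, Finset.sum_div]
    refine Finset.sum_congr rfl fun τ hτ => ?_
    have h1 : (nodal Z).eval z = (z - τ) * (nodal (Z.erase τ)).eval z := by
      rw [nodal_eq_mul_erase hτ, eval_mul]; simp
    have h2 : z - τ ≠ 0 := sub_ne_zero.2 (hz τ hτ)
    have h2' : (τ : ℂ) - z ≠ 0 := sub_ne_zero.2 (hz τ hτ).symm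
    have h3 : (nodal (Z.erase τ)).eval z ≠ 0 := fun h => hd (by rw [h1, h, mul_zero])
    rw [h1]
    field_simp
    ring
  have hre : (N.eval z / ((nodal Z).eval z * (b₀.eval z + z₂ * b₁.eval z))).re =
      (‖p₀.eval z + z₂ * p₁.eval z‖ ^ 2 -
        ‖(crev n p₁).eval z + z₂ * (crev n p₀).eval z‖ ^ 2) /
      ‖(level₀ n p₀ p₁ γ α).eval z + z₂ * (level₁ n p₀ p₁ γ α).eval z‖ ^ 2 := by
    rw [← hlev, eval_level]
    have hN2 : N.eval z = α * (p₀.eval z + z₂ * p₁.eval z) +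
        γ * ((crev n p₁).eval z + z₂ * (crev n p₀).eval z) := by
      simp only [N, eval_add, eval_mul, eval_C]
      ring
    rw [hN2, re_add_div_sub, norm_mul, norm_mul, Circle.norm_coe, Circle.norm_coe, one_mul,
      one_mul]
  rw [← hre, hfrac, hLd, add_re, add_re, re_sum, re_sum, add_comm _ (Complex.re (_ / _)), add_assoc,
    ← Finset.sum_add_distrib]
  congr 1
  refine Finset.sum_congr rfl fun τ hτ => ?_
  rw [re_ofReal_mul, re_two_mul_div τ (hz τ hτ), ofReal_re]
  ring

/-- For fixed `z₂` in the disk, removing the poles on `Z` from `(α + φ) / (α - φ)` leaves a function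
of `z₁` holomorphic up to the circle, whose real part is the Poisson integral of its boundary
values. There the level polynomial factors as `nodal Z · b₁ · (z₂ - β)`, which turns these values
into `w(ζ) P(z₂, β ζ)`. -/
lemma RIFData.exists_clarkData {n : ℕ} {p₀ p₁ : ℂ[X]} (D : RIFData n p₀ p₁) (γ α : Circle) :
    Nonempty (ClarkData n p₀ p₁ γ α) := by
  classical
  have hA0 : level₀ n p₀ p₁ γ α ≠ 0 := fun h => by
    have := D.level₀_ne_zero γ α (z := 0) (by simp)
    simp [h] at this
  have hfin : {τ : Circle | (level₀ n p₀ p₁ γ α).eval (τ : ℂ) = 0}.Finite := by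
    refine Set.Finite.preimage (f := ((↑) : Circle → ℂ)) (fun x _ y _ h => Circle.ext h)
      (s := {z | (level₀ n p₀ p₁ γ α).eval z = 0}) ?_
    exact (Polynomial.finite_setOfPred_isRoot hA0)
  let Z : Finset Circle := hfin.toFinset
  have hZ : ∀ τ, τ ∈ Z ↔ (level₀ n p₀ p₁ γ α).eval (τ : ℂ) = 0 := fun τ => by simp [Z]
  obtain ⟨b₀, h₀⟩ : nodal Z ∣ level₀ n p₀ p₁ γ α := nodal_dvd fun τ hτ => (hZ τ).1 hτ
  obtain ⟨b₁, h₁⟩ : nodal Z ∣ level₁ n p₀ p₁ γ α :=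
    nodal_dvd fun τ hτ => D.level₁_eq_zero γ α ((hZ τ).1 hτ)
  -- The circle zeros of the level polynomial are simple, so `nodal Z` absorbs them completely.
  have hb₀ : ∀ z, ‖z‖ ≤ 1 → b₀.eval z ≠ 0 := by
    intro z hz h
    have hlz : (level₀ n p₀ p₁ γ α).eval z = 0 := by rw [h₀, eval_mul, h, mul_zero]
    rcases hz.lt_or_eq with hlt | heq
    · exact D.level₀_ne_zero γ α hlt hlz
    · obtain ⟨τ, rfl⟩ := exists_circle heq
      refine D.derivative_level₀_ne_zero γ α hlz ?_
      rw [h₀, derivative_eval_of_nodal ((hZ τ).2 hlz), h, mul_zero]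
  have hd : ∀ z : ℂ, (∀ τ ∈ Z, z ≠ τ) → (nodal Z).eval z ≠ 0 := fun z => eval_nodal_ne_zero
  have hcoe : ∀ ζ : Circle, ζ ∉ Z → ∀ τ ∈ Z, (ζ : ℂ) ≠ τ := fun ζ hζ τ hτ h =>
    hζ (by rw [Circle.ext h]; exact hτ)
  have hnorm : ∀ ζ : Circle, ‖b₁.eval (ζ : ℂ)‖ = ‖b₀.eval (ζ : ℂ)‖ := by
    have : (fun ζ : Circle => ‖b₁.eval (ζ : ℂ)‖) = fun ζ : Circle => ‖b₀.eval (ζ : ℂ)‖ := by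
      refine eq_of_eq_off_finset (by fun_prop) (by fun_prop) Z fun ζ hζ => ?_
      have := D.norm_level₁_circle γ α ζ
      rw [h₀, h₁, eval_mul, eval_mul, norm_mul, norm_mul] at this
      exact mul_left_cancel₀ (norm_ne_zero_iff.2 (hd ζ (hcoe ζ hζ))) this
    exact fun ζ => congrFun this ζ
  have hb₁ : ∀ ζ : Circle, b₁.eval (ζ : ℂ) ≠ 0 := fun ζ => by
    rw [← norm_ne_zero_iff, hnorm, norm_ne_zero_iff]
    exact hb₀ ζ (Circle.norm_coe ζ).le
  have hu : ∀ z z₂ : ℂ, ‖z‖ ≤ 1 → ‖z₂‖ < 1 → b₀.eval z + z₂ * b₁.eval z ≠ 0 := by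
    intro z z₂ hz hz₂ h
    rcases hz.lt_or_eq with hlt | heq
    · refine D.level_ne_zero γ α (z := (z, z₂)) ⟨hlt, hz₂⟩ ?_
      simp only [h₀, h₁, eval_mul]
      linear_combination (nodal Z).eval z * h
    · obtain ⟨τ, rfl⟩ := exists_circle heq
      have h1 : ‖b₀.eval (τ : ℂ)‖ = ‖z₂‖ * ‖b₁.eval (τ : ℂ)‖ := by
        rw [← norm_mul, ← norm_neg (z₂ * _)]
        congr 1
        linear_combination h
      rw [hnorm] at h1
      have := norm_pos_iff.2 (hb₀ τ (Circle.norm_coe τ).le)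
      nlinarith
  choose! c hcpos hc using fun (τ : Circle) (h : (level₀ n p₀ p₁ γ α).eval (τ : ℂ) = 0) =>
    D.exists_pos_residue γ α h
  choose R hR using exists_partial_fraction (c := c) (fun τ hτ => hc τ ((hZ τ).1 hτ)) h₀ h₁
  let G : ℂ → ℂ → ℂ := fun z₂ z => (R z₂).eval z / (b₀.eval z + z₂ * b₁.eval z) + ∑ τ ∈ Z, (c τ : ℂ)
  have hG : ∀ z₂ : ℂ, ‖z₂‖ < 1 → DiffContOnCl ℂ (G z₂) (ball 0 1) := by
    intro z₂ hz₂
    refine DifferentiableOn.diffContOnCl ?_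
    rw [closure_ball _ one_ne_zero]
    refine DifferentiableOn.add (DifferentiableOn.div (by fun_prop) (by fun_prop) fun z hz => ?_)
      (differentiableOn_const _)
    exact hu z z₂ (by simpa using hz) hz₂
  have hGc : ∀ z₂ : ℂ, ‖z₂‖ < 1 → Continuous fun ζ : Circle => G z₂ ζ := fun z₂ hz₂ =>
    (hG z₂ hz₂).continuousOn.comp_continuous (by fun_prop) fun ζ => by
      rw [closure_ball _ one_ne_zero]; simp [Circle.norm_coe]
  have hGre : ∀ z₂ : ℂ, ‖z₂‖ < 1 → ∀ ζ : Circle, ζ ∉ Z → (G z₂ ζ).re =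
      (‖p₀.eval (ζ : ℂ)‖ ^ 2 - ‖p₁.eval (ζ : ℂ)‖ ^ 2) * (1 - ‖z₂‖ ^ 2) /
      ‖(level₀ n p₀ p₁ γ α).eval (ζ : ℂ) + z₂ * (level₁ n p₀ p₁ γ α).eval (ζ : ℂ)‖ ^ 2 := by
    intro z₂ hz₂ ζ hζ
    have := hR z₂ ζ (hcoe ζ hζ) (hu ζ z₂ (Circle.norm_coe ζ).le hz₂)
    simpa [G, Circle.norm_coe, D.normSq_sub_circle] using this
  -- The value at `z₂ = 0` gives the density. Off `Z` the real part is already nonnegative; the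
  -- absolute value settles the points of `Z` without an argument.
  let w : Circle → ℝ := fun ζ => |(G 0 ζ).re|
  have hw : ∀ ζ : Circle, ζ ∉ Z → w ζ =
      (‖p₀.eval (ζ : ℂ)‖ ^ 2 - ‖p₁.eval (ζ : ℂ)‖ ^ 2) /
        ‖(level₀ n p₀ p₁ γ α).eval (ζ : ℂ)‖ ^ 2 := by
    intro ζ hζ
    have h1 := hGre 0 (by simp) ζ hζ
    simp only [norm_zero, ne_eq, OfNat.ofNat_ne_zero, not_false_eq_true, zero_pow, sub_zero,
      mul_one, zero_mul, add_zero] at h1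
    simp only [w]
    rw [h1, abs_of_nonneg]
    have := D.norm_p₁_le ζ
    refine div_nonneg (sub_nonneg.2 ?_) (by positivity)
    gcongr
  have hβn : ∀ ζ : Circle, ‖-b₀.eval (ζ : ℂ) / b₁.eval (ζ : ℂ)‖ = 1 := fun ζ => by
    rw [norm_div, norm_neg, ← hnorm, div_self (norm_ne_zero_iff.2 (hb₁ ζ))]
  let β : Circle → Circle := fun ζ =>
    ⟨-b₀.eval (ζ : ℂ) / b₁.eval (ζ : ℂ), mem_sphere_zero_iff_norm.2 (hβn ζ)⟩
  have hβ : ∀ ζ : Circle, (β ζ : ℂ) = -b₀.eval (ζ : ℂ) / b₁.eval (ζ : ℂ) := fun ζ => rfl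
  have hcurve : ∀ ζ : Circle, b₀.eval (ζ : ℂ) + β ζ * b₁.eval (ζ : ℂ) = 0 := fun ζ => by
    rw [hβ, div_mul_cancel₀ _ (hb₁ ζ)]; ring
  -- Off `Z` the masses get the default value `1`, so that positivity needs no side condition.
  refine ⟨⟨Z, fun τ => if τ ∈ Z then c τ else 1, b₀, b₁, w, β, ?_, hZ, h₀, h₁, hb₀, hcurve,
    ?_, ?_, fun ζ => abs_nonneg _, ?_, ?_⟩⟩
  · intro τ
    split_ifs with h
    · exact hcpos τ ((hZ τ).1 h)
    · exact one_pos
  · refine Continuous.subtype_mk ?_ _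
    exact Continuous.div (by fun_prop) (by fun_prop) hb₁
  · exact (continuous_re.comp (hGc 0 (by simp))).abs
  · intro ζ hζ
    have : (level₀ n p₀ p₁ γ α).eval (ζ : ℂ) ≠ 0 := fun h => hζ ((hZ ζ).2 h)
    rw [hw ζ hζ]
    field_simp
  · intro z hz
    have hzZ : ∀ τ ∈ Z, z.1 ≠ τ := fun τ _ h => by
      have := hz.1
      rw [h, Circle.norm_coe] at this
      exact lt_irrefl _ this
    rw [← hR z.2 z.1 hzZ (hu z.1 z.2 hz.1.le hz.2), add_comm]
    congr 1
    · change _ = (G z.2 z.1).re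
      rw [← re_poisson_of_diffContOnCl (hG z.2 hz.2) hz.1]
      refine integral_congr_ae ?_
      filter_upwards [ae_notMem_finset Z] with ζ hζ
      rw [hGre z.2 hz.2 ζ hζ, hw ζ hζ]
      have e : (level₀ n p₀ p₁ γ α).eval (ζ : ℂ) + z.2 * (level₁ n p₀ p₁ γ α).eval (ζ : ℂ) =
          (nodal Z).eval (ζ : ℂ) * b₁.eval (ζ : ℂ) * (z.2 - β ζ) := by
        rw [h₀, h₁, eval_mul, eval_mul]
        linear_combination (nodal Z).eval (ζ : ℂ) * hcurve ζ
      have e0 : ‖(level₀ n p₀ p₁ γ α).eval (ζ : ℂ)‖ =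
          ‖(nodal Z).eval (ζ : ℂ)‖ * ‖b₁.eval (ζ : ℂ)‖ := by
        rw [h₀, eval_mul, norm_mul, hnorm]
      rw [e, e0, norm_mul, norm_mul, norm_sub_rev z.2]
      simp only [poisson]
      have q1 := norm_ne_zero_iff.2 (hd ζ (hcoe ζ hζ))
      have q2 := norm_ne_zero_iff.2 (hb₁ ζ)
      have q3 := norm_ne_zero_iff.2 (circle_sub_ne_zero hz.2 (β ζ))
      have q4 := norm_ne_zero_iff.2 (circle_sub_ne_zero hz.1 ζ)
      field_simp
    · refine Finset.sum_congr rfl fun τ hτ => ?_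
      simp only [if_pos hτ, poisson]

end

/-! ### The rational inner function and its explicit Clark measure -/

section

open Metric Polynomial

/-- `φ = γ p̃ / p` on the bidisk with `p = p₀(z₁) + z₂ p₁(z₁)`. -/
structure RIFRep (φ : ℂ × ℂ → ℂ) (n : ℕ) (p₀ p₁ : ℂ[X]) (γ : Circle) : Prop
    extends RIFData n p₀ p₁ where
  eq_div : ∀ z ∈ bidisk, φ z = γ * (((crev n p₁).eval z.1 + z.2 * (crev n p₀).eval z.1) /
    (p₀.eval z.1 + z.2 * p₁.eval z.1))

lemma IsRIF.exists_rifRep {φ : ℂ × ℂ → ℂ} {p : MvPolynomial (Fin 2) ℂ} {n : ℕ}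
    (h : IsRIF φ p n 1) : ∃ γ : Circle, RIFRep φ n (sndCoeff p 0) (sndCoeff p 1) γ := by
  obtain ⟨γ, hγ⟩ := h.eq_div
  refine ⟨γ, h.rifData, fun z hz => ?_⟩
  rw [hγ z hz, evalAt_reflection h.degree_fst h.degree_snd, evalAt_eq_sndCoeff h.degree_snd]

namespace RIFRep

variable {φ : ℂ × ℂ → ℂ} {n : ℕ} {p₀ p₁ : ℂ[X]} {γ : Circle} (R : RIFRep φ n p₀ p₁ γ)

include R

lemma norm_lt_one {z : ℂ × ℂ} (hz : z ∈ bidisk) : ‖φ z‖ < 1 := by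
  rw [R.eq_div z hz, norm_mul, Circle.norm_coe, one_mul, norm_div,
    div_lt_one (norm_pos_iff.2 (R.ne_zero z hz))]
  exact R.norm_reflection_lt hz

lemma sub_eq (α : Circle) {z : ℂ × ℂ} (hz : z ∈ bidisk) : (α : ℂ) - φ z =
    ((level₀ n p₀ p₁ γ α).eval z.1 + z.2 * (level₁ n p₀ p₁ γ α).eval z.1) /
      (p₀.eval z.1 + z.2 * p₁.eval z.1) := by
  have := R.ne_zero z hz
  rw [R.eq_div z hz, eval_level]
  field_simp

lemma sub_ne_zero (α : Circle) {z : ℂ × ℂ} (hz : z ∈ bidisk) : (α : ℂ) - φ z ≠ 0 := by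
  rw [R.sub_eq α hz]
  exact div_ne_zero (R.level_ne_zero γ α hz) (R.ne_zero z hz)

lemma one_sub_ne_zero (α : Circle) {z : ℂ × ℂ} (hz : z ∈ bidisk) :
    1 - conj (α : ℂ) * φ z ≠ 0 := by
  intro h
  refine R.sub_ne_zero α hz ?_
  linear_combination (α : ℂ) * h + φ z * circle_mul_conj α

lemma differentiableOn : DifferentiableOn ℂ φ bidisk := by
  have hp : ∀ q : ℂ[X], Differentiable ℂ fun z : ℂ × ℂ => q.eval z.1 := fun q =>
    q.differentiable.comp differentiable_fst
  have h : DifferentiableOn ℂ (fun z : ℂ × ℂ => (γ : ℂ) *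
      (((crev n p₁).eval z.1 + z.2 * (crev n p₀).eval z.1) *
        (p₀.eval z.1 + z.2 * p₁.eval z.1)⁻¹)) bidisk := by
    refine (differentiableOn_const _).mul (DifferentiableOn.mul ?_ (DifferentiableOn.inv ?_ R.ne_zero))
    · exact ((hp _).add (differentiable_snd.mul (hp _))).differentiableOn
    · exact ((hp _).add (differentiable_snd.mul (hp _))).differentiableOn
  refine h.congr fun z hz => ?_
  rw [R.eq_div z hz, div_eq_mul_inv]

lemma clark_ratio (α : Circle) {z : ℂ × ℂ} (hz : z ∈ bidisk) :
    (1 - ‖φ z‖ ^ 2) / ‖(α : ℂ) - φ z‖ ^ 2 =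
    (‖p₀.eval z.1 + z.2 * p₁.eval z.1‖ ^ 2 -
      ‖(crev n p₁).eval z.1 + z.2 * (crev n p₀).eval z.1‖ ^ 2) /
    ‖(level₀ n p₀ p₁ γ α).eval z.1 + z.2 * (level₁ n p₀ p₁ γ α).eval z.1‖ ^ 2 := by
  have h1 := norm_ne_zero_iff.2 (R.ne_zero z hz)
  have h2 := norm_ne_zero_iff.2 (R.level_ne_zero γ α hz)
  rw [R.sub_eq α hz, R.eq_div z hz, norm_mul, norm_div, norm_div, Circle.norm_coe]
  field_simp

end RIFRep

/-! ### The explicit Clark measure -/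

lemma measurableEmbedding_graph {β : Circle → Circle} (hβ : Continuous β) :
    MeasurableEmbedding fun ζ : Circle => ((ζ, β ζ) : Torus) :=
  (Continuous.isClosedEmbedding (by fun_prop) fun _ _ h =>
    (Prod.ext_iff.1 h).1).measurableEmbedding

lemma measurableEmbedding_line (τ : Circle) :
    MeasurableEmbedding fun ζ : Circle => ((τ, ζ) : Torus) :=
  (Continuous.isClosedEmbedding (by fun_prop) fun _ _ h =>
    (Prod.ext_iff.1 h).2).measurableEmbedding

namespace ClarkData

variable {n : ℕ} {p₀ p₁ : ℂ[X]} {γ α : Circle} (K : ClarkData n p₀ p₁ γ α)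

/-- The measure with density `w` on the graph of `β` and masses `c` on the lines over `Z`. -/
def measure : Measure Torus :=
  (circleMeasure.withDensity fun ζ => ENNReal.ofReal (K.w ζ)).map (fun ζ => (ζ, K.β ζ)) +
    ∑ τ ∈ K.Z, ENNReal.ofReal (K.c τ) • circleMeasure.map (fun ζ => ((τ, ζ) : Torus))

lemma measurable_density : Measurable fun ζ => ENNReal.ofReal (K.w ζ) :=
  K.continuous_w.measurable.ennreal_ofReal

lemma lintegral_eq (F : Torus → ENNReal) :
    ∫⁻ ζ, F ζ ∂K.measure = ∫⁻ ζ, ENNReal.ofReal (K.w ζ) * F (ζ, K.β ζ) ∂circleMeasure +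
      ∑ τ ∈ K.Z, ENNReal.ofReal (K.c τ) * ∫⁻ ζ, F (τ, ζ) ∂circleMeasure := by
  rw [measure, lintegral_add_measure, (measurableEmbedding_graph K.continuous_β).lintegral_map,
    lintegral_withDensity_eq_lintegral_mul_non_measurable _ K.measurable_density
      (Eventually.of_forall fun _ => ENNReal.ofReal_lt_top), lintegral_finsetSum_measure]
  congr 1
  refine Finset.sum_congr rfl fun τ _ => ?_
  rw [lintegral_smul_measure, (measurableEmbedding_line τ).lintegral_map, smul_eq_mul]

instance : IsFiniteMeasure K.measure := by
  refine ⟨?_⟩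
  rw [← lintegral_one, K.lintegral_eq]
  obtain ⟨C, hC⟩ := isCompact_univ.exists_bound_of_continuousOn K.continuous_w.continuousOn
  refine ENNReal.add_lt_top.2 ⟨?_, ENNReal.sum_lt_top.2 fun τ _ => ?_⟩
  · calc _ ≤ ∫⁻ _ : Circle, ENNReal.ofReal C ∂circleMeasure := by
          refine lintegral_mono fun ζ => ?_
          rw [mul_one]
          exact ENNReal.ofReal_le_ofReal ((le_abs_self _).trans (hC ζ (Set.mem_univ _)))
      _ < ⊤ := by simp
  · simp

/-- The masses of the lines are positive and drop out; on the curve only the points with nonzero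
density count. -/
lemma ae_measure_iff {P : Torus → Prop} : (∀ᵐ ζ ∂K.measure, P ζ) ↔
    (∀ᵐ ζ ∂circleMeasure, K.w ζ ≠ 0 → P (ζ, K.β ζ)) ∧
      ∀ τ ∈ K.Z, ∀ᵐ ζ ∂circleMeasure, P (τ, ζ) := by
  have hg : (∀ᵐ ζ ∂(circleMeasure.withDensity fun ζ => ENNReal.ofReal (K.w ζ)).map
      (fun ζ => ((ζ, K.β ζ) : Torus)), P ζ) ↔
      ∀ᵐ ζ ∂circleMeasure, K.w ζ ≠ 0 → P (ζ, K.β ζ) := by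
    rw [(measurableEmbedding_graph K.continuous_β).ae_map_iff,
      ae_withDensity_iff K.measurable_density]
    refine eventually_congr (Eventually.of_forall fun ζ => ?_)
    have : ENNReal.ofReal (K.w ζ) ≠ 0 ↔ K.w ζ ≠ 0 := by
      rw [ne_eq, ENNReal.ofReal_eq_zero, not_le]
      exact ⟨fun h => h.ne', fun h => lt_of_le_of_ne (K.w_nonneg ζ) h.symm⟩
    rw [this]
  have hl : ∀ τ, (∀ᵐ ζ ∂(ENNReal.ofReal (K.c τ) • circleMeasure.map
      (fun ζ => ((τ, ζ) : Torus))), P ζ) ↔ ∀ᵐ ζ ∂circleMeasure, P (τ, ζ) := by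
    intro τ
    rw [Measure.ae_ennreal_smul_measure_iff (by simpa using K.c_pos τ),
      (measurableEmbedding_line τ).ae_map_iff]
  rw [measure, ae_add_measure_iff, hg]
  refine and_congr_right fun _ => ?_
  rw [MeasureTheory.ae_iff, Measure.coe_finsetSum, Finset.sum_apply, Finset.sum_eq_zero_iff]
  refine forall₂_congr fun τ _ => ?_
  rw [← hl τ, MeasureTheory.ae_iff]

lemma integral_eq {f : Torus → ℂ} (hf : Integrable f K.measure) :
    ∫ ζ, f ζ ∂K.measure = ∫ ζ, (K.w ζ : ℂ) * f (ζ, K.β ζ) ∂circleMeasure +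
      ∑ τ ∈ K.Z, (K.c τ : ℂ) * ∫ ζ, f (τ, ζ) ∂circleMeasure := by
  have h1 := hf
  rw [measure] at h1
  have hs := (integrable_finsetSum_measure.1 h1.right_of_add_measure)
  rw [measure, integral_add_measure h1.left_of_add_measure h1.right_of_add_measure,
    (measurableEmbedding_graph K.continuous_β).integral_map,
    integral_withDensity_eq_integral_toReal_smul K.measurable_density
      (Eventually.of_forall fun _ => ENNReal.ofReal_lt_top), integral_finsetSum_measure hs]
  congr 1
  · refine integral_congr_ae (Eventually.of_forall fun ζ => ?_)
    simp [ENNReal.toReal_ofReal (K.w_nonneg ζ)]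
  · refine Finset.sum_congr rfl fun τ _ => ?_
    rw [integral_smul_measure, (measurableEmbedding_line τ).integral_map,
      ENNReal.toReal_ofReal (K.c_pos τ).le, real_smul]

/-- Along a line the Poisson kernel in `z₂` integrates to one and leaves `P(z₁, τ)`, so the integral
is the left side of `poisson_eq`. -/
lemma isClarkMeasure {φ : ℂ × ℂ → ℂ} (R : RIFRep φ n p₀ p₁ γ) :
    IsClarkMeasure φ α K.measure where
  finite := inferInstance
  poisson z hz := by
    rw [R.clark_ratio α hz, ← K.poisson_eq z hz]
    have hc : Continuous fun ζ : Torus => ((bidiskPoissonKernel z ζ : ℝ) : ℂ) := by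
      simp only [bidiskPoissonKernel_eq]
      exact continuous_ofReal.comp (((continuous_poisson hz.1).comp continuous_fst).mul
        ((continuous_poisson hz.2).comp continuous_snd))
    have h := K.integral_eq (hc.integrable_of_hasCompactSupport (HasCompactSupport.of_compactSpace _))
    have hline : ∀ τ : Circle, ∫ ζ, ((bidiskPoissonKernel z (τ, ζ) : ℝ) : ℂ) ∂circleMeasure =
        (poisson z.1 τ : ℂ) := by
      intro τ
      simp only [bidiskPoissonKernel_eq]
      rw [integral_complex_ofReal, integral_const_mul, integral_poisson hz.2, mul_one]
    simp_rw [hline] at h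
    rw [integral_complex_ofReal] at h
    have h2 : ∫ ζ, (K.w ζ : ℂ) * ((bidiskPoissonKernel z (ζ, K.β ζ) : ℝ) : ℂ) ∂circleMeasure =
        ((∫ ζ, K.w ζ * (poisson z.1 ζ * poisson z.2 (K.β ζ)) ∂circleMeasure : ℝ) : ℂ) := by
      rw [← integral_complex_ofReal]
      refine integral_congr_ae (Eventually.of_forall fun ζ => ?_)
      simp [bidiskPoissonKernel_eq]
    rw [h2] at h
    have h3 : ((∫ ζ, bidiskPoissonKernel z ζ ∂K.measure : ℝ) : ℂ) =
        ((∑ τ ∈ K.Z, K.c τ * poisson z.1 τ +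
          ∫ ζ, K.w ζ * (poisson z.1 ζ * poisson z.2 (K.β ζ)) ∂circleMeasure : ℝ) : ℂ) := by
      rw [h]
      push_cast
      ring
    exact_mod_cast h3

end ClarkData

end

section

open Metric Polynomial

/-! ### The Cauchy kernels as elements of the Hardy space -/

lemma hasTaylor_cauchy {w : ℂ × ℂ} (hw : w ∈ bidisk) :
    HasTaylor (bidiskCauchyKernel w) fun i => conj (mono i w) := by
  intro z hz
  have hb : ∀ a b : ℂ, ‖a‖ < 1 → ‖b‖ < 1 → ‖a * conj b‖ < 1 := fun a b ha hb => by
    rw [norm_mul, RCLike.norm_conj]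
    exact mul_lt_one_of_nonneg_of_lt_one_left (norm_nonneg _) ha hb.le
  have g1 := hasSum_geometric_of_norm_lt_one (hb _ _ hz.1 hw.1)
  have g2 := hasSum_geometric_of_norm_lt_one (hb _ _ hz.2 hw.2)
  have h := g1.mul g2 ((summable_norm_geometric_of_norm_lt_one (hb _ _ hz.1 hw.1)).mul_norm
    (summable_norm_geometric_of_norm_lt_one (hb _ _ hz.2 hw.2))).of_norm
  rw [← mul_inv, ← one_div] at h
  refine h.congr_fun fun i => ?_
  simp only [mono, map_mul, map_pow, mul_pow]
  ring

lemma HasTaylor.indicator {f : ℂ × ℂ → ℂ} {a : ℕ × ℕ → ℂ} (h : HasTaylor f a) :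
    HasTaylor (bidisk.indicator f) a := fun z hz => by
  rw [Set.indicator_of_mem hz]
  exact h z hz

lemma norm_bidiskCauchyKernel_le {w z : ℂ × ℂ} (hw : w ∈ bidisk) (hz : z ∈ bidisk) :
    ‖bidiskCauchyKernel w z‖ ≤ ((1 - ‖w.1‖) * (1 - ‖w.2‖))⁻¹ := by
  have hb : ∀ a b : ℂ, ‖a‖ < 1 → ‖b‖ < 1 → 1 - ‖b‖ ≤ ‖1 - a * conj b‖ := fun a b ha hb => by
    have h1 := norm_sub_norm_le 1 (a * conj b)
    rw [norm_one, norm_mul, RCLike.norm_conj] at h1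
    nlinarith [norm_nonneg b]
  rw [bidiskCauchyKernel, one_div, norm_inv, norm_mul]
  have h1 := hb _ _ hz.1 hw.1
  have h2 := hb _ _ hz.2 hw.2
  have p1 := sub_pos.2 hw.1
  have p2 := sub_pos.2 hw.2
  gcongr

/-- The Cauchy kernel `C_w` as an element of the Hardy space. -/
def cauchyHardy (w : ℂ × ℂ) (hw : w ∈ bidisk) : hardySpace :=
  ⟨bidisk.indicator (bidiskCauchyKernel w), memHardy_of_bounded
    (hasTaylor_cauchy hw).indicator.differentiableOn (fun _ hz => Set.indicator_of_notMem hz _)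
    fun z hz => by
      rw [Set.indicator_of_mem hz]
      exact norm_bidiskCauchyKernel_le hw hz⟩

lemma toEll_cauchyHardy {w : ℂ × ℂ} (hw : w ∈ bidisk) :
    toEll (cauchyHardy w hw) = cauchyEll w hw := by
  ext1
  exact (hasTaylor_taylorCoeff (MemHardy.analytic (cauchyHardy w hw).2)).unique
    (hasTaylor_cauchy hw).indicator

lemma inner_toEll_cauchyHardy {w : ℂ × ℂ} (hw : w ∈ bidisk) (f : hardySpace) :
    inner ℂ (toEll (cauchyHardy w hw)) (toEll f) = (f : ℂ × ℂ → ℂ) w := by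
  rw [toEll_cauchyHardy, inner_cauchyEll_toEll]

/-- Each line `{x} × 𝕋` meets the zero set of `p` in at most one point, because `p₀(x) ≠ 0`; Fubini
does the rest. -/
lemma RIFData.ae_ne_zero {n : ℕ} {p₀ p₁ : ℂ[X]} (D : RIFData n p₀ p₁) :
    ∀ᵐ ζ ∂torusMeasure, p₀.eval (ζ.1 : ℂ) + ζ.2 * p₁.eval (ζ.1 : ℂ) ≠ 0 := by
  have hm : MeasurableSet {ζ : Torus | p₀.eval (ζ.1 : ℂ) + ζ.2 * p₁.eval (ζ.1 : ℂ) = 0} :=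
    (isClosed_eq (by fun_prop) continuous_const).measurableSet
  have h0 : torusMeasure {ζ : Torus | p₀.eval (ζ.1 : ℂ) + ζ.2 * p₁.eval (ζ.1 : ℂ) = 0} = 0 := by
    rw [torusMeasure, Measure.measure_prod_null hm]
    refine Eventually.of_forall fun x => ?_
    refine Set.Subsingleton.measure_zero (fun a ha b hb => ?_) _
    have ha : p₀.eval (x : ℂ) + a * p₁.eval (x : ℂ) = 0 := ha
    have hb : p₀.eval (x : ℂ) + b * p₁.eval (x : ℂ) = 0 := hb
    have hp : p₁.eval (x : ℂ) ≠ 0 := fun h => by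
      rw [h, mul_zero, add_zero] at ha
      exact D.p₀_ne_zero (Circle.norm_coe x).le ha
    exact Circle.ext (mul_right_cancel₀ hp (by linear_combination ha - hb))
  rw [MeasureTheory.ae_iff]
  simpa using h0

lemma tendsto_dilate (ζ : Torus) :
    Tendsto (fun r : ℝ => (r : ℂ) • ζ.pt) (𝓝[<] 1) (𝓝[bidisk] ζ.pt) := by
  refine tendsto_nhdsWithin_iff.2 ⟨?_, ?_⟩
  · have : Continuous fun r : ℝ => (r : ℂ) • ζ.pt := by fun_prop
    simpa using (this.tendsto 1).mono_left nhdsWithin_le_nhds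
  · filter_upwards [Ioo_mem_nhdsLT (zero_lt_one' ℝ)] with r hr
    exact smul_pt_mem_bidisk hr.1 hr.2 ζ

namespace RIFRep

variable {φ : ℂ × ℂ → ℂ} {n : ℕ} {p₀ p₁ : ℂ[X]} {γ : Circle} (R : RIFRep φ n p₀ p₁ γ)

include R

lemma mul_memHardy {g : ℂ × ℂ → ℂ} (hg : MemHardy g) : MemHardy (φ * g) where
  analytic := R.differentiableOn.mul hg.analytic
  eq_zero z hz := by simp [hg.eq_zero z hz]
  bounded := by
    obtain ⟨a, ha⟩ := hg.bounded
    refine ⟨a, ?_⟩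
    rintro _ ⟨r, rfl⟩
    refine le_trans ?_ (ha ⟨r, rfl⟩)
    have cg := continuous_dilate hg.analytic r.2.1 r.2.2
    have cφ := continuous_dilate (R.differentiableOn.mul hg.analytic) r.2.1 r.2.2
    refine integral_mono (integrable_torus (cφ.norm.pow 2)) (integrable_torus (cg.norm.pow 2))
      fun ζ => ?_
    have := (R.norm_lt_one (smul_pt_mem_bidisk r.2.1 r.2.2 ζ)).le
    simp only [Pi.mul_apply, norm_mul]
    gcongr
    exact mul_le_of_le_one_left (norm_nonneg _) this

lemma tendsto_at_regular {ζ : ℂ × ℂ} (hp : p₀.eval ζ.1 + ζ.2 * p₁.eval ζ.1 ≠ 0) :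
    Tendsto φ (𝓝[bidisk] ζ) (𝓝 (γ * (((crev n p₁).eval ζ.1 + ζ.2 * (crev n p₀).eval ζ.1) /
      (p₀.eval ζ.1 + ζ.2 * p₁.eval ζ.1)))) := by
  have hc : ContinuousAt (fun z : ℂ × ℂ => (γ : ℂ) *
      (((crev n p₁).eval z.1 + z.2 * (crev n p₀).eval z.1) /
      (p₀.eval z.1 + z.2 * p₁.eval z.1))) ζ := by
    refine continuousAt_const.mul (ContinuousAt.div (by fun_prop) (by fun_prop) hp)
  refine (hc.tendsto.mono_left nhdsWithin_le_nhds).congr' ?_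
  filter_upwards [self_mem_nhdsWithin] with z hz using (R.eq_div z hz).symm

/-- At almost every point of the torus `φ` extends continuously with modulus one; dominated
convergence applies. -/
lemma tendsto_hardyMean :
    Tendsto (fun r : ℝ => ∫ ζ : Torus, (1 - ‖φ ((r : ℂ) • ζ.pt)‖ ^ 2) ∂torusMeasure)
      (𝓝[<] 1) (𝓝 0) := by
  have h := tendsto_integral_filter_of_dominated_convergence (μ := torusMeasure) (l := 𝓝[<] (1 : ℝ))
    (F := fun r ζ => 1 - ‖φ ((r : ℂ) • ζ.pt)‖ ^ 2) (f := fun _ => (0 : ℝ)) (fun _ => (1 : ℝ)) ?_ ?_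
    (integrable_const _) ?_
  · simpa using h
  · filter_upwards [Ioo_mem_nhdsLT (zero_lt_one' ℝ)] with r hr
    exact (continuous_const.sub
      ((continuous_dilate R.differentiableOn hr.1 hr.2).norm.pow 2)).aestronglyMeasurable
  · filter_upwards [Ioo_mem_nhdsLT (zero_lt_one' ℝ)] with r hr
    refine Eventually.of_forall fun ζ => ?_
    have h1 := (R.norm_lt_one (smul_pt_mem_bidisk hr.1 hr.2 ζ)).le
    have h2 := norm_nonneg (φ ((r : ℂ) • ζ.pt))
    rw [Real.norm_eq_abs, abs_le]
    constructor <;> nlinarith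
  · filter_upwards [R.ae_ne_zero] with ζ hζ
    have h1 := ((R.tendsto_at_regular (ζ := ζ.pt) hζ).comp (tendsto_dilate ζ)).norm.pow 2
    have h2 := h1.const_sub 1
    have h3 := R.normSq_sub_circle ζ.1 ζ.2
    rw [Circle.norm_coe, one_pow, sub_self, mul_zero, sub_eq_zero] at h3
    have e : 1 - ‖(γ : ℂ) * (((crev n p₁).eval ζ.pt.1 + ζ.pt.2 * (crev n p₀).eval ζ.pt.1) /
        (p₀.eval ζ.pt.1 + ζ.pt.2 * p₁.eval ζ.pt.1))‖ ^ 2 = 0 := by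
      simp only [Torus.pt]
      rw [norm_mul, Circle.norm_coe, one_mul, norm_div, div_pow, ← h3, div_self, sub_self]
      exact pow_ne_zero 2 (norm_ne_zero_iff.2 hζ)
    rw [e] at h2
    exact h2

/-- Multiplication by `φ` is isometric, tested against bounded functions. -/
lemma inner_mul_mul {f : ℂ × ℂ → ℂ} (hf : MemHardy f) {C : ℝ} (hC : ∀ z ∈ bidisk, ‖f z‖ ≤ C)
    {g : ℂ × ℂ → ℂ} (hg : MemHardy g) :
    inner ℂ (toEll ⟨φ * g, R.mul_memHardy hg⟩) (toEll ⟨φ * f, R.mul_memHardy hf⟩) =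
      inner ℂ (toEll ⟨g, hg⟩) (toEll ⟨f, hf⟩) := by
  have h1 := tendsto_hardyPairing ⟨φ * f, R.mul_memHardy hf⟩ ⟨φ * g, R.mul_memHardy hg⟩
  have h2 := tendsto_hardyPairing ⟨f, hf⟩ ⟨g, hg⟩
  obtain ⟨B, hB⟩ := hg.bounded
  have hC0 : 0 ≤ C := (norm_nonneg _).trans (hC 0 (by simp [bidisk]))
  -- The difference of the pairings is the integral of `(|φ|² - 1) f conj g`. With `f` bounded, the
  -- weighted AM-GM inequality splits `(1 - |φ|²) |g|` into `ε |g|²` and `ε⁻¹ (1 - |φ|²)`; the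
  -- second integral vanishes as `r → 1`, and then `ε → 0`.
  have key : ∀ r ∈ Set.Ioo (0 : ℝ) 1, ∀ ε > 0,
      ‖hardyPairing r (φ * f) (φ * g) - hardyPairing r f g‖ ≤
        C * (ε * B + ε⁻¹ * ∫ ζ : Torus, (1 - ‖φ ((r : ℂ) • ζ.pt)‖ ^ 2) ∂torusMeasure) := by
    intro r hr ε hε
    have cf := continuous_dilate hf.analytic hr.1 hr.2
    have cg := continuous_dilate hg.analytic hr.1 hr.2
    have cφ := continuous_dilate R.differentiableOn hr.1 hr.2
    have c1 : Continuous fun ζ : Torus => ε * ‖g ((r : ℂ) • ζ.pt)‖ ^ 2 := (cg.norm.pow 2).const_mul ε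
    have c2 : Continuous fun ζ : Torus => ε⁻¹ * (1 - ‖φ ((r : ℂ) • ζ.pt)‖ ^ 2) :=
      (continuous_const.sub (cφ.norm.pow 2)).const_mul ε⁻¹
    have hBr : hardyMean r g ≤ B := hB ⟨⟨r, hr⟩, rfl⟩
    calc ‖hardyPairing r (φ * f) (φ * g) - hardyPairing r f g‖
        ≤ ∫ ζ : Torus, C * (ε * ‖g ((r : ℂ) • ζ.pt)‖ ^ 2 +
            ε⁻¹ * (1 - ‖φ ((r : ℂ) • ζ.pt)‖ ^ 2)) ∂torusMeasure := by
          unfold hardyPairing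
          rw [← integral_sub]
          · refine norm_integral_le_of_norm_le (integrable_torus ((c1.add c2).const_mul C))
              (Eventually.of_forall fun ζ => ?_)
            set a := φ ((r : ℂ) • ζ.pt) with ha
            set x := f ((r : ℂ) • ζ.pt) with hx
            set y := g ((r : ℂ) • ζ.pt) with hy
            have hmem := smul_pt_mem_bidisk hr.1 hr.2 ζ
            have e : (φ * f) ((r : ℂ) • ζ.pt) * conj ((φ * g) ((r : ℂ) • ζ.pt)) - x * conj y =
                ((‖a‖ ^ 2 - 1 : ℝ) : ℂ) * x * conj y := by
              have := mul_conj' a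
              simp only [Pi.mul_apply, map_mul, ← ha, ← hx, ← hy]
              push_cast
              linear_combination x * conj y * this
            have hx' : ‖x‖ ≤ C := hC _ hmem
            have ha1 : ‖a‖ < 1 := R.norm_lt_one hmem
            have ha0 : 0 ≤ ‖a‖ := norm_nonneg a
            have hq : 0 ≤ 1 - ‖a‖ ^ 2 := by nlinarith
            have hq1 : 1 - ‖a‖ ^ 2 ≤ 1 := by nlinarith
            rw [e, norm_mul, norm_mul, RCLike.norm_conj, Complex.norm_real, Real.norm_eq_abs, abs_sub_comm,
              abs_of_nonneg hq]
            have amgm : (1 - ‖a‖ ^ 2) * ‖y‖ ≤ ε * ‖y‖ ^ 2 + ε⁻¹ * (1 - ‖a‖ ^ 2) := by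
              have h3 : 2 * ((1 - ‖a‖ ^ 2) * ‖y‖) ≤ ε * ‖y‖ ^ 2 + ε⁻¹ * (1 - ‖a‖ ^ 2) ^ 2 := by
                have := mul_nonneg (inv_pos.2 hε).le (sq_nonneg (ε * ‖y‖ - (1 - ‖a‖ ^ 2)))
                have e2 : ε⁻¹ * (ε * ‖y‖ - (1 - ‖a‖ ^ 2)) ^ 2 = ε * ‖y‖ ^ 2 +
                  ε⁻¹ * (1 - ‖a‖ ^ 2) ^ 2 - 2 * ((1 - ‖a‖ ^ 2) * ‖y‖) := by
                  field_simp
                  ring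
                linarith
              have h4 : ε⁻¹ * (1 - ‖a‖ ^ 2) ^ 2 ≤ ε⁻¹ * (1 - ‖a‖ ^ 2) := by
                have := (inv_pos.2 hε).le
                gcongr
                nlinarith
              have h5 : 0 ≤ (1 - ‖a‖ ^ 2) * ‖y‖ := by positivity
              linarith
            calc (1 - ‖a‖ ^ 2) * ‖x‖ * ‖y‖ = ‖x‖ * ((1 - ‖a‖ ^ 2) * ‖y‖) := by ring
              _ ≤ C * ((1 - ‖a‖ ^ 2) * ‖y‖) := by gcongr
              _ ≤ _ := by gcongr
          · exact integrable_torus ((cφ.mul cf).mul (continuous_conj.comp (cφ.mul cg)))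
          · exact integrable_torus (cf.mul (continuous_conj.comp cg))
      _ = C * (ε * hardyMean r g + ε⁻¹ * ∫ ζ : Torus, (1 - ‖φ ((r : ℂ) • ζ.pt)‖ ^ 2)
            ∂torusMeasure) := by
          rw [integral_const_mul, integral_add (integrable_torus c1)
            (integrable_torus c2), integral_const_mul, integral_const_mul]
          rfl
      _ ≤ _ := by gcongr
  have hlim := (h1.sub h2).norm
  have hle : ∀ ε > 0, ‖inner ℂ (toEll ⟨φ * g, R.mul_memHardy hg⟩) (toEll ⟨φ * f, R.mul_memHardy hf⟩)
      - inner ℂ (toEll ⟨g, hg⟩) (toEll ⟨f, hf⟩)‖ ≤ C * (ε * B + ε⁻¹ * 0) := by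
    intro ε hε
    refine le_of_tendsto_of_tendsto hlim
      (((R.tendsto_hardyMean.const_mul ε⁻¹).const_add (ε * B)).const_mul C) ?_
    filter_upwards [Ioo_mem_nhdsLT (zero_lt_one' ℝ)] with r hr using key r hr ε hε
  have h0 : ‖inner ℂ (toEll ⟨φ * g, R.mul_memHardy hg⟩) (toEll ⟨φ * f, R.mul_memHardy hf⟩)
      - inner ℂ (toEll ⟨g, hg⟩) (toEll ⟨f, hf⟩)‖ ≤ 0 := by
    have ht : Tendsto (fun ε : ℝ => C * (ε * B + ε⁻¹ * 0)) (𝓝[>] 0) (𝓝 0) := by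
      have : Continuous fun ε : ℝ => C * (ε * B + ε⁻¹ * 0) := by
        simp only [mul_zero, add_zero]; fun_prop
      simpa using (this.tendsto 0).mono_left (nhdsWithin_le_nhds (s := Set.Ioi 0))
    refine ge_of_tendsto ht ?_
    filter_upwards [self_mem_nhdsWithin] with ε hε using hle ε hε
  exact sub_eq_zero.1 (norm_le_zero_iff.1 h0)

end RIFRep

end

section

open Metric Polynomial

/-! ### The model space as a Hilbert space -/

/-- The sequences of Taylor coefficients of functions in the model space. -/
def modelEll (φ : ℂ × ℂ → ℂ) : Submodule ℂ Ell :=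
  (Submodule.span ℂ {e | ∃ g : hardySpace, ∃ h : MemHardy (φ * g), e = toEll ⟨φ * g, h⟩})ᗮ

lemma mem_modelEll_iff {φ : ℂ × ℂ → ℂ} {e : Ell} : e ∈ modelEll φ ↔
    ∀ (g : hardySpace) (h : MemHardy (φ * g)), inner ℂ (toEll ⟨φ * g, h⟩) e = 0 := by
  rw [modelEll, Submodule.mem_orthogonal]
  constructor
  · exact fun H g h => H _ (Submodule.subset_span ⟨g, h, rfl⟩)
  · intro H u hu
    induction hu using Submodule.span_induction with
    | mem x hx => obtain ⟨g, h, rfl⟩ := hx; exact H g h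
    | zero => simp
    | add x y _ _ hx hy => rw [inner_add_left, hx, hy, add_zero]
    | smul a x _ hx => rw [inner_smul_left, hx, mul_zero]

/-- For two Hardy functions the limit of the pairings always exists and is the `ℓ²` inner product,
so the condition in the definition is plain orthogonality. -/
lemma mem_modelSpace_iff {φ f : ℂ × ℂ → ℂ} : f ∈ modelSpace φ ↔
    ∃ hf : MemHardy f, toEll ⟨f, hf⟩ ∈ modelEll φ := by
  constructor
  · rintro ⟨hf, h⟩
    refine ⟨hf, mem_modelEll_iff.2 fun g hg => ?_⟩
    exact tendsto_nhds_unique (tendsto_hardyPairing ⟨f, hf⟩ ⟨φ * g, hg⟩) (h g g.2 hg)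
  · rintro ⟨hf, h⟩
    refine ⟨hf, fun g hg hφ => ?_⟩
    rw [← mem_modelEll_iff.1 h ⟨g, hg⟩ hφ]
    exact tendsto_hardyPairing ⟨f, hf⟩ ⟨φ * g, hφ⟩

lemma modelSpace_le_hardySpace (φ : ℂ × ℂ → ℂ) : modelSpace φ ≤ hardySpace := fun _ hf => hf.1

/-- The model space is isometric to a closed subspace of `ℓ²`. -/
def modelEquiv (φ : ℂ × ℂ → ℂ) : modelSpace φ ≃ₗ[ℂ] modelEll φ :=
  LinearEquiv.ofBijective
    ((toEll ∘ₗ Submodule.inclusion (modelSpace_le_hardySpace φ)).codRestrict (modelEll φ)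
      fun f => (mem_modelSpace_iff.1 f.2).2) (by
    constructor
    · intro f g h
      have h1 := injective_toEll (Subtype.ext_iff.1 h)
      exact Submodule.inclusion_injective _ h1
    · rintro ⟨e, he⟩
      obtain ⟨f, rfl⟩ := surjective_toEll e
      exact ⟨⟨f, mem_modelSpace_iff.2 ⟨f.2, he⟩⟩, rfl⟩)

lemma coe_modelEquiv {φ : ℂ × ℂ → ℂ} (f : modelSpace φ) :
    (modelEquiv φ f : Ell) = toEll ⟨f, modelSpace_le_hardySpace φ f.2⟩ := rfl

lemma norm_modelEquiv {φ : ℂ × ℂ → ℂ} (f : modelSpace φ) : ‖modelEquiv φ f‖ = hardyNorm f :=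
  norm_toEll ⟨f, modelSpace_le_hardySpace φ f.2⟩

lemma modelKernel_eq (φ : ℂ × ℂ → ℂ) {w : ℂ × ℂ} (hw : w ∈ bidisk) : modelKernel φ w =
    (cauchyHardy w hw : ℂ × ℂ → ℂ) + (-conj (φ w)) • (φ * (cauchyHardy w hw : ℂ × ℂ → ℂ)) := by
  funext z
  by_cases hz : z ∈ bidisk
  · simp only [modelKernel, cauchyHardy, Set.indicator_of_mem hz, Pi.add_apply, Pi.smul_apply,
      Pi.mul_apply, smul_eq_mul]
    ring
  · simp [modelKernel, cauchyHardy, hz]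

namespace RIFRep

variable {φ : ℂ × ℂ → ℂ} {n : ℕ} {p₀ p₁ : ℂ[X]} {γ : Circle} (R : RIFRep φ n p₀ p₁ γ)

include R

lemma memHardy_mul_cauchy {w : ℂ × ℂ} (hw : w ∈ bidisk) :
    MemHardy (φ * (cauchyHardy w hw : ℂ × ℂ → ℂ)) :=
  R.mul_memHardy (cauchyHardy w hw).2

lemma modelKernel_memHardy {w : ℂ × ℂ} (hw : w ∈ bidisk) : MemHardy (modelKernel φ w) := by
  rw [modelKernel_eq φ hw]
  exact (MemHardy.add (cauchyHardy w hw).2 ((R.memHardy_mul_cauchy hw).smul _))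

lemma toEll_modelKernel {w : ℂ × ℂ} (hw : w ∈ bidisk) :
    toEll ⟨modelKernel φ w, R.modelKernel_memHardy hw⟩ =
      toEll (cauchyHardy w hw) + (-conj (φ w)) • toEll ⟨_, R.memHardy_mul_cauchy hw⟩ := by
  rw [← map_smul, ← map_add]
  congr 1
  exact Subtype.ext (modelKernel_eq φ hw)

/-- Paired with `φ g`, the two terms of `k_w` give `conj (φ(w) g(w))` with opposite signs: the first
by the reproducing property, the second because multiplication by `φ` preserves the inner product
with the bounded function `C_w`. -/
lemma modelKernel_mem {w : ℂ × ℂ} (hw : w ∈ bidisk) : modelKernel φ w ∈ modelSpace φ := by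
  refine mem_modelSpace_iff.2 ⟨R.modelKernel_memHardy hw, mem_modelEll_iff.2 fun g hg => ?_⟩
  have hC : ∀ z ∈ bidisk, ‖(cauchyHardy w hw : ℂ × ℂ → ℂ) z‖ ≤ ((1 - ‖w.1‖) * (1 - ‖w.2‖))⁻¹ :=
    fun z hz => by
      simp only [cauchyHardy, Set.indicator_of_mem hz]
      exact norm_bidiskCauchyKernel_le hw hz
  have h1 := R.inner_mul_mul (cauchyHardy w hw).2 hC g.2
  rw [R.toEll_modelKernel hw, inner_add_right, inner_smul_right, h1]
  have h2 : ∀ f : hardySpace, inner ℂ (toEll f) (toEll (cauchyHardy w hw)) =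
      conj ((f : ℂ × ℂ → ℂ) w) := fun f => by
    rw [← inner_conj_symm, inner_toEll_cauchyHardy]
  rw [h2]
  change _ + _ * inner ℂ (toEll g) (toEll (cauchyHardy w hw)) = 0
  rw [h2]
  simp

/-- The reproducing kernel in the Hilbert space `modelEll`. -/
lemma inner_modelKernel {w : ℂ × ℂ} (hw : w ∈ bidisk) (f : modelSpace φ) :
    inner ℂ (modelEquiv φ ⟨modelKernel φ w, R.modelKernel_mem hw⟩) (modelEquiv φ f) =
      (f : ℂ × ℂ → ℂ) w := by
  rw [Submodule.coe_inner, coe_modelEquiv, coe_modelEquiv]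
  have h1 := mem_modelEll_iff.1 (mem_modelSpace_iff.1 f.2).2 (cauchyHardy w hw)
    (R.memHardy_mul_cauchy hw)
  rw [show toEll ⟨modelKernel φ w, _⟩ = _ from R.toEll_modelKernel hw, inner_add_left,
    inner_smul_left, inner_toEll_cauchyHardy, h1]
  simp

/-- By the reproducing property, a function orthogonal to all the kernels vanishes at every point of
the bidisk. -/
lemma dense_span_modelKernel : Dense (Submodule.span ℂ (Set.range fun w : bidisk =>
    modelEquiv φ ⟨modelKernel φ w, R.modelKernel_mem w.2⟩) : Set (modelEll φ)) := by
  have : CompleteSpace (modelEll φ) := by unfold modelEll; infer_instance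
  rw [Submodule.dense_iff_topologicalClosure_eq_top, Submodule.topologicalClosure_eq_top_iff,
    Submodule.eq_bot_iff]
  intro e he
  obtain ⟨f, rfl⟩ := (modelEquiv φ).surjective e
  have h0 : f = 0 := by
    ext z
    by_cases hz : z ∈ bidisk
    · rw [← R.inner_modelKernel hz]
      exact (Submodule.mem_orthogonal _ _).1 he _ (Submodule.subset_span ⟨⟨z, hz⟩, rfl⟩)
    · exact f.2.1.eq_zero z hz
  rw [h0, map_zero]

/-- The conjugate function `s ↦ conj (φ (conj s))` is holomorphic. -/
lemma differentiableOn_conj : DifferentiableOn ℂ (fun s => conj (φ (conjPt s))) bidisk := by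
  have h : HasTaylor (fun s => conj (φ (conjPt s))) fun i => conj (taylorCoeff φ i) := by
    intro s hs
    have h1 := hasTaylor_taylorCoeff R.differentiableOn _ (conjPt_mem hs)
    have h2 := (Complex.hasSum_conj'.2 h1)
    refine h2.congr_fun fun i => ?_
    simp [mono, conjPt]
  exact h.differentiableOn

end RIFRep

/-! ### The vectors `(1 - α conj (φ w)) C_w` in `L²(σ)` -/

lemma star_cauchyMap_apply {w : ℂ × ℂ} (hw : w ∈ bidisk) (ζ : Torus) :
    star (cauchyMap w) ζ = bidiskCauchyKernel w ζ.pt := by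
  rw [ContinuousMap.star_apply, cauchyMap_apply hw, bidiskCauchyKernel, Torus.pt, one_div, mul_inv]
  simp only [star_mul', RCLike.star_def, map_inv₀, map_sub, map_one, map_mul, Complex.conj_conj]
  simp only [mul_comm]

/-- The vector `(1 - α conj (φ w)) C_w` in `L²(σ)`. -/
def clarkVec (φ : ℂ × ℂ → ℂ) (α : Circle) (σ : Measure Torus) [IsFiniteMeasure σ] (w : ℂ × ℂ) :
    Lp ℂ 2 σ :=
  ContinuousMap.toLp (E := ℂ) 2 σ ℂ ((1 - (α : ℂ) * conj (φ w)) • star (cauchyMap w))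

lemma coeFn_clarkVec (φ : ℂ × ℂ → ℂ) (α : Circle) (σ : Measure Torus) [IsFiniteMeasure σ]
    {w : ℂ × ℂ} (hw : w ∈ bidisk) : clarkVec φ α σ w =ᵐ[σ]
      fun ζ : Torus => (1 - (α : ℂ) * conj (φ w)) * bidiskCauchyKernel w ζ.pt := by
  filter_upwards [ContinuousMap.coeFn_toLp (𝕜 := ℂ) (p := 2) σ
    ((1 - (α : ℂ) * conj (φ w)) • star (cauchyMap w))] with ζ hζ
  rw [clarkVec, hζ, ContinuousMap.smul_apply, star_cauchyMap_apply hw, smul_eq_mul]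

/-- The composition with `ζ ↦ ζ⁻¹` on continuous functions. -/
def compInv : C(Torus, ℂ) →L[ℂ] C(Torus, ℂ) where
  toLinearMap := (ContinuousMap.compRightAlgHom ℂ ℂ
    (⟨fun ζ : Torus => (ζ.1⁻¹, ζ.2⁻¹), by fun_prop⟩ : C(Torus, Torus))).toLinearMap
  cont := ContinuousMap.continuous_precomp _

lemma compInv_apply (F : C(Torus, ℂ)) (ζ : Torus) : compInv F ζ = F (ζ.1⁻¹, ζ.2⁻¹) := rfl

lemma norm_cauchyMap_sq {z : ℂ × ℂ} (hz : z ∈ bidisk) (ζ : Torus) :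
    (1 - ‖z.1‖ ^ 2) * (1 - ‖z.2‖ ^ 2) * ‖cauchyMap z ζ‖ ^ 2 = bidiskPoissonKernel z ζ := by
  rw [cauchyMap_apply hz, norm_mul, norm_inv, norm_inv, norm_one_sub_mul_conj,
    norm_one_sub_mul_conj, bidiskPoissonKernel, mul_pow, inv_pow, inv_pow, div_eq_mul_inv, mul_inv]

/-- Conjugation on the circle is inversion, so the conjugate kernel is a fixed linear operator
applied to a holomorphic map. This makes the Gram integrals holomorphic in `conj z`, as polarization
requires. -/
lemma compInv_cauchyMap {s : ℂ × ℂ} (hs : s ∈ bidisk) :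
    compInv (cauchyMap s) = star (cauchyMap (conjPt s)) := by
  ext ζ
  rw [star_cauchyMap_apply (conjPt_mem hs), compInv_apply, cauchyMap_apply hs, bidiskCauchyKernel,
    one_div, mul_inv]
  simp [conjPt, Torus.pt, conj_coe_circle, mul_comm]

/-- Both sides are holomorphic in `w` and in `conj z`. For `z = w` the squared modulus of the Cauchy
kernel is a multiple of the Poisson kernel and the identity is the definition of a Clark measure;
polarization gives the rest. -/
lemma IsClarkMeasure.inner_eq {φ : ℂ × ℂ → ℂ} {n : ℕ} {p₀ p₁ : ℂ[X]} {γ : Circle}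
    (R : RIFRep φ n p₀ p₁ γ) {α : Circle} {σ : Measure Torus} [IsFiniteMeasure σ]
    (hσ : IsClarkMeasure φ α σ) {w z : ℂ × ℂ} (hw : w ∈ bidisk) (hz : z ∈ bidisk) :
    (1 - conj (α : ℂ) * φ w) * (1 - α * conj (φ z)) *
      ∫ ζ, cauchyMap w ζ * star (cauchyMap z) ζ ∂σ =
    (1 - conj (φ z) * φ w) * bidiskCauchyKernel z w := by
  -- The first argument stands for the conjugate of `z`, the second for `w`.
  let G : (ℂ × ℂ) × (ℂ × ℂ) → ℂ := fun x =>
    (1 - conj (α : ℂ) * φ x.2) * (1 - α * conj (φ (conjPt x.1))) *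
      integralCLM σ (fun _ => 1) (integrable_const _) (cauchyMap x.2 * compInv (cauchyMap x.1)) -
    (1 - conj (φ (conjPt x.1)) * φ x.2) * ((1 - x.2.1 * x.1.1) * (1 - x.2.2 * x.1.2))⁻¹
  have hfst : Set.MapsTo (Prod.fst : (ℂ × ℂ) × (ℂ × ℂ) → ℂ × ℂ) (bidisk ×ˢ bidisk) bidisk :=
    fun x hx => hx.1
  have hsnd : Set.MapsTo (Prod.snd : (ℂ × ℂ) × (ℂ × ℂ) → ℂ × ℂ) (bidisk ×ˢ bidisk) bidisk :=
    fun x hx => hx.2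
  have hG : DifferentiableOn ℂ G (bidisk ×ˢ bidisk) := by
    have d1 : DifferentiableOn ℂ (fun x : (ℂ × ℂ) × (ℂ × ℂ) => φ x.2) (bidisk ×ˢ bidisk) :=
      R.differentiableOn.comp differentiableOn_snd hsnd
    have d2 : DifferentiableOn ℂ (fun x : (ℂ × ℂ) × (ℂ × ℂ) => conj (φ (conjPt x.1)))
        (bidisk ×ˢ bidisk) :=
      R.differentiableOn_conj.comp differentiableOn_fst hfst
    have d3 : DifferentiableOn ℂ (fun x : (ℂ × ℂ) × (ℂ × ℂ) => cauchyMap x.2) (bidisk ×ˢ bidisk) :=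
      differentiableOn_cauchyMap.comp differentiableOn_snd hsnd
    have d4 : DifferentiableOn ℂ (fun x : (ℂ × ℂ) × (ℂ × ℂ) => compInv (cauchyMap x.1))
        (bidisk ×ˢ bidisk) :=
      compInv.differentiable.comp_differentiableOn
        (differentiableOn_cauchyMap.comp differentiableOn_fst hfst)
    have d5 := (integralCLM σ (fun _ => (1 : ℂ)) (integrable_const _)).differentiable
      |>.comp_differentiableOn (d3.mul d4)
    have d6 : DifferentiableOn ℂ (fun x : (ℂ × ℂ) × (ℂ × ℂ) =>
        ((1 - x.2.1 * x.1.1) * (1 - x.2.2 * x.1.2))⁻¹) (bidisk ×ˢ bidisk) := by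
      refine DifferentiableOn.inv (by fun_prop) fun x hx => ?_
      exact mul_ne_zero (one_sub_mul_ne_zero hx.2.1 hx.1.1.le)
        (one_sub_mul_ne_zero hx.2.2 hx.1.2.le)
    exact ((((differentiableOn_const _).sub ((differentiableOn_const _).mul d1)).mul
      ((differentiableOn_const _).sub ((differentiableOn_const _).mul d2))).mul d5).sub
      (((differentiableOn_const _).sub (d2.mul d1)).mul d6)
  have hdiag : ∀ t ∈ bidisk, G (conjPt t, t) = 0 := by
    intro t ht
    have h1 : (∫ ζ, ((‖cauchyMap t ζ‖ ^ 2 : ℝ) : ℂ) ∂σ) * ((1 - ‖t.1‖ ^ 2 : ℝ) * (1 - ‖t.2‖ ^ 2 : ℝ)) =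
        (((1 - ‖φ t‖ ^ 2) / ‖(α : ℂ) - φ t‖ ^ 2 : ℝ) : ℂ) := by
      rw [← hσ.poisson t ht, integral_complex_ofReal]
      norm_cast
      rw [mul_comm, ← integral_const_mul]
      simp_rw [norm_cauchyMap_sq ht]
    have e1 : ∀ ζ, (1 : ℂ) * (cauchyMap t * compInv (cauchyMap (conjPt t))) ζ =
        ((‖cauchyMap t ζ‖ ^ 2 : ℝ) : ℂ) := by
      intro ζ
      rw [compInv_cauchyMap (conjPt_mem ht), conjPt_conjPt, one_mul, ContinuousMap.mul_apply,
        ContinuousMap.star_apply, RCLike.star_def, mul_conj']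
      push_cast
      rfl
    have q : ∀ a : ℂ, 1 - a * conj a = ((1 - ‖a‖ ^ 2 : ℝ) : ℂ) := fun a => by
      rw [mul_conj']; push_cast; rfl
    have q' : ((1 - ‖t.1‖ ^ 2 : ℝ) : ℂ) * ((1 - ‖t.2‖ ^ 2 : ℝ) : ℂ) ≠ 0 := by
      rw [← q, ← q]
      exact mul_ne_zero (one_sub_mul_ne_zero ht.1 (by simpa using ht.1.le))
        (one_sub_mul_ne_zero ht.2 (by simpa using ht.2.le))
    have hα := R.sub_ne_zero α ht
    have e2 : (1 - conj (α : ℂ) * φ t) * (1 - α * conj (φ t)) = ((‖(α : ℂ) - φ t‖ ^ 2 : ℝ) : ℂ) := by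
      push_cast
      rw [← mul_conj', map_sub]
      linear_combination (φ t * conj (φ t) - 1) * circle_mul_conj α
    have e3 : ((‖(α : ℂ) - φ t‖ ^ 2 : ℝ) : ℂ) ≠ 0 := by
      exact_mod_cast pow_ne_zero 2 (norm_ne_zero_iff.2 hα)
    simp only [G, integralCLM_apply, e1, conjPt_conjPt]
    rw [e2, mul_comm (conj (φ t)), q]
    simp only [conjPt]
    rw [q, q, eq_div_of_mul_eq q' h1]
    rw [ofReal_div, ← mul_div_assoc, mul_div_cancel₀ _ e3, div_eq_mul_inv, sub_self]
  have := eq_zero_of_conj_diagonal_bidisk hG hdiag (conjPt_mem hz) hw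
  simp only [G, integralCLM_apply, conjPt_conjPt, compInv_cauchyMap (conjPt_mem hz), one_mul,
    ContinuousMap.mul_apply, sub_eq_zero] at this
  rw [this, bidiskCauchyKernel, one_div]
  rfl

lemma IsClarkMeasure.inner_clarkVec {φ : ℂ × ℂ → ℂ} {n : ℕ} {p₀ p₁ : ℂ[X]} {γ : Circle}
    (R : RIFRep φ n p₀ p₁ γ) {α : Circle} {σ : Measure Torus} [IsFiniteMeasure σ]
    (hσ : IsClarkMeasure φ α σ) {w z : ℂ × ℂ} (hw : w ∈ bidisk) (hz : z ∈ bidisk) :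
    inner ℂ (clarkVec φ α σ w) (clarkVec φ α σ z) = modelKernel φ z w := by
  rw [clarkVec, clarkVec, ContinuousMap.inner_toLp, modelKernel, Set.indicator_of_mem hw,
    ← hσ.inner_eq R hw hz, ← integral_const_mul]
  refine integral_congr_ae (Eventually.of_forall fun ζ => ?_)
  simp only [ContinuousMap.smul_apply, ContinuousMap.star_apply, smul_eq_mul, map_mul, map_sub,
    map_one, Complex.conj_conj, RCLike.star_def]
  ring

/-! ### The embedding -/

lemma IsClarkEmbedding.apply_modelKernel {φ : ℂ × ℂ → ℂ} {α : Circle}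
    {σ : Measure Torus} [IsFiniteMeasure σ] {J : modelSpace φ →ₗ[ℂ] Lp ℂ 2 σ}
    (hJ : IsClarkEmbedding φ α σ J) {w : ℂ × ℂ} (hw : w ∈ bidisk)
    (hk : modelKernel φ w ∈ modelSpace φ) : J ⟨modelKernel φ w, hk⟩ = clarkVec φ α σ w := by
  obtain ⟨_, h⟩ := hJ.kernel w hw
  exact Lp.ext (h.trans (coeFn_clarkVec φ α σ hw).symm)

/-- The isometry on `modelEll` that corresponds to a Clark embedding. -/
def IsClarkEmbedding.isometry {φ : ℂ × ℂ → ℂ} {α : Circle} {σ : Measure Torus}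
    {J : modelSpace φ →ₗ[ℂ] Lp ℂ 2 σ}
    (hJ : IsClarkEmbedding φ α σ J) : modelEll φ →ₗᵢ[ℂ] Lp ℂ 2 σ where
  toLinearMap := J ∘ₗ (modelEquiv φ).symm.toLinearMap
  norm_map' e := by
    obtain ⟨f, rfl⟩ := (modelEquiv φ).surjective e
    simp only [LinearMap.comp_apply, LinearEquiv.coe_coe, LinearEquiv.symm_apply_apply]
    rw [hJ.isometric, norm_modelEquiv]

lemma IsClarkEmbedding.isometry_apply {φ : ℂ × ℂ → ℂ} {α : Circle} {σ : Measure Torus}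
    {J : modelSpace φ →ₗ[ℂ] Lp ℂ 2 σ}
    (hJ : IsClarkEmbedding φ α σ J) (f : modelSpace φ) : hJ.isometry (modelEquiv φ f) = J f := by
  change J ((modelEquiv φ).symm (modelEquiv φ f)) = J f
  rw [LinearEquiv.symm_apply_apply]

section Embedding

variable {φ : ℂ × ℂ → ℂ} {n : ℕ} {p₀ p₁ : ℂ[X]} {γ : Circle} (R : RIFRep φ n p₀ p₁ γ)
  {α : Circle} {σ : Measure Torus} [IsFiniteMeasure σ]

include R

lemma IsClarkMeasure.exists_embedding (hσ : IsClarkMeasure φ α σ) :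
    ∃ J : modelSpace φ →ₗ[ℂ] Lp ℂ 2 σ, IsClarkEmbedding φ α σ J := by
  obtain ⟨J, hJ⟩ := exists_isometry_of_inner_eq (L := Lp ℂ 2 σ) (v := fun w : bidisk => clarkVec φ α σ w)
    R.dense_span_modelKernel fun w z => by
      rw [R.inner_modelKernel w.2, hσ.inner_clarkVec R w.2 z.2]
  refine ⟨J.toLinearMap ∘ₗ (modelEquiv φ).toLinearMap, fun f => ?_, fun w hw =>
    ⟨R.modelKernel_mem hw, ?_⟩⟩
  · exact (J.norm_map _).trans (norm_modelEquiv f)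
  · have := hJ ⟨w, hw⟩
    change J (modelEquiv φ _) =ᵐ[σ] _
    rw [this]
    exact coeFn_clarkVec φ α σ hw

lemma IsClarkEmbedding.unique {J J' : modelSpace φ →ₗ[ℂ] Lp ℂ 2 σ}
    (hJ : IsClarkEmbedding φ α σ J) (hJ' : IsClarkEmbedding φ α σ J') : J = J' := by
  have h : Set.EqOn hJ.isometry.toContinuousLinearMap hJ'.isometry.toContinuousLinearMap
      (Set.range fun w : bidisk => modelEquiv φ ⟨modelKernel φ w, R.modelKernel_mem w.2⟩) := by
    rintro _ ⟨w, rfl⟩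
    change hJ.isometry _ = hJ'.isometry _
    rw [hJ.isometry_apply, hJ'.isometry_apply, hJ.apply_modelKernel w.2, hJ'.apply_modelKernel w.2]
  have h2 := ContinuousLinearMap.eqOn_closure_span h
  ext1 f
  rw [← hJ.isometry_apply, ← hJ'.isometry_apply]
  exact h2 (R.dense_span_modelKernel _)

/-- An isometry carries the reproducing property of `k_z` to its image. Boundary behaviour of `f` is
thereby read from an integral of `J f` against `σ`. -/
lemma IsClarkEmbedding.eval_eq {J : modelSpace φ →ₗ[ℂ] Lp ℂ 2 σ}
    (hJ : IsClarkEmbedding φ α σ J) (f : modelSpace φ) {z : ℂ × ℂ} (hz : z ∈ bidisk) :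
    (f : ℂ × ℂ → ℂ) z = inner ℂ (clarkVec φ α σ z) (J f) := by
  rw [← R.inner_modelKernel hz, ← hJ.isometry.inner_map_map, hJ.isometry_apply, hJ.isometry_apply,
    hJ.apply_modelKernel hz]

/-- The kernels are total, and an isometry from a complete space has closed range. Surjectivity thus
becomes totality of the vectors `clarkVec`. -/
lemma IsClarkEmbedding.range_eq {J : modelSpace φ →ₗ[ℂ] Lp ℂ 2 σ}
    (hJ : IsClarkEmbedding φ α σ J) : Set.range J =
      closure (Submodule.span ℂ (clarkVec φ α σ '' bidisk) : Set (Lp ℂ 2 σ)) := by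
  have hr : Set.range J = Set.range hJ.isometry := by
    ext x
    constructor
    · rintro ⟨f, rfl⟩
      exact ⟨_, hJ.isometry_apply f⟩
    · rintro ⟨e, rfl⟩
      obtain ⟨f, rfl⟩ := (modelEquiv φ).surjective e
      exact ⟨f, (hJ.isometry_apply f).symm⟩
  have himg : hJ.isometry '' (Submodule.span ℂ (Set.range fun w : bidisk =>
      modelEquiv φ ⟨modelKernel φ w, R.modelKernel_mem w.2⟩) : Set (modelEll φ)) =
      (Submodule.span ℂ (clarkVec φ α σ '' bidisk) : Set (Lp ℂ 2 σ)) := by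
    change hJ.isometry.toLinearMap '' _ = _
    rw [← Submodule.map_coe, Submodule.map_span, ← Set.range_comp]
    congr 2
    ext x
    constructor
    · rintro ⟨w, rfl⟩
      refine ⟨w, w.2, ?_⟩
      change _ = hJ.isometry _
      rw [hJ.isometry_apply, hJ.apply_modelKernel w.2]
    · rintro ⟨w, hw, rfl⟩
      refine ⟨⟨w, hw⟩, ?_⟩
      change hJ.isometry _ = _
      rw [hJ.isometry_apply, hJ.apply_modelKernel hw]
  have : CompleteSpace (modelEll φ) := by unfold modelEll; infer_instance
  rw [hr, ← himg]
  refine Set.Subset.antisymm ?_ ?_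
  · rintro _ ⟨e, rfl⟩
    exact image_closure_subset_closure_image hJ.isometry.continuous
      ⟨e, R.dense_span_modelKernel e, rfl⟩
  · exact closure_minimal (Set.image_subset_range _ _)
      hJ.isometry.isometry.isClosedEmbedding.isClosed_range

end Embedding

lemma RIFRep.existsUnique_clarkMeasure {φ : ℂ × ℂ → ℂ} {n : ℕ} {p₀ p₁ : ℂ[X]} {γ : Circle}
    (R : RIFRep φ n p₀ p₁ γ) (α : Circle) : ∃! σ : Measure Torus, IsClarkMeasure φ α σ := by
  obtain ⟨K⟩ := R.exists_clarkData γ α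
  refine ⟨K.measure, K.isClarkMeasure R, fun σ hσ => ?_⟩
  have := hσ.finite
  refine measure_ext_of_poisson fun z hz => ?_
  rw [hσ.poisson z hz, (K.isClarkMeasure R).poisson z hz]

end

section

open Metric

/-! ### Non-tangential limits of Poisson integrals -/

/-- Chord against arc: `|e^{2πis} - 1| = 2 sin (π|s|)`, and Jordan's inequality bounds the sine
below for `|s| ≤ 1/2`. -/
lemma four_mul_norm_le (x : UnitAddCircle) : 4 * ‖x‖ ≤ ‖(AddCircle.toCircle x : ℂ) - 1‖ := by
  induction x using QuotientAddGroup.induction_on with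
  | H t =>
    have hper : ((t - round t : ℝ) : UnitAddCircle) = (t : UnitAddCircle) := by
      have h := AddCircle.coe_sub (1 : ℝ) t (round t : ℝ)
      rw [h, sub_eq_self]
      exact (AddCircle.coe_eq_zero_iff (1 : ℝ)).2 ⟨round t, by simp⟩
    have hn : ‖(t : UnitAddCircle)‖ = |t - round t| := by
      rw [UnitAddCircle.norm_eq]
    have h2 := abs_sub_round t
    change 4 * ‖(t : UnitAddCircle)‖ ≤ ‖(AddCircle.toCircle (t : UnitAddCircle) : ℂ) - 1‖
    rw [hn, ← hper]
    set s := t - round t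
    rw [AddCircle.toCircle_apply_mk, Circle.coe_exp, div_one,
      mul_comm _ I, Complex.norm_exp_I_mul_ofReal_sub_one]
    have h3 : 2 * Real.pi * s / 2 = Real.pi * s := by ring
    rw [h3, norm_mul, Real.norm_ofNat, Real.norm_eq_abs]
    have hs : |Real.sin (Real.pi * s)| = Real.sin (Real.pi * |s|) := by
      rcases le_total 0 s with h | h
      · rw [abs_of_nonneg h, abs_of_nonneg]
        refine Real.sin_nonneg_of_nonneg_of_le_pi (by positivity) ?_
        rw [abs_of_nonneg h] at h2
        nlinarith [Real.pi_pos]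
      · rw [abs_of_nonpos h, mul_neg, Real.sin_neg, abs_of_nonpos]
        rw [← neg_nonneg, ← Real.sin_neg, ← mul_neg]
        refine Real.sin_nonneg_of_nonneg_of_le_pi (mul_nonneg Real.pi_pos.le (neg_nonneg.2 h)) ?_
        rw [abs_of_nonpos h] at h2
        nlinarith [Real.pi_pos]
    rw [hs]
    have h4 := Real.mul_le_sin (x := Real.pi * |s|) (by positivity) (by nlinarith [Real.pi_pos])
    have h5 : 2 / Real.pi * (Real.pi * |s|) = 2 * |s| := by
      have := Real.pi_pos.ne'
      field_simp
    linarith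

lemma four_mul_dist_le (x y : UnitAddCircle) :
    4 * dist y x ≤ ‖(AddCircle.toCircle y : ℂ) - AddCircle.toCircle x‖ := by
  have h := four_mul_norm_le (y - x)
  have e : (AddCircle.toCircle y : ℂ) - AddCircle.toCircle x =
      AddCircle.toCircle x * ((AddCircle.toCircle (y - x) : ℂ) - 1) := by
    have h2 : AddCircle.toCircle y = AddCircle.toCircle x * AddCircle.toCircle (y - x) := by
      rw [← AddCircle.toCircle_add, add_sub_cancel]
    rw [h2]
    push_cast
    ring
  rw [e, norm_mul, Circle.norm_coe, one_mul, dist_eq_norm]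
  exact h

lemma tendsto_tsum_dyadic {E : ℝ → ℝ} {K : ℝ} (h0 : ∀ δ > 0, 0 ≤ E δ) (hK : ∀ δ > 0, E δ ≤ K)
    (hE : Tendsto E (𝓝[>] 0) (𝓝 0)) :
    Tendsto (fun d => ∑' k : ℕ, (1 / 2 : ℝ) ^ k * E (2 ^ k * d)) (𝓝[>] 0) (𝓝 0) := by
  have h := tendsto_tsum_of_dominated_convergence (𝓕 := 𝓝[>] (0 : ℝ))
    (f := fun d (k : ℕ) => (1 / 2 : ℝ) ^ k * E (2 ^ k * d)) (g := fun _ => (0 : ℝ))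
    (bound := fun k => (1 / 2 : ℝ) ^ k * K)
    ((summable_geometric_of_lt_one (by norm_num) (by norm_num)).mul_right K) ?_ ?_
  · simpa using h
  · intro k
    have h1 : Tendsto (fun d : ℝ => 2 ^ k * d) (𝓝[>] 0) (𝓝[>] 0) := by
      refine tendsto_nhdsWithin_iff.2 ⟨?_, ?_⟩
      · have : Continuous fun d : ℝ => 2 ^ k * d := by fun_prop
        simpa using (this.tendsto 0).mono_left nhdsWithin_le_nhds
      · filter_upwards [self_mem_nhdsWithin] with d hd
        have hd' : 0 < d := hd
        exact Set.mem_Ioi.2 (by positivity)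
    simpa using (hE.comp h1).const_mul ((1 / 2 : ℝ) ^ k)
  · filter_upwards [self_mem_nhdsWithin] with d hd k
    have hp : 0 < 2 ^ k * d := mul_pos (by positivity) hd
    rw [Real.norm_of_nonneg (mul_nonneg (by positivity) (h0 _ hp))]
    gcongr
    exact hK _ hp

/-- Take the least `k` with `ρ ≤ 2^k d`. For `k = 0` the height bound suffices; otherwise `ρ >
2^(k-1) d` and the decay bound applies, the shift by one costing the factor `4`. -/
lemma exists_dyadic_bound {d ρ A P : ℝ} (hd : 0 < d) (h1 : P ≤ A / d)
    (h2 : P * ρ ^ 2 ≤ A * d) (hA : 0 ≤ A) : ∃ k : ℕ, ρ ≤ 2 ^ k * d ∧ P ≤ 4 * A * (1 / 4) ^ k / d := by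
  have hex : ∃ k : ℕ, ρ ≤ 2 ^ k * d := by
    obtain ⟨k, hk⟩ := pow_unbounded_of_one_lt (ρ / d) (one_lt_two)
    exact ⟨k, ((div_lt_iff₀ hd).1 hk).le⟩
  classical
  refine ⟨Nat.find hex, Nat.find_spec hex, ?_⟩
  rcases hk : Nat.find hex with _ | j
  · rw [pow_zero, mul_one]
    refine h1.trans ?_
    gcongr
    linarith
  · have hj : 2 ^ j * d < ρ := not_le.1 (Nat.find_min hex (m := j) (by omega))
    have hpos : 0 < 2 ^ j * d := by positivity
    have h3 : (2 ^ j * d) ^ 2 ≤ ρ ^ 2 := by gcongr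
    rcases le_or_gt P 0 with hP | hP
    · exact hP.trans (by positivity)
    have h4 : P * (2 ^ j * d) ^ 2 ≤ A * d := (by gcongr : _ ≤ P * ρ ^ 2).trans h2
    rw [le_div_iff₀ hd]
    have h5 : (2 : ℝ) ^ j * 2 ^ j * (1 / 4) ^ j = 1 := by
      rw [← mul_pow, ← mul_pow]; norm_num
    have h6 : (0 : ℝ) < (1 / 4) ^ j := by positivity
    have h7 : P * d * (2 ^ j * 2 ^ j) ≤ A := by
      have : P * (2 ^ j * d) ^ 2 = P * d * (2 ^ j * 2 ^ j) * d := by ring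
      rw [this] at h4
      exact le_of_mul_le_mul_right h4 hd
    calc P * d = P * d * (2 ^ j * 2 ^ j) * (1 / 4) ^ j := by
          rw [mul_assoc (P * d), h5, mul_one]
      _ ≤ A * (1 / 4) ^ j := by gcongr
      _ = 4 * A * (1 / 4) ^ (j + 1) := by ring

/-- The mean oscillation of `f` over the ball of radius `δ`, up to a constant. -/
def oscillation (f : UnitAddCircle → ℂ) (x : UnitAddCircle) (δ : ℝ) : ℝ :=
  (∫ y in closedBall x δ, ‖f y - f x‖) / δ

lemma oscillation_nonneg (f : UnitAddCircle → ℂ) (x : UnitAddCircle) {δ : ℝ} (hδ : 0 < δ) :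
    0 ≤ oscillation f x δ :=
  div_nonneg (integral_nonneg fun _ => norm_nonneg _) hδ.le

lemma ae_tendsto_oscillation {f : UnitAddCircle → ℂ} (hf : Integrable f) :
    ∀ᵐ x, Tendsto (oscillation f x) (𝓝[>] 0) (𝓝 0) := by
  filter_upwards [IsUnifLocDoublingMeasure.ae_tendsto_average_norm_sub
    (volume : Measure UnitAddCircle) hf.locallyIntegrable 1] with x hx
  have h := hx (l := 𝓝[>] (0 : ℝ)) (fun _ => x) id tendsto_id (by
    filter_upwards [self_mem_nhdsWithin] with δ hδ
    simpa using (Set.mem_Ioi.1 hδ).le)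
  have h2 := h.const_mul 2
  rw [mul_zero] at h2
  refine h2.congr' ?_
  filter_upwards [Ioo_mem_nhdsGT (show (0 : ℝ) < 1 / 2 by norm_num)] with δ hδ
  have hv : (volume : Measure UnitAddCircle).real (closedBall x δ) = 2 * δ := by
    rw [Measure.real, AddCircle.volume_closedBall, ENNReal.toReal_ofReal, min_eq_right]
    · linarith [hδ.2]
    · exact le_min zero_le_one (by linarith [hδ.1])
  simp only [id]
  rw [setAverage_eq, hv, oscillation, smul_eq_mul]
  have := hδ.1.ne'
  field_simp

/-- Small radii are controlled by the limit, large ones by the total integral. -/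
lemma oscillation_bounded {f : UnitAddCircle → ℂ} (hf : Integrable f) {x : UnitAddCircle}
    (hx : Tendsto (oscillation f x) (𝓝[>] 0) (𝓝 0)) : ∃ K, ∀ δ > 0, oscillation f x δ ≤ K := by
  obtain ⟨δ₀, h0, h1⟩ := mem_nhdsGT_iff_exists_Ioo_subset.1
    (hx.eventually (ge_mem_nhds (zero_lt_one' ℝ)))
  have hi : Integrable fun y => ‖f y - f x‖ := (hf.sub (integrable_const _)).norm
  refine ⟨max 1 ((∫ y, ‖f y - f x‖) / δ₀), fun δ hδ => ?_⟩
  rcases lt_or_ge δ δ₀ with h | h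
  · exact le_max_of_le_left (h1 ⟨hδ, h⟩)
  · refine le_max_of_le_right ?_
    have h2 : ∫ y in closedBall x δ, ‖f y - f x‖ ≤ ∫ y, ‖f y - f x‖ :=
      setIntegral_le_integral hi (Eventually.of_forall fun _ => norm_nonneg _)
    have h3 : 0 ≤ ∫ y, ‖f y - f x‖ := integral_nonneg fun _ => norm_nonneg _
    have h4 : 0 < δ₀ := h0
    unfold oscillation
    gcongr

/-- A kernel of height `A / d` decaying like `A d / dist²` is dominated by a sum of multiples
`4^{-k} / d` of indicators of balls of radius `2^k d`; each ball contributes `2^{-k}` times the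
oscillation at its scale. -/
lemma lintegral_le_tsum_oscillation {f : UnitAddCircle → ℂ} (hf : Integrable f) {x : UnitAddCircle}
    {K : ℝ} (hK : ∀ δ > 0, oscillation f x δ ≤ K) {d A : ℝ} (hd : 0 < d) (hA : 0 ≤ A)
    {P : UnitAddCircle → ℝ} (h1 : ∀ y, P y ≤ A / d) (h2 : ∀ y, P y * dist y x ^ 2 ≤ A * d) :
    ∫⁻ y, ENNReal.ofReal (P y) * ‖f y - f x‖ₑ ≤
      ENNReal.ofReal (4 * A * ∑' k : ℕ, (1 / 2 : ℝ) ^ k * oscillation f x (2 ^ k * d)) := by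
  have hi : Integrable fun y => f y - f x := hf.sub (integrable_const _)
  have hpos : ∀ k : ℕ, 0 < 2 ^ k * d := fun k => by positivity
  have hs : Summable fun k : ℕ => (1 / 2 : ℝ) ^ k * oscillation f x (2 ^ k * d) := by
    refine Summable.of_nonneg_of_le
      (fun k => mul_nonneg (by positivity) (oscillation_nonneg f x (hpos k))) (fun k => ?_)
      ((summable_geometric_of_lt_one (by norm_num) (by norm_num : (1 / 2 : ℝ) < 1)).mul_right K)
    gcongr
    exact hK _ (hpos k)
  calc ∫⁻ y, ENNReal.ofReal (P y) * ‖f y - f x‖ₑ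
      ≤ ∫⁻ y, ∑' k : ℕ, (closedBall x (2 ^ k * d)).indicator
          (fun y => ENNReal.ofReal (4 * A * (1 / 4) ^ k / d) * ‖f y - f x‖ₑ) y := by
        refine lintegral_mono fun y => ?_
        obtain ⟨k, hk1, hk2⟩ := exists_dyadic_bound hd (h1 y) (h2 y) hA
        refine le_trans ?_ (ENNReal.le_tsum k)
        rw [Set.indicator_of_mem (mem_closedBall.2 hk1)]
        gcongr
    _ = ∑' k : ℕ, ∫⁻ y, (closedBall x (2 ^ k * d)).indicator
          (fun y => ENNReal.ofReal (4 * A * (1 / 4) ^ k / d) * ‖f y - f x‖ₑ) y := by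
        refine lintegral_tsum fun k => ?_
        exact (hi.aestronglyMeasurable.enorm.const_mul _).indicator measurableSet_closedBall
    _ = ∑' k : ℕ, ENNReal.ofReal (4 * A * ((1 / 2 : ℝ) ^ k * oscillation f x (2 ^ k * d))) := by
        refine tsum_congr fun k => ?_
        rw [lintegral_indicator measurableSet_closedBall,
          lintegral_const_mul'' _ hi.aestronglyMeasurable.enorm.restrict,
          ← ofReal_integral_norm_eq_lintegral_enorm hi.integrableOn, ← ENNReal.ofReal_mul (by positivity)]
        congr 1
        unfold oscillation
        have e : (1 / 4 : ℝ) ^ k * 2 ^ k = (1 / 2) ^ k := by rw [← mul_pow]; norm_num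
        generalize ∫ y in closedBall x (2 ^ k * d), ‖f y - f x‖ = Q
        rw [← e]
        have := hd.ne'
        field_simp
    _ = _ := by
        rw [← tsum_mul_left, ENNReal.ofReal_tsum_of_nonneg _ (hs.mul_left _)]
        exact fun k => mul_nonneg (by positivity)
          (mul_nonneg (by positivity) (oscillation_nonneg f x (hpos k)))

/-- The Stolz region at `ζ`. -/
def stolz (M : ℝ) (ζ : Circle) : Set ℂ := {z | ‖z‖ < 1 ∧ ‖z - ζ‖ < M * (1 - ‖z‖)}

/-- Inside the Stolz region `|η - ζ| ≤ (1 + |M|) |η - z|`, so the kernel has the height and decay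
required above with `d = 1 - |z|`. -/
lemma poisson_le_of_stolz {M : ℝ} {ζ : Circle} {z : ℂ} (hz : z ∈ stolz M ζ) (η : Circle) :
    poisson z η ≤ 2 * (1 + |M|) ^ 2 / (1 - ‖z‖) ∧
      poisson z η * ‖(η : ℂ) - ζ‖ ^ 2 ≤ 2 * (1 + |M|) ^ 2 * (1 - ‖z‖) := by
  have hd : 0 < 1 - ‖z‖ := sub_pos.2 hz.1
  have h1 : 1 - ‖z‖ ≤ ‖(η : ℂ) - z‖ := by
    have := norm_sub_norm_le (η : ℂ) z
    rwa [Circle.norm_coe] at this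
  have hpos : 0 < ‖(η : ℂ) - z‖ := hd.trans_le h1
  have h2 : ‖(η : ℂ) - ζ‖ ≤ (1 + |M|) * ‖(η : ℂ) - z‖ := by
    have e : (η : ℂ) - ζ = (η - z) + (z - ζ) := by ring
    have h3 := norm_add_le ((η : ℂ) - z) (z - ζ)
    rw [← e] at h3
    have h4 : M * (1 - ‖z‖) ≤ |M| * ‖(η : ℂ) - z‖ :=
      (mul_le_mul_of_nonneg_right (le_abs_self M) hd.le).trans (by gcongr)
    linarith [hz.2]
  have h5 : 1 - ‖z‖ ^ 2 ≤ 2 * (1 - ‖z‖) := by nlinarith [norm_nonneg z]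
  have hM : 0 ≤ |M| := abs_nonneg M
  constructor
  · rw [poisson, div_le_div_iff₀ (by positivity) hd]
    have h6 : (1 - ‖z‖) ^ 2 ≤ ‖(η : ℂ) - z‖ ^ 2 := by gcongr
    nlinarith [sq_nonneg ‖(η : ℂ) - z‖, mul_nonneg hM (sq_nonneg ‖(η : ℂ) - z‖),
      mul_nonneg (sq_nonneg |M|) (sq_nonneg ‖(η : ℂ) - z‖)]
  · rw [poisson, div_mul_eq_mul_div, div_le_iff₀ (by positivity)]
    have h6 : ‖(η : ℂ) - ζ‖ ^ 2 ≤ (1 + |M|) ^ 2 * ‖(η : ℂ) - z‖ ^ 2 := by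
      rw [← mul_pow]; gcongr
    calc (1 - ‖z‖ ^ 2) * ‖(η : ℂ) - ζ‖ ^ 2
        ≤ 2 * (1 - ‖z‖) * ((1 + |M|) ^ 2 * ‖(η : ℂ) - z‖ ^ 2) := by gcongr
      _ = _ := by ring

lemma tendsto_one_sub_norm (M : ℝ) (ζ : Circle) :
    Tendsto (fun z : ℂ => 1 - ‖z‖) (𝓝[stolz M ζ] ζ) (𝓝[>] 0) := by
  refine tendsto_nhdsWithin_iff.2 ⟨?_, ?_⟩
  · have : Continuous fun z : ℂ => 1 - ‖z‖ := by fun_prop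
    have h := (this.tendsto ζ).mono_left (nhdsWithin_le_nhds (s := stolz M ζ))
    rwa [Circle.norm_coe, sub_self] at h
  · filter_upwards [self_mem_nhdsWithin] with z hz using sub_pos.2 hz.1

lemma measurableEmbedding_toCircle :
    MeasurableEmbedding (AddCircle.toCircle : UnitAddCircle → Circle) :=
  ((AddCircle.continuous_toCircle).isClosedEmbedding
    (AddCircle.injective_toCircle one_ne_zero)).measurableEmbedding

lemma circleMeasure_eq : circleMeasure = (volume : Measure UnitAddCircle).map AddCircle.toCircle := by
  rw [circleMeasure, AddCircle.volume_eq_smul_haarAddCircle, ENNReal.ofReal_one, one_smul]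

/-- Fatou's theorem on non-tangential limits of Poisson integrals. -/
theorem ae_tendsto_poisson {g : Circle → ℂ} (hg : Integrable g circleMeasure) :
    ∀ᵐ ζ : Circle ∂circleMeasure, ∀ M : ℝ,
      Tendsto (fun z => ∫ η, (poisson z η : ℂ) * g η ∂circleMeasure) (𝓝[stolz M ζ] ζ)
        (𝓝 (g ζ)) := by
  rw [circleMeasure_eq, measurableEmbedding_toCircle.ae_map_iff, ← circleMeasure_eq]
  have hf : Integrable (fun x : UnitAddCircle => g (AddCircle.toCircle x)) := by
    rw [circleMeasure_eq, measurableEmbedding_toCircle.integrable_map_iff] at hg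
    exact hg
  filter_upwards [ae_tendsto_oscillation hf] with x hx M
  obtain ⟨K, hK⟩ := oscillation_bounded hf hx
  set ζ := AddCircle.toCircle x with hζ
  set A : ℝ := 2 * (1 + |M|) ^ 2
  have hA : 0 ≤ A := by positivity
  have hlim := ((tendsto_tsum_dyadic (fun δ hδ => oscillation_nonneg _ x hδ) hK hx).comp
    (tendsto_one_sub_norm M ζ)).const_mul (4 * A)
  rw [mul_zero] at hlim
  rw [tendsto_iff_norm_sub_tendsto_zero]
  refine squeeze_zero' (Eventually.of_forall fun _ => norm_nonneg _) ?_ hlim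
  filter_upwards [self_mem_nhdsWithin] with z hz
  have hcont := continuous_poisson hz.1
  obtain ⟨C, hC⟩ := isCompact_univ.exists_bound_of_continuousOn hcont.continuousOn
  have hPc : Continuous fun η : Circle => (poisson z η : ℂ) := continuous_ofReal.comp hcont
  have hPg : Integrable (fun η => (poisson z η : ℂ) * g η) circleMeasure := by
    refine hg.bdd_mul (c := C) hPc.aestronglyMeasurable (Eventually.of_forall fun η => ?_)
    rw [Complex.norm_real]
    exact hC η (Set.mem_univ _)
  have e : ∫ η, (poisson z η : ℂ) * g η ∂circleMeasure - g ζ =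
      ∫ η, (poisson z η : ℂ) * (g η - g ζ) ∂circleMeasure := by
    simp_rw [mul_sub]
    rw [integral_sub hPg ((integrable_circle hPc).mul_const _), integral_mul_const,
      integral_complex_ofReal, integral_poisson hz.1, ofReal_one, one_mul]
  rw [e]
  simp only [Function.comp_apply]
  have hnn : 0 ≤ 4 * A * ∑' k : ℕ, (1 / 2 : ℝ) ^ k *
      oscillation (fun x : UnitAddCircle => g (AddCircle.toCircle x)) x (2 ^ k * (1 - ‖z‖)) := by
    refine mul_nonneg (by positivity) (tsum_nonneg fun k => mul_nonneg (by positivity) ?_)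
    exact oscillation_nonneg _ x (mul_pos (by positivity) (sub_pos.2 hz.1))
  rw [← ENNReal.ofReal_le_ofReal_iff hnn, ofReal_norm]
  refine (enorm_integral_le_lintegral_enorm _).trans ?_
  rw [circleMeasure_eq, measurableEmbedding_toCircle.lintegral_map]
  refine le_trans (lintegral_mono fun y => ?_) (lintegral_le_tsum_oscillation hf hK (P := fun y =>
    poisson z (AddCircle.toCircle y)) (sub_pos.2 hz.1) hA
    (fun y => (poisson_le_of_stolz hz _).1) fun y => ?_)
  · rw [enorm_mul, ← ofReal_norm, Complex.norm_real, Real.norm_of_nonneg (poisson_pos hz.1 _).le]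
  · refine le_trans ?_ (poisson_le_of_stolz hz (AddCircle.toCircle y)).2
    have h1 := four_mul_dist_le x y
    have h2 : dist y x ≤ ‖(AddCircle.toCircle y : ℂ) - ζ‖ := by
      linarith [dist_nonneg (x := y) (y := x)]
    have := (poisson_pos hz.1 (AddCircle.toCircle y)).le
    gcongr

end

section

open Metric

/-! ### Cauchy integrals of square integrable functions on the circle -/

/-- The Cauchy kernel `ζ ↦ (1 - conj z ζ)⁻¹` as a continuous function on the circle. -/
def szego (z : ℂ) (hz : ‖z‖ < 1) : C(Circle, ℂ) :=
  ⟨fun ζ => (1 - conj z * ζ)⁻¹, by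
    refine Continuous.inv₀ (by fun_prop) fun ζ => ?_
    exact one_sub_mul_ne_zero (by simpa using hz) (Circle.norm_coe ζ).le⟩

lemma conj_szego {z : ℂ} (hz : ‖z‖ < 1) (ζ : Circle) :
    conj (szego z hz ζ) = (1 - z * conj (ζ : ℂ))⁻¹ := by
  simp [szego]

/-- The space `L²` of the circle. -/
abbrev CircleL2 : Type := Lp ℂ 2 circleMeasure

/-- The Cauchy integral of a square integrable function. -/
def cauchyInt (g : Circle → ℂ) (z : ℂ) : ℂ :=
  ∫ ζ, g ζ * (1 - z * conj (ζ : ℂ))⁻¹ ∂circleMeasure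

/-- The Cauchy kernels as elements of `L²`. -/
def szegoL2 (z : ℂ) (hz : ‖z‖ < 1) : CircleL2 :=
  ContinuousMap.toLp (E := ℂ) 2 circleMeasure ℂ (szego z hz)

lemma coeFn_szegoL2 {z : ℂ} (hz : ‖z‖ < 1) :
    szegoL2 z hz =ᵐ[circleMeasure] szego z hz :=
  ContinuousMap.coeFn_toLp (𝕜 := ℂ) circleMeasure (szego z hz)

lemma inner_szegoL2 {z : ℂ} (hz : ‖z‖ < 1) (g : CircleL2) :
    inner ℂ (szegoL2 z hz) g = cauchyInt g z := by
  rw [L2.inner_def, cauchyInt]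
  refine integral_congr_ae ?_
  filter_upwards [coeFn_szegoL2 hz] with ζ hζ
  rw [hζ, RCLike.inner_apply, conj_szego hz]

lemma norm_szegoL2_sq {z : ℂ} (hz : ‖z‖ < 1) : ‖szegoL2 z hz‖ ^ 2 = (1 - ‖z‖ ^ 2)⁻¹ := by
  have h0 : 0 < 1 - ‖z‖ ^ 2 := by nlinarith [norm_nonneg z]
  have h := inner_self_eq_norm_sq_to_K (𝕜 := ℂ) (szegoL2 z hz)
  rw [szegoL2, ContinuousMap.inner_toLp] at h
  have e : ∀ ζ : Circle, szego z hz ζ * conj (szego z hz ζ) =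
      (((1 - ‖z‖ ^ 2)⁻¹ * poisson z ζ : ℝ) : ℂ) := by
    intro ζ
    have h1 : ‖szego z hz ζ‖ = ‖(ζ : ℂ) - z‖⁻¹ := by
      rw [← RCLike.norm_conj, conj_szego hz, norm_inv, norm_one_sub_mul_conj]
    rw [mul_conj', h1, poisson]
    have : ‖(ζ : ℂ) - z‖ ≠ 0 := norm_ne_zero_iff.2 (circle_sub_ne_zero hz ζ)
    rw [← ofReal_pow]
    congr 1
    field_simp
  simp_rw [e] at h
  rw [integral_complex_ofReal, integral_const_mul, integral_poisson hz, mul_one] at h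
  have h2 : ((‖szegoL2 z hz‖ ^ 2 : ℝ) : ℂ) = (((1 - ‖z‖ ^ 2)⁻¹ : ℝ) : ℂ) := by
    rw [h]; push_cast; rfl
  exact_mod_cast h2

/-- Cauchy–Schwarz with the norm of the kernel. The growth is slower than `1 / (1 - |z|)`, so a
linear factor vanishing at a boundary point annihilates it non-tangentially. -/
lemma norm_cauchyInt_le (g : CircleL2) {z : ℂ} (hz : ‖z‖ < 1) :
    ‖cauchyInt g z‖ ≤ ‖g‖ * (Real.sqrt (1 - ‖z‖))⁻¹ := by
  have h := norm_inner_le_norm (𝕜 := ℂ) (szegoL2 z hz) g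
  rw [inner_szegoL2] at h
  refine h.trans ?_
  rw [mul_comm]
  gcongr
  have h0 : 0 < 1 - ‖z‖ := sub_pos.2 hz
  refine le_of_sq_le_sq ?_ (by positivity)
  rw [norm_szegoL2_sq, inv_pow, Real.sq_sqrt h0.le]
  gcongr
  nlinarith [norm_nonneg z]

/-- The Hardy space of the circle: the closed span of the Cauchy kernels. -/
def hardyCircle : Submodule ℂ CircleL2 :=
  (Submodule.span ℂ (Set.range fun z : {z : ℂ // ‖z‖ < 1} => szegoL2 z z.2)).topologicalClosure

instance : CompleteSpace hardyCircle :=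
  (Submodule.isClosed_topologicalClosure _).completeSpace_coe

/-- The Riesz projection. -/
def riesz : CircleL2 →L[ℂ] CircleL2 := hardyCircle.starProjection

lemma riesz_mem (g : CircleL2) : riesz g ∈ hardyCircle := hardyCircle.starProjection_apply_mem g

lemma cauchyInt_riesz (g : CircleL2) {z : ℂ} (hz : ‖z‖ < 1) :
    cauchyInt (riesz g) z = cauchyInt g z := by
  have hm : szegoL2 z hz ∈ hardyCircle :=
    Submodule.le_topologicalClosure _ (Submodule.subset_span ⟨⟨z, hz⟩, rfl⟩)
  rw [← inner_szegoL2 hz, ← inner_szegoL2 hz, riesz,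
    ← Submodule.inner_starProjection_left_eq_right, hardyCircle.starProjection_eq_self_iff.2 hm]

/-- The function `ζ ↦ z conj ζ (1 - z conj ζ)⁻¹` on the circle. -/
def coSzego (z : ℂ) (hz : ‖z‖ < 1) : C(Circle, ℂ) :=
  ⟨fun ζ => z * conj (ζ : ℂ) * (1 - z * conj (ζ : ℂ))⁻¹, by
    refine Continuous.mul (by fun_prop) (Continuous.inv₀ (by fun_prop) fun ζ => ?_)
    exact one_sub_mul_ne_zero hz (by simp [Circle.norm_coe])⟩

/-- Against a Cauchy kernel the integrand is analytic with a zero at the origin, and the mean value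
property gives `0`; continuity extends this to the closed span. -/
lemma inner_coSzego {z : ℂ} (hz : ‖z‖ < 1) {g : CircleL2} (hg : g ∈ hardyCircle) :
    inner ℂ (ContinuousMap.toLp (E := ℂ) 2 circleMeasure ℂ (coSzego z hz)) g = 0 := by
  let Φ : CircleL2 →L[ℂ] ℂ :=
    innerSL ℂ (ContinuousMap.toLp (E := ℂ) 2 circleMeasure ℂ (coSzego z hz))
  have h : Set.EqOn Φ (0 : CircleL2 →L[ℂ] ℂ)
      (Set.range fun z : {z : ℂ // ‖z‖ < 1} => szegoL2 z z.2) := by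
    rintro _ ⟨⟨w, hw⟩, rfl⟩
    simp only [Φ, innerSL_apply_apply, szegoL2, ContinuousMap.inner_toLp,
      zero_apply]
    have hd : DiffContOnCl ℂ (fun ζ : ℂ => (1 - conj w * ζ)⁻¹ * (conj z * ζ * (1 - conj z * ζ)⁻¹))
        (ball 0 1) := by
      refine DifferentiableOn.diffContOnCl ?_
      rw [closure_ball _ one_ne_zero]
      have hi : ∀ a : ℂ, ‖a‖ < 1 → DifferentiableOn ℂ (fun ζ : ℂ => (1 - conj a * ζ)⁻¹)
          (closedBall 0 1) := fun a ha => by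
        refine DifferentiableOn.inv (by fun_prop) fun ζ hζ => ?_
        exact one_sub_mul_ne_zero (by simpa using ha) (by simpa using hζ)
      exact (hi w hw).mul (DifferentiableOn.mul (by fun_prop) (hi z hz))
    have h1 := integral_circle_eq hd
    simp only [mul_zero, zero_mul] at h1
    rw [← h1]
    refine integral_congr_ae (Eventually.of_forall fun ζ => ?_)
    simp [szego, coSzego]
  exact ContinuousLinearMap.eqOn_closure_span h hg

/-- The two kernels differ by the co-analytic part of `poisson_eq_add`, which is orthogonal to the
Hardy space. -/
lemma cauchyInt_eq_poisson {g : CircleL2} (hg : g ∈ hardyCircle) {z : ℂ} (hz : ‖z‖ < 1) :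
    cauchyInt g z = ∫ ζ, (poisson z ζ : ℂ) * g ζ ∂circleMeasure := by
  have h := inner_coSzego hz hg
  rw [← inner_szegoL2 hz, ← add_zero (inner ℂ (szegoL2 z hz) g), ← h, ← inner_add_left, szegoL2,
    ← map_add, L2.inner_def]
  refine integral_congr_ae ?_
  filter_upwards [ContinuousMap.coeFn_toLp (𝕜 := ℂ) (p := 2) circleMeasure
    (szego z hz + coSzego z hz)] with ζ hζ
  rw [hζ, RCLike.inner_apply, poisson_eq_add hz]
  simp [szego, coSzego]
  ring

/-- Cauchy integrals of square integrable functions have non-tangential limits. -/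
theorem ae_tendsto_cauchyInt (g : CircleL2) :
    ∀ᵐ ζ : Circle ∂circleMeasure, ∀ M : ℝ,
      Tendsto (cauchyInt g) (𝓝[stolz M ζ] ζ) (𝓝 (riesz g ζ)) := by
  have hi : Integrable (riesz g) circleMeasure := (Lp.memLp (riesz g)).integrable (by norm_num)
  filter_upwards [ae_tendsto_poisson hi] with ζ hζ M
  refine (hζ M).congr' ?_
  filter_upwards [self_mem_nhdsWithin] with z hz
  rw [← cauchyInt_riesz g hz.1, cauchyInt_eq_poisson (riesz_mem g) hz.1]

/-! ### Weighted composition operators -/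

/-- The inequality is absolute continuity of the weighted image measure: null sets pull back to null
sets where `ψ ≠ 0`. Weighted composition is therefore well defined on `L²` classes. -/
lemma ae_comp_of_lintegral_le {X Y : Type*} [MeasurableSpace X] [MeasurableSpace Y]
    {μ : Measure X} {ν : Measure Y} {θ : X → Y} {ψ : X → ℂ}
    (hψ : Measurable ψ) {C : ENNReal}
    (H : ∀ F : Y → ENNReal, Measurable F →
      ∫⁻ x, ‖ψ x‖ₑ ^ 2 * F (θ x) ∂μ ≤ C * ∫⁻ y, F y ∂ν) (hθ : Measurable θ) {P : Y → Prop}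
    (hP : ∀ᵐ y ∂ν, P y) : ∀ᵐ x ∂μ, ψ x ≠ 0 → P (θ x) := by
  obtain ⟨s, hs, hsm, hs0⟩ := exists_measurable_superset_of_null (ae_iff.1 hP)
  have h := H (s.indicator 1) (measurable_one.indicator hsm)
  rw [lintegral_indicator_one hsm, hs0, mul_zero, nonpos_iff_eq_zero, lintegral_eq_zero_iff] at h
  · filter_upwards [h] with x hx hne
    by_contra hc
    have hmem : θ x ∈ s := hs hc
    simp [Set.indicator_of_mem hmem, hne] at hx
  · exact (hψ.enorm.pow_const 2).mul ((measurable_one.indicator hsm).comp hθ)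

lemma eLpNorm_two_eq {X : Type*} [MeasurableSpace X] (μ : Measure X) (f : X → ℂ) :
    eLpNorm f 2 μ = (∫⁻ x, ‖f x‖ₑ ^ 2 ∂μ) ^ (1 / 2 : ℝ) := by
  rw [eLpNorm_eq_lintegral_rpow_enorm_toReal (by norm_num) (by norm_num)]
  norm_num

/-- The operator `h ↦ ψ · (h ∘ θ)` between `L²` spaces. -/
lemma exists_weightedComp {X Y : Type*} [MeasurableSpace X] [MeasurableSpace Y]
    {μ : Measure X} {ν : Measure Y} {θ : X → Y} (hθ : Measurable θ) {ψ : X → ℂ}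
    (hψ : Measurable ψ) {C : ENNReal} (hC : C ≠ ⊤)
    (H : ∀ F : Y → ENNReal, Measurable F →
      ∫⁻ x, ‖ψ x‖ₑ ^ 2 * F (θ x) ∂μ ≤ C * ∫⁻ y, F y ∂ν) :
    ∃ T : Lp ℂ 2 ν →L[ℂ] Lp ℂ 2 μ, ∀ h : Lp ℂ 2 ν, T h =ᵐ[μ] fun x => ψ x * h (θ x) := by
  have hsm : ∀ h : Lp ℂ 2 ν, AEStronglyMeasurable (fun x => ψ x * h (θ x)) μ := fun h =>
    (hψ.mul ((Lp.stronglyMeasurable h).measurable.comp hθ)).aestronglyMeasurable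
  have hle : ∀ h : Lp ℂ 2 ν, eLpNorm (fun x => ψ x * h (θ x)) 2 μ ≤
      C ^ (1 / 2 : ℝ) * eLpNorm h 2 ν := by
    intro h
    rw [eLpNorm_two_eq, eLpNorm_two_eq, ← ENNReal.mul_rpow_of_nonneg _ _ (by norm_num)]
    gcongr
    refine le_trans (le_of_eq ?_) (H (fun y => ‖h y‖ₑ ^ 2)
      ((Lp.stronglyMeasurable h).measurable.enorm.pow_const 2))
    simp only [enorm_mul, mul_pow]
  have hCt : C ^ (1 / 2 : ℝ) ≠ ⊤ := ENNReal.rpow_ne_top_of_nonneg (by norm_num) hC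
  have hmem : ∀ h : Lp ℂ 2 ν, MemLp (fun x => ψ x * h (θ x)) 2 μ := fun h =>
    ⟨hsm h, (hle h).trans_lt (ENNReal.mul_lt_top hCt.lt_top (Lp.eLpNorm_lt_top h))⟩
  let T₀ : Lp ℂ 2 ν →ₗ[ℂ] Lp ℂ 2 μ :=
    { toFun := fun h => (hmem h).toLp _
      map_add' := fun h k => by
        refine Lp.ext ?_
        filter_upwards [(hmem (h + k)).coeFn_toLp, (hmem h).coeFn_toLp, (hmem k).coeFn_toLp,
          Lp.coeFn_add ((hmem h).toLp _) ((hmem k).toLp _),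
          ae_comp_of_lintegral_le hψ H hθ (Lp.coeFn_add h k)] with x h1 h2 h3 h4 h5
        rw [h1, h4, Pi.add_apply, h2, h3]
        by_cases h0 : ψ x = 0
        · simp [h0]
        · rw [h5 h0, Pi.add_apply, mul_add]
      map_smul' := fun c h => by
        refine Lp.ext ?_
        filter_upwards [(hmem (c • h)).coeFn_toLp, (hmem h).coeFn_toLp,
          Lp.coeFn_smul c ((hmem h).toLp _),
          ae_comp_of_lintegral_le hψ H hθ (Lp.coeFn_smul c h)] with x h1 h2 h4 h5
        rw [h1, RingHom.id_apply, h4, Pi.smul_apply, h2]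
        by_cases h0 : ψ x = 0
        · simp [h0]
        · rw [h5 h0, Pi.smul_apply, smul_eq_mul, smul_eq_mul]
          ring }
  refine ⟨T₀.mkContinuous (C ^ (1 / 2 : ℝ)).toReal fun h => ?_, fun h => (hmem h).coeFn_toLp⟩
  change ‖(hmem h).toLp _‖ ≤ _
  rw [Lp.norm_toLp, Lp.norm_def, ← ENNReal.toReal_mul]
  exact ENNReal.toReal_mono (ENNReal.mul_ne_top hCt (Lp.eLpNorm_ne_top h)) (hle h)

/-- Multiplication by a continuous function on `L²`. -/
lemma exists_mulOp {X : Type*} [TopologicalSpace X] [CompactSpace X] [MeasurableSpace X]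
    [BorelSpace X] (μ : Measure X) {ψ : X → ℂ} (hψ : Continuous ψ) :
    ∃ T : Lp ℂ 2 μ →L[ℂ] Lp ℂ 2 μ, ∀ h : Lp ℂ 2 μ, T h =ᵐ[μ] fun x => ψ x * h x := by
  obtain ⟨C, hC⟩ := isCompact_univ.exists_bound_of_continuousOn hψ.continuousOn
  refine exists_weightedComp (θ := id) (C := ENNReal.ofReal C ^ 2) measurable_id hψ.measurable
    (by simp) fun F hF => ?_
  rw [← lintegral_const_mul _ hF]
  refine lintegral_mono fun x => ?_
  simp only [id]
  gcongr
  rw [← ofReal_norm]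
  exact ENNReal.ofReal_le_ofReal (hC x (Set.mem_univ _))

end

section

open Metric Polynomial

/-! ### Boundary values of inner functions -/

/-- The image of the Lebesgue measure under an inner function. -/
lemma map_inner_eq {β : Circle → Circle} (hβ : Continuous β) {B : ℂ → ℂ}
    (hB : DiffContOnCl ℂ B (ball 0 1)) (hBβ : ∀ ζ : Circle, B ζ = conj (β ζ : ℂ))
    (h0 : ‖B 0‖ < 1) : circleMeasure.map β =
      circleMeasure.withDensity fun ζ => ENNReal.ofReal (poisson (conj (B 0)) ζ) := by
  have ha : ‖conj (B 0)‖ < 1 := by simpa using h0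
  have hPc := continuous_poisson ha
  have hPm : Measurable fun ζ => ENNReal.ofReal (poisson (conj (B 0)) ζ) :=
    hPc.measurable.ennreal_ofReal
  have hfin : IsFiniteMeasure
      (circleMeasure.withDensity fun ζ => ENNReal.ofReal (poisson (conj (B 0)) ζ)) :=
    isFiniteMeasure_withDensity_ofReal (integrable_circle hPc).2
  have hfin' : IsFiniteMeasure (circleMeasure.map β) :=
    Measure.isFiniteMeasure_map circleMeasure β
  -- `B ^ k` is analytic with boundary values `conj β ^ k`, so the mean value property gives the
  -- moments of the image measure; they are those of the Poisson kernel at `conj (B 0)`.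
  have h1 : ∀ k : ℕ, ∫ ζ, (β ζ : ℂ) ^ k ∂circleMeasure = conj (B 0) ^ k := by
    intro k
    have hd : DiffContOnCl ℂ (fun z => B z ^ k) (ball 0 1) :=
      ⟨hB.differentiableOn.pow k, hB.continuousOn.pow k⟩
    rw [← map_pow, ← integral_circle_eq hd, ← integral_conj]
    refine integral_congr_ae (Eventually.of_forall fun ζ => ?_)
    simp [hBβ]
  have h2 : ∀ k : ℕ, ∫ ζ : Circle, (poisson (conj (B 0)) ζ : ℂ) * (ζ : ℂ) ^ k ∂circleMeasure =
      conj (B 0) ^ k := fun k =>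
    integral_poisson_mul (f := fun z => z ^ k) (by
      exact (differentiable_id.pow k).diffContOnCl) ha
  have h3 : ∀ k : ℕ, ∫ ζ : Circle, (ζ : ℂ) ^ k ∂(circleMeasure.map β) =
      ∫ ζ : Circle, (ζ : ℂ) ^ k ∂(circleMeasure.withDensity fun ζ =>
        ENNReal.ofReal (poisson (conj (B 0)) ζ)) := by
    intro k
    rw [integral_map hβ.aemeasurable (by fun_prop), h1,
      integral_withDensity_eq_integral_toReal_smul hPm
      (Eventually.of_forall fun _ => ENNReal.ofReal_lt_top), ← h2]
    refine integral_congr_ae (Eventually.of_forall fun ζ => ?_)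
    simp [ENNReal.toReal_ofReal (poisson_pos ha ζ).le]
  refine measure_ext_of_characters (u := id) (v := fun _ => 1) continuous_id continuous_const
    (fun x y h _ => h) fun j k => ?_
  simp only [id, one_zpow, mul_one]
  obtain ⟨m, rfl | rfl⟩ := j.eq_nat_or_neg
  · simpa using h3 m
  · have e : ∀ ζ : Circle, ((ζ ^ (-(m : ℤ)) : Circle) : ℂ) = conj ((ζ : ℂ) ^ m) := fun ζ => by
      rw [zpow_neg, zpow_natCast, ← conj_coe_circle, Circle.coe_pow]
    simp only [e]
    rw [integral_conj, integral_conj, h3 m]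

lemma lintegral_comp_inner_le {β : Circle → Circle} (hβ : Continuous β) {B : ℂ → ℂ}
    (hB : DiffContOnCl ℂ B (ball 0 1)) (hBβ : ∀ ζ : Circle, B ζ = conj (β ζ : ℂ))
    (h0 : ‖B 0‖ < 1) : ∃ C : ENNReal, C ≠ ⊤ ∧ ∀ F : Circle → ENNReal, Measurable F →
      ∫⁻ ζ, F (β ζ) ∂circleMeasure ≤ C * ∫⁻ ζ, F ζ ∂circleMeasure := by
  have ha : ‖conj (B 0)‖ < 1 := by simpa using h0
  have hPc := continuous_poisson ha
  obtain ⟨C, hC⟩ := isCompact_univ.exists_bound_of_continuousOn hPc.continuousOn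
  refine ⟨ENNReal.ofReal C, ENNReal.ofReal_ne_top, fun F hF => ?_⟩
  rw [← lintegral_map hF hβ.measurable, map_inner_eq hβ hB hBβ h0,
    lintegral_withDensity_eq_lintegral_mul _ hPc.measurable.ennreal_ofReal hF,
    ← lintegral_const_mul _ hF]
  refine lintegral_mono fun ζ => ?_
  rw [Pi.mul_apply]
  gcongr
  exact (le_abs_self _).trans (hC ζ (Set.mem_univ _))

namespace ClarkData

variable {n : ℕ} {p₀ p₁ : ℂ[X]} {γ α : Circle} (K : ClarkData n p₀ p₁ γ α)

lemma conj_β_mul (ζ : Circle) :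
    K.b₀.eval (ζ : ℂ) * conj (K.β ζ : ℂ) = -K.b₁.eval (ζ : ℂ) := by
  linear_combination conj (K.β ζ : ℂ) * K.curve ζ - K.b₁.eval (ζ : ℂ) * circle_mul_conj (K.β ζ)

lemma b₀_circle_ne_zero (ζ : Circle) : K.b₀.eval (ζ : ℂ) ≠ 0 :=
  K.b₀_ne_zero ζ (Circle.norm_coe ζ).le

/-- Either `β` is, up to conjugation, a non-constant inner function, or it is constant. -/
lemma comp_le_or_const :
    (∃ C : ENNReal, C ≠ ⊤ ∧ ∀ F : Circle → ENNReal, Measurable F →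
      ∫⁻ ζ, F (K.β ζ) ∂circleMeasure ≤ C * ∫⁻ ζ, F ζ ∂circleMeasure) ∨
    ∃ c : Circle, (∀ ζ, K.β ζ = c) ∧
      ∀ z, ‖z‖ ≤ 1 → K.b₁.eval z = -(conj (c : ℂ) * K.b₀.eval z) := by
  let B : ℂ → ℂ := fun z => -K.b₁.eval z / K.b₀.eval z
  have hB : DiffContOnCl ℂ B (ball 0 1) := by
    refine DifferentiableOn.diffContOnCl ?_
    rw [closure_ball _ one_ne_zero]
    exact DifferentiableOn.div (by fun_prop) (by fun_prop) fun z hz =>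
      K.b₀_ne_zero z (by simpa using hz)
  have hBβ : ∀ ζ : Circle, B ζ = conj (K.β ζ : ℂ) := fun ζ => by
    simp only [B]
    rw [← K.conj_β_mul, mul_div_cancel_left₀ _ (K.b₀_circle_ne_zero ζ)]
  rcases lt_or_ge ‖B 0‖ 1 with h | h
  · exact Or.inl (lintegral_comp_inner_le K.continuous_β hB hBβ h)
  · right
    have hle : ∀ z ∈ closure (ball (0 : ℂ) 1), ‖B z‖ ≤ 1 := fun z hz => by
      refine Complex.norm_le_of_forall_mem_frontier_norm_le isBounded_ball hB (fun w hw => ?_) hz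
      rw [frontier_ball _ one_ne_zero, mem_sphere_zero_iff_norm] at hw
      obtain ⟨τ, rfl⟩ := exists_circle hw
      rw [hBβ, RCLike.norm_conj, Circle.norm_coe]
    have hmax : IsMaxOn (norm ∘ B) (ball 0 1) 0 := fun z hz =>
      (hle z (subset_closure hz)).trans h
    have heq := Complex.eqOn_closedBall_of_isMaxOn_norm hB hmax
    have hn : ‖B 0‖ = 1 := le_antisymm (hle 0 (subset_closure (by simp))) h
    obtain ⟨c, hc⟩ := exists_circle (z := conj (B 0)) (by simpa using hn)
    refine ⟨c, fun ζ => Circle.ext ?_, fun z hz => ?_⟩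
    · have := heq (x := (ζ : ℂ)) (by simp [Circle.norm_coe])
      rw [hBβ, Function.const_apply] at this
      rw [hc, ← this, Complex.conj_conj]
    · have := heq (x := z) (by simpa using hz)
      simp only [B, Function.const_apply] at this
      rw [div_eq_iff (K.b₀_ne_zero z hz)] at this
      rw [hc, Complex.conj_conj]
      linear_combination -this

end ClarkData

/-- Division of `q(z) - q(ζ)` by `z - ζ`. -/
lemma exists_sub_eq (q : ℂ[X]) {N : ℕ} (hN : q.natDegree < N) :
    ∃ e : ℕ → ℂ → ℂ, (∀ j, Continuous (e j)) ∧ ∀ z ζ : ℂ,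
      q.eval z - q.eval ζ = (z - ζ) * ∑ j ∈ Finset.range N, z ^ j * e j ζ := by
  refine ⟨fun j ζ => ∑ k ∈ Finset.range N, if j < k then q.coeff k * ζ ^ (k - 1 - j) else 0,
    fun j => continuous_finsetSum _ fun k _ => ?_, fun z ζ => ?_⟩
  · split_ifs <;> fun_prop
  · rw [eval_eq_sum_range' hN, eval_eq_sum_range' hN, ← Finset.sum_sub_distrib]
    simp_rw [← mul_sub, ← geom_sum₂_mul, Finset.mul_sum]
    rw [Finset.sum_comm]
    refine Finset.sum_congr rfl fun k hk => ?_
    have hsub : Finset.range k ⊆ Finset.range N := Finset.range_mono (Finset.mem_range.1 hk).le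
    rw [← Finset.sum_subset hsub, ← mul_assoc, mul_comm, ← mul_assoc, Finset.mul_sum]
    · refine Finset.sum_congr rfl fun j hj => ?_
      rw [if_pos (Finset.mem_range.1 hj)]
      ring
    · intro j _ hj
      rw [if_neg (fun h => hj (Finset.mem_range.2 h)), mul_zero, mul_zero]

/-- The left side vanishes for `z = ζ`; the quotient by `z - ζ` is expanded in powers of `z` to
separate the variables. -/
lemma exists_bezoutian (q₀ q₁ : ℂ[X]) :
    ∃ (N : ℕ) (e : ℕ → ℂ → ℂ), (∀ j, Continuous (e j)) ∧ ∀ z ζ : ℂ,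
      q₀.eval ζ * q₁.eval z - q₀.eval z * q₁.eval ζ =
        (z - ζ) * ∑ j ∈ Finset.range N, z ^ j * e j ζ := by
  set N := max q₀.natDegree q₁.natDegree + 1
  obtain ⟨e₀, c₀, h₀⟩ := exists_sub_eq q₀ (N := N) (Nat.lt_succ_of_le (le_max_left _ _))
  obtain ⟨e₁, c₁, h₁⟩ := exists_sub_eq q₁ (N := N) (Nat.lt_succ_of_le (le_max_right _ _))
  refine ⟨N, fun j ζ => q₀.eval ζ * e₁ j ζ - q₁.eval ζ * e₀ j ζ, fun j => ?_, fun z ζ => ?_⟩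
  · have := c₀ j
    have := c₁ j
    fun_prop
  · have e : ∑ j ∈ Finset.range N, z ^ j * (q₀.eval ζ * e₁ j ζ - q₁.eval ζ * e₀ j ζ) =
        q₀.eval ζ * ∑ j ∈ Finset.range N, z ^ j * e₁ j ζ -
          q₁.eval ζ * ∑ j ∈ Finset.range N, z ^ j * e₀ j ζ := by
      rw [Finset.mul_sum, Finset.mul_sum, ← Finset.sum_sub_distrib]
      refine Finset.sum_congr rfl fun j _ => ?_
      ring
    rw [e]
    linear_combination q₀.eval ζ * h₁ z ζ - q₁.eval ζ * h₀ z ζ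

namespace ClarkData

variable {n : ℕ} {p₀ p₁ : ℂ[X]} {γ α : Circle} (K : ClarkData n p₀ p₁ γ α)

/-- The weighted restriction to the level curve. -/
lemma exists_curveOp : ∃ A : Lp ℂ 2 K.measure →L[ℂ] CircleL2,
    ∀ h : Lp ℂ 2 K.measure, A h =ᵐ[circleMeasure] fun ζ => (K.w ζ : ℂ) * h (ζ, K.β ζ) := by
  have hc := K.continuous_w
  obtain ⟨C, hC⟩ := isCompact_univ.exists_bound_of_continuousOn hc.continuousOn
  refine exists_weightedComp (θ := fun ζ => ((ζ, K.β ζ) : Torus)) (C := ENNReal.ofReal C)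
    (measurableEmbedding_graph K.continuous_β).measurable (by fun_prop) (by simp) fun F hF => ?_
  have hm : Measurable fun ζ => F (ζ, K.β ζ) :=
    hF.comp (measurableEmbedding_graph K.continuous_β).measurable
  calc _ ≤ ∫⁻ ζ, ENNReal.ofReal C * (ENNReal.ofReal (K.w ζ) * F (ζ, K.β ζ)) ∂circleMeasure := by
        refine lintegral_mono fun ζ => ?_
        rw [← ofReal_norm, Complex.norm_real, Real.norm_of_nonneg (K.w_nonneg ζ), sq, mul_assoc]
        gcongr
        exact (le_abs_self _).trans (hC ζ (Set.mem_univ _))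
    _ = ENNReal.ofReal C * ∫⁻ ζ, ENNReal.ofReal (K.w ζ) * F (ζ, K.β ζ) ∂circleMeasure :=
        lintegral_const_mul _ (K.measurable_density.mul hm)
    _ ≤ _ := by
        rw [K.lintegral_eq]
        gcongr
        exact le_self_add

/-- The restriction to a line. -/
lemma exists_lineOp {τ : Circle} (hτ : τ ∈ K.Z) : ∃ L : Lp ℂ 2 K.measure →L[ℂ] CircleL2,
    ∀ h : Lp ℂ 2 K.measure, L h =ᵐ[circleMeasure] fun ζ => h (τ, ζ) := by
  have hc := K.c_pos τ
  obtain ⟨L, hL⟩ := exists_weightedComp (μ := circleMeasure) (ν := K.measure)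
    (θ := fun ζ => ((τ, ζ) : Torus)) (ψ := fun _ => 1)
    (C := ENNReal.ofReal (K.c τ)⁻¹) (measurableEmbedding_line τ).measurable measurable_const
    (by simp) fun F hF => by
      rw [K.lintegral_eq]
      have h1 : ENNReal.ofReal (K.c τ) * ∫⁻ ζ, F (τ, ζ) ∂circleMeasure ≤
          ∑ τ ∈ K.Z, ENNReal.ofReal (K.c τ) * ∫⁻ ζ, F (τ, ζ) ∂circleMeasure :=
        Finset.single_le_sum (f := fun τ => ENNReal.ofReal (K.c τ) * ∫⁻ ζ, F (τ, ζ) ∂circleMeasure)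
          (fun _ _ => zero_le) hτ
      calc _ = ENNReal.ofReal (K.c τ)⁻¹ * (ENNReal.ofReal (K.c τ) *
            ∫⁻ ζ, F (τ, ζ) ∂circleMeasure) := by
            rw [← mul_assoc, ← ENNReal.ofReal_mul (inv_pos.2 hc).le, inv_mul_cancel₀ hc.ne']
            simp
        _ ≤ _ := by
            gcongr
            exact h1.trans le_add_self
  exact ⟨L, fun h => (hL h).trans (Eventually.of_forall fun ζ => by simp)⟩

/-- The composition with `β`, when it is bounded. -/
lemma exists_compOp (hβ : ∃ C : ENNReal, C ≠ ⊤ ∧ ∀ F : Circle → ENNReal, Measurable F →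
      ∫⁻ ζ, F (K.β ζ) ∂circleMeasure ≤ C * ∫⁻ ζ, F ζ ∂circleMeasure) :
    ∃ S : CircleL2 →L[ℂ] CircleL2, ∀ g : CircleL2, S g =ᵐ[circleMeasure] fun ζ => g (K.β ζ) := by
  obtain ⟨C, hC, H⟩ := hβ
  obtain ⟨S, hS⟩ := exists_weightedComp (μ := circleMeasure) (ν := circleMeasure) (θ := K.β)
    (ψ := fun _ => 1) K.continuous_β.measurable measurable_const hC fun F hF => by simpa using H F hF
  exact ⟨S, fun g => (hS g).trans (Eventually.of_forall fun ζ => by simp)⟩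

lemma ae_comp_β {P : Circle → Prop}
    (hβ : ∃ C : ENNReal, C ≠ ⊤ ∧ ∀ F : Circle → ENNReal, Measurable F →
      ∫⁻ ζ, F (K.β ζ) ∂circleMeasure ≤ C * ∫⁻ ζ, F ζ ∂circleMeasure)
    (hP : ∀ᵐ ζ ∂circleMeasure, P ζ) : ∀ᵐ ζ ∂circleMeasure, P (K.β ζ) := by
  obtain ⟨C, hC, H⟩ := hβ
  have := ae_comp_of_lintegral_le (μ := circleMeasure) (ψ := fun _ => 1) measurable_const
    (fun F hF => by simpa using H F hF) K.continuous_β.measurable hP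
  filter_upwards [this] with ζ hζ using hζ one_ne_zero

end ClarkData

end

/-! ### Reduction to one-variable Cauchy integrals -/

section

open Metric Polynomial

lemma integrable_mul_continuous {X : Type*} [TopologicalSpace X] [CompactSpace X]
    [MeasurableSpace X] [BorelSpace X] {μ : Measure X} [IsFiniteMeasure μ] (g : Lp ℂ 2 μ)
    {F : X → ℂ} (hF : Continuous F) : Integrable (fun x => g x * F x) μ := by
  obtain ⟨C, hC⟩ := isCompact_univ.exists_bound_of_continuousOn hF.continuousOn
  exact ((Lp.memLp g).integrable (by norm_num)).mul_bdd (c := C) hF.aestronglyMeasurable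
    (Eventually.of_forall fun x => hC x (Set.mem_univ _))

lemma continuous_inv_one_sub {X : Type*} [TopologicalSpace X] {u : X → Circle} (hu : Continuous u)
    {z : ℂ} (hz : ‖z‖ < 1) : Continuous fun x => (1 - z * conj (u x : ℂ))⁻¹ :=
  Continuous.inv₀ (by fun_prop) fun x => one_sub_mul_ne_zero hz (by simp [Circle.norm_coe])

lemma inner_clarkVec_eq (φ : ℂ × ℂ → ℂ) (α : Circle) (σ : Measure Torus) [IsFiniteMeasure σ]
    {z : ℂ × ℂ} (hz : z ∈ bidisk) (h : Lp ℂ 2 σ) : inner ℂ (clarkVec φ α σ z) h =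
      (1 - conj (α : ℂ) * φ z) * ∫ ζ, h ζ * cauchyMap z ζ ∂σ := by
  rw [L2.inner_def, ← integral_const_mul]
  refine integral_congr_ae ?_
  filter_upwards [coeFn_clarkVec φ α σ hz] with ζ hζ
  rw [hζ, RCLike.inner_apply, ← star_cauchyMap_apply hz]
  simp only [map_mul, map_sub, map_one, Complex.conj_conj, ContinuousMap.star_apply, RCLike.star_def]
  ring

namespace ClarkData

variable {n : ℕ} {p₀ p₁ : ℂ[X]} {γ α : Circle} (K : ClarkData n p₀ p₁ γ α)

/-- The Cauchy integral over the level curve, multiplied by `b₀ + z₂ b₁`, is a sum of Cauchy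
integrals in one variable. -/
lemma exists_curve_decomposition {A : Lp ℂ 2 K.measure →L[ℂ] CircleL2}
    (hA : ∀ h : Lp ℂ 2 K.measure, A h =ᵐ[circleMeasure] fun ζ => (K.w ζ : ℂ) * h (ζ, K.β ζ)) :
    ∃ (N : ℕ) (T : ℕ → Lp ℂ 2 K.measure →L[ℂ] CircleL2),
    (∀ (h : Lp ℂ 2 K.measure), ∀ z ∈ bidisk,
      (K.b₀.eval z.1 + z.2 * K.b₁.eval z.1) * ∫ ζ, (K.w ζ : ℂ) * (h (ζ, K.β ζ) *
        ((1 - z.1 * conj (ζ : ℂ))⁻¹ * (1 - z.2 * conj (K.β ζ : ℂ))⁻¹)) ∂circleMeasure =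
      K.b₀.eval z.1 * cauchyInt (A h) z.1 +
        z.2 * ∑ j ∈ Finset.range N, z.1 ^ j * cauchyInt (T j h) z.2) ∧
    ((∃ C : ENNReal, C ≠ ⊤ ∧ ∀ F : Circle → ENNReal, Measurable F →
      ∫⁻ ζ, F (K.β ζ) ∂circleMeasure ≤ C * ∫⁻ ζ, F ζ ∂circleMeasure) ∨
    N = 0 ∧ ∃ c : Circle, (∀ ζ, K.β ζ = c) ∧
      ∀ z, ‖z‖ ≤ 1 → K.b₁.eval z = -(conj (c : ℂ) * K.b₀.eval z)) := by
  rcases K.comp_le_or_const with hβ | ⟨c, hc, hb⟩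
  · obtain ⟨S, hS⟩ := K.exists_compOp hβ
    obtain ⟨N, e, he, hbez⟩ := exists_bezoutian K.b₀ K.b₁
    have hψc : ∀ j, Continuous fun ζ : Circle => -((ζ : ℂ) * e j ζ) / K.b₀.eval (ζ : ℂ) := fun j => by
      have := he j
      exact Continuous.div (by fun_prop) (by fun_prop) K.b₀_circle_ne_zero
    choose M hM using fun j => exists_mulOp circleMeasure (hψc j)
    refine ⟨N, fun j => (ContinuousLinearMap.adjoint S) ∘L (M j) ∘L A, fun h z hz => ?_, Or.inl hβ⟩
    -- The adjoint of composition with `β` turns an integral of the kernel at the points `β ζ` into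
    -- a genuine Cauchy integral in `z₂`.
    have hadj : ∀ u : CircleL2, cauchyInt (ContinuousLinearMap.adjoint S u) z.2 =
        ∫ ζ, u ζ * (1 - z.2 * conj (K.β ζ : ℂ))⁻¹ ∂circleMeasure := by
      intro u
      rw [← inner_szegoL2 hz.2, ContinuousLinearMap.adjoint_inner_right, L2.inner_def]
      refine integral_congr_ae ?_
      filter_upwards [hS (szegoL2 z.2 hz.2), K.ae_comp_β hβ (coeFn_szegoL2 hz.2)] with ζ h1 h2
      rw [h1, h2, RCLike.inner_apply, conj_szego]
    simp only [ContinuousLinearMap.comp_apply, hadj]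
    have c1 := continuous_inv_one_sub (X := Circle) continuous_id hz.1
    have c2 := continuous_inv_one_sub K.continuous_β hz.2
    simp only [id] at c1
    have i2 : ∀ j, Integrable (fun ζ => z.1 ^ j * (M j (A h) ζ *
        (1 - z.2 * conj (K.β ζ : ℂ))⁻¹)) circleMeasure := fun j =>
      (integrable_mul_continuous _ c2).const_mul _
    rw [cauchyInt, ← integral_const_mul, ← integral_const_mul]
    simp_rw [← integral_const_mul]
    rw [← integral_finsetSum _ fun j _ => i2 j, ← integral_const_mul,
      ← integral_add ((integrable_mul_continuous _ c1).const_mul _)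
        ((integrable_finsetSum _ fun j _ => i2 j).const_mul _)]
    refine integral_congr_ae ?_
    have hall : ∀ᵐ ζ ∂circleMeasure, ∀ j, M j (A h) ζ =
        -((ζ : ℂ) * e j ζ) / K.b₀.eval (ζ : ℂ) * A h ζ := ae_all_iff.2 fun j => hM j (A h)
    filter_upwards [hA h, hall] with ζ h1 h2
    simp only [h2, h1]
    set x := (1 - z.1 * conj (ζ : ℂ))⁻¹ with hx
    set y := (1 - z.2 * conj (K.β ζ : ℂ))⁻¹ with hy
    have hx1 : (1 - z.1 * conj (ζ : ℂ)) * x = 1 :=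
      mul_inv_cancel₀ (one_sub_mul_ne_zero hz.1 (by simp [Circle.norm_coe]))
    have hy1 : (1 - z.2 * conj (K.β ζ : ℂ)) * y = 1 :=
      mul_inv_cancel₀ (one_sub_mul_ne_zero hz.2 (by simp [Circle.norm_coe]))
    have hx2 : (z.1 - ζ) * x = -ζ := by
      linear_combination (-(ζ : ℂ)) * hx1 - z.1 * x * circle_mul_conj ζ
    have hb0 := K.b₀_circle_ne_zero ζ
    have hB := K.conj_β_mul ζ
    have hz1 := hbez z.1 ζ
    have hsum : ∑ j ∈ Finset.range N, z.1 ^ j * (-((ζ : ℂ) * e j ζ) / K.b₀.eval (ζ : ℂ) *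
        (K.w ζ * h (ζ, K.β ζ)) * y) = -(ζ : ℂ) * (∑ j ∈ Finset.range N, z.1 ^ j * e j ζ) *
          (K.b₀.eval (ζ : ℂ))⁻¹ * (K.w ζ * h (ζ, K.β ζ)) * y := by
      simp only [Finset.mul_sum, Finset.sum_mul]
      refine Finset.sum_congr rfl fun j _ => ?_
      rw [div_eq_mul_inv]
      ring
    rw [hsum]
    set Q := ∑ j ∈ Finset.range N, z.1 ^ j * e j ζ
    set B := conj (K.β ζ : ℂ)
    -- On the curve `conj β = -b₁ / b₀`, so the left side is a Bezoutian over `b₀(ζ)`. Its factor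
    -- `z₁ - ζ` cancels the Cauchy kernel in `z₁`, leaving only the kernel in `z₂`.
    have hkey : K.b₁.eval z.1 + K.b₀.eval z.1 * B = (z.1 - ζ) * Q * (K.b₀.eval (ζ : ℂ))⁻¹ := by
      rw [eq_mul_inv_iff_mul_eq₀ hb0]
      linear_combination hz1 + K.b₀.eval z.1 * hB
    have hkey2 : (K.b₀.eval z.1 + z.2 * K.b₁.eval z.1) * (x * y) = K.b₀.eval z.1 * x +
        z.2 * (-(ζ : ℂ) * Q * (K.b₀.eval (ζ : ℂ))⁻¹ * y) := by
      linear_combination z.2 * x * y * hkey + z.2 * Q * (K.b₀.eval (ζ : ℂ))⁻¹ * y * hx2 +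
        K.b₀.eval z.1 * x * hy1
    linear_combination (K.w ζ : ℂ) * h (ζ, K.β ζ) * hkey2
  -- For constant `β = c` the factor `b₀ + z₂ b₁` equals `b₀ (1 - z₂ conj c)` and cancels the kernel
  -- in `z₂`, so no second-variable terms remain.
  · refine ⟨0, fun _ => 0, fun h z hz => ?_, Or.inr ⟨rfl, c, hc, hb⟩⟩
    rw [Finset.range_zero, Finset.sum_empty, mul_zero, add_zero, cauchyInt, ← integral_const_mul,
      ← integral_const_mul]
    refine integral_congr_ae ?_
    filter_upwards [hA h] with ζ h1
    rw [h1, hc, hb z.1 hz.1.le]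
    have hy1 : (1 - z.2 * conj (c : ℂ)) * (1 - z.2 * conj (c : ℂ))⁻¹ = 1 :=
      mul_inv_cancel₀ (one_sub_mul_ne_zero hz.2 (by simp [Circle.norm_coe]))
    linear_combination K.b₀.eval z.1 * K.w ζ * h (ζ, c) * (1 - z.1 * conj (ζ : ℂ))⁻¹ * hy1

/-- The representation of `p(z) ⟨v_z, h⟩` by Cauchy integrals in one variable. -/
lemma mul_inner_clarkVec {φ : ℂ × ℂ → ℂ} (R : RIFRep φ n p₀ p₁ γ)
    {A : Lp ℂ 2 K.measure →L[ℂ] CircleL2} {L : Circle → Lp ℂ 2 K.measure →L[ℂ] CircleL2}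
    (hL : ∀ τ ∈ K.Z, ∀ h : Lp ℂ 2 K.measure, L τ h =ᵐ[circleMeasure] fun ζ => h (τ, ζ))
    {N : ℕ} {T : ℕ → Lp ℂ 2 K.measure →L[ℂ] CircleL2}
    (hT : ∀ (h : Lp ℂ 2 K.measure), ∀ z ∈ bidisk,
      (K.b₀.eval z.1 + z.2 * K.b₁.eval z.1) * ∫ ζ, (K.w ζ : ℂ) * (h (ζ, K.β ζ) *
        ((1 - z.1 * conj (ζ : ℂ))⁻¹ * (1 - z.2 * conj (K.β ζ : ℂ))⁻¹)) ∂circleMeasure =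
      K.b₀.eval z.1 * cauchyInt (A h) z.1 +
        z.2 * ∑ j ∈ Finset.range N, z.1 ^ j * cauchyInt (T j h) z.2)
    (h : Lp ℂ 2 K.measure) {z : ℂ × ℂ} (hz : z ∈ bidisk) :
    (p₀.eval z.1 + z.2 * p₁.eval z.1) * inner ℂ (clarkVec φ α K.measure z) h =
      conj (α : ℂ) * ((nodal K.Z).eval z.1 * (K.b₀.eval z.1 * cauchyInt (A h) z.1 +
        z.2 * ∑ j ∈ Finset.range N, z.1 ^ j * cauchyInt (T j h) z.2) +
      ∑ τ ∈ K.Z, (K.c τ : ℂ) * ((nodal K.Z).eval z.1 * (1 - z.1 * conj (τ : ℂ))⁻¹) *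
        ((K.b₀.eval z.1 + z.2 * K.b₁.eval z.1) * cauchyInt (L τ h) z.2)) := by
  have hlev : (p₀.eval z.1 + z.2 * p₁.eval z.1) * (1 - conj (α : ℂ) * φ z) =
      conj (α : ℂ) * ((nodal K.Z).eval z.1 * (K.b₀.eval z.1 + z.2 * K.b₁.eval z.1)) := by
    have h1 := R.sub_eq α hz
    rw [K.level₀_eq, K.level₁_eq, eval_mul, eval_mul, eq_div_iff (R.ne_zero z hz)] at h1
    linear_combination conj (α : ℂ) * h1 -
      (p₀.eval z.1 + z.2 * p₁.eval z.1) * circle_mul_conj α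
  rw [inner_clarkVec_eq φ α K.measure hz, ← mul_assoc, hlev,
    K.integral_eq (integrable_mul_continuous h (cauchyMap z).continuous)]
  simp only [cauchyMap_apply hz]
  have hline : ∀ τ ∈ K.Z, ∫ ζ : Circle, h (τ, ζ) * ((1 - z.1 * conj (τ : ℂ))⁻¹ *
      (1 - z.2 * conj (ζ : ℂ))⁻¹) ∂circleMeasure =
      (1 - z.1 * conj (τ : ℂ))⁻¹ * cauchyInt (L τ h) z.2 := by
    intro τ hτ
    rw [cauchyInt, ← integral_const_mul]
    refine integral_congr_ae ?_
    filter_upwards [hL τ hτ h] with ζ h1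
    rw [h1]
    ring
  have hsum : ∑ τ ∈ K.Z, (K.c τ : ℂ) * ∫ ζ : Circle, h (τ, ζ) * ((1 - z.1 * conj (τ : ℂ))⁻¹ *
      (1 - z.2 * conj (ζ : ℂ))⁻¹) ∂circleMeasure =
      ∑ τ ∈ K.Z, (K.c τ : ℂ) * ((1 - z.1 * conj (τ : ℂ))⁻¹ * cauchyInt (L τ h) z.2) :=
    Finset.sum_congr rfl fun τ hτ => by rw [hline τ hτ]
  rw [hsum, mul_assoc, mul_assoc, mul_add, mul_add, hT h z hz]
  congr 2
  simp only [Finset.mul_sum]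
  refine Finset.sum_congr rfl fun τ _ => ?_
  ring

end ClarkData

end

section

open Metric Polynomial

/-! ### Non-tangential approach -/

/-- The product of Stolz regions at `ζ`. -/
def stolzProd (M : ℝ) (ζ : Torus) : Set (ℂ × ℂ) :=
  {z | z ∈ bidisk ∧ ‖z.1 - ζ.1‖ < M * (1 - ‖z.1‖) ∧ ‖z.2 - ζ.2‖ < M * (1 - ‖z.2‖)}

lemma tendsto_fst_stolz (M : ℝ) (ζ : Torus) :
    Tendsto Prod.fst (𝓝[stolzProd M ζ] ζ.pt) (𝓝[stolz M ζ.1] (ζ.1 : ℂ)) :=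
  tendsto_nhdsWithin_iff.2 ⟨(continuous_fst.tendsto ζ.pt).mono_left nhdsWithin_le_nhds, by
    filter_upwards [self_mem_nhdsWithin] with z hz using ⟨hz.1.1, hz.2.1⟩⟩

lemma tendsto_snd_stolz (M : ℝ) (ζ : Torus) :
    Tendsto Prod.snd (𝓝[stolzProd M ζ] ζ.pt) (𝓝[stolz M ζ.2] (ζ.2 : ℂ)) :=
  tendsto_nhdsWithin_iff.2 ⟨(continuous_snd.tendsto ζ.pt).mono_left nhdsWithin_le_nhds, by
    filter_upwards [self_mem_nhdsWithin] with z hz using ⟨hz.1.2, hz.2.2⟩⟩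

/-- Radial approach has `|z - ζ| = 1 - |z|`, which an aperture above `1` admits. Uniqueness of
non-tangential limits rests on this. -/
lemma stolzProd_neBot (ζ : Torus) : (𝓝[stolzProd 2 ζ] ζ.pt).NeBot := by
  have h : Tendsto (fun r : ℝ => (r : ℂ) • ζ.pt) (𝓝[<] 1) (𝓝[stolzProd 2 ζ] ζ.pt) := by
    refine tendsto_nhdsWithin_iff.2
      ⟨(tendsto_dilate ζ).mono_right nhdsWithin_le_nhds, ?_⟩
    filter_upwards [Ioo_mem_nhdsLT (zero_lt_one' ℝ)] with r hr
    have key : ∀ η : Circle, ‖(r : ℂ) * η - η‖ < 2 * (1 - ‖(r : ℂ) * η‖) := fun η => by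
      have e : (r : ℂ) * η - η = ((r - 1 : ℝ) : ℂ) * η := by push_cast; ring
      rw [e, norm_mul, norm_mul, Circle.norm_coe, Complex.norm_real, Complex.norm_real,
        Real.norm_of_nonneg hr.1.le, Real.norm_eq_abs, abs_of_neg (by linarith [hr.2])]
      linarith [hr.2]
    exact ⟨smul_pt_mem_bidisk hr.1 hr.2 ζ, key ζ.1, key ζ.2⟩
  exact h.neBot

lemma HasNTLimit.unique {f : ℂ × ℂ → ℂ} {ζ : Torus} {L L' : ℂ} (h : HasNTLimit f ζ L)
    (h' : HasNTLimit f ζ L') : L = L' := by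
  have := stolzProd_neBot ζ
  exact tendsto_nhds_unique (l := 𝓝[stolzProd 2 ζ] ζ.pt) (h 2) (h' 2)

lemma hasNTLimit_iff {f : ℂ × ℂ → ℂ} {ζ : Torus} {L : ℂ} :
    HasNTLimit f ζ L ↔ ∀ M : ℝ, Tendsto f (𝓝[stolzProd M ζ] ζ.pt) (𝓝 L) := Iff.rfl

lemma HasNTLimit.congr {f g : ℂ × ℂ → ℂ} {ζ : Torus} {L : ℂ} (h : HasNTLimit f ζ L)
    (hfg : ∀ z ∈ bidisk, f z = g z) : HasNTLimit g ζ L := fun M =>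
  (h M).congr' (by filter_upwards [self_mem_nhdsWithin] with z hz using hfg z hz.1)

lemma hasNTLimit_of_tendsto {f : ℂ × ℂ → ℂ} {ζ : Torus} {L : ℂ}
    (h : Tendsto f (𝓝[bidisk] ζ.pt) (𝓝 L)) : HasNTLimit f ζ L := fun _ =>
  h.mono_left (nhdsWithin_mono _ fun _ hz => hz.1)

lemma HasNTLimit.mul {f g : ℂ × ℂ → ℂ} {ζ : Torus} {L L' : ℂ} (h : HasNTLimit f ζ L)
    (h' : HasNTLimit g ζ L') : HasNTLimit (fun z => f z * g z) ζ (L * L') := fun M =>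
  (h M).mul (h' M)

lemma HasNTLimit.add {f g : ℂ × ℂ → ℂ} {ζ : Torus} {L L' : ℂ} (h : HasNTLimit f ζ L)
    (h' : HasNTLimit g ζ L') : HasNTLimit (fun z => f z + g z) ζ (L + L') := fun M =>
  (h M).add (h' M)

lemma HasNTLimit.sum {ι : Type*} {s : Finset ι} {f : ι → ℂ × ℂ → ℂ} {ζ : Torus} {L : ι → ℂ}
    (h : ∀ i ∈ s, HasNTLimit (f i) ζ (L i)) :
    HasNTLimit (fun z => ∑ i ∈ s, f i z) ζ (∑ i ∈ s, L i) := fun M =>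
  tendsto_finsetSum s fun i hi => h i hi M

lemma hasNTLimit_of_continuousAt {f : ℂ × ℂ → ℂ} {ζ : Torus} (h : ContinuousAt f ζ.pt) :
    HasNTLimit f ζ (f ζ.pt) := hasNTLimit_of_tendsto (h.tendsto.mono_left nhdsWithin_le_nhds)

lemma hasNTLimit_fst {u : ℂ → ℂ} {ζ : Torus} {L : ℂ}
    (h : ∀ M : ℝ, Tendsto u (𝓝[stolz M ζ.1] (ζ.1 : ℂ)) (𝓝 L)) :
    HasNTLimit (fun z => u z.1) ζ L := fun M => (h M).comp (tendsto_fst_stolz M ζ)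

lemma hasNTLimit_snd {u : ℂ → ℂ} {ζ : Torus} {L : ℂ}
    (h : ∀ M : ℝ, Tendsto u (𝓝[stolz M ζ.2] (ζ.2 : ℂ)) (𝓝 L)) :
    HasNTLimit (fun z => u z.2) ζ L := fun M => (h M).comp (tendsto_snd_stolz M ζ)

/-- A zero at `τ` annihilates the Cauchy integral of a square integrable function. -/
lemma tendsto_sub_mul_cauchyInt (g : CircleL2) (τ : Circle) (M : ℝ) :
    Tendsto (fun z : ℂ => (z - τ) * cauchyInt g z) (𝓝[stolz M τ] (τ : ℂ)) (𝓝 0) := by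
  have hs : Tendsto (fun z : ℂ => |M| * ‖g‖ * Real.sqrt (1 - ‖z‖)) (𝓝[stolz M τ] (τ : ℂ)) (𝓝 0) := by
    have hc : Continuous fun z : ℂ => |M| * ‖g‖ * Real.sqrt (1 - ‖z‖) := by fun_prop
    have := (hc.tendsto τ).mono_left (nhdsWithin_le_nhds (s := stolz M τ))
    simpa [Circle.norm_coe] using this
  refine squeeze_zero_norm' ?_ hs
  filter_upwards [self_mem_nhdsWithin] with z hz
  have h0 : 0 < 1 - ‖z‖ := sub_pos.2 hz.1
  have h1 : ‖z - τ‖ ≤ |M| * (1 - ‖z‖) :=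
    hz.2.le.trans (mul_le_mul_of_nonneg_right (le_abs_self M) h0.le)
  rw [norm_mul]
  calc ‖z - τ‖ * ‖cauchyInt g z‖
      ≤ |M| * (1 - ‖z‖) * (‖g‖ * (Real.sqrt (1 - ‖z‖))⁻¹) :=
        mul_le_mul h1 (norm_cauchyInt_le g hz.1) (norm_nonneg _) (by positivity)
    _ = |M| * ‖g‖ * ((1 - ‖z‖) * (Real.sqrt (1 - ‖z‖))⁻¹) := by ring
    _ = |M| * ‖g‖ * Real.sqrt (1 - ‖z‖) := by
        rw [← div_eq_mul_inv, Real.div_sqrt]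

namespace ClarkData

variable {n : ℕ} {p₀ p₁ : ℂ[X]} {γ α : Circle} (K : ClarkData n p₀ p₁ γ α)

lemma exists_lineOps : ∃ L : Circle → Lp ℂ 2 K.measure →L[ℂ] CircleL2,
    ∀ τ ∈ K.Z, ∀ h : Lp ℂ 2 K.measure, L τ h =ᵐ[circleMeasure] fun ζ => h (τ, ζ) := by
  choose! L hL using fun (τ : Circle) (hτ : τ ∈ K.Z) => K.exists_lineOp hτ
  exact ⟨L, hL⟩

lemma circle_ne {ζ τ : Circle} (h : ζ ≠ τ) : 1 - (ζ : ℂ) * conj (τ : ℂ) ≠ 0 := by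
  intro h0
  refine h (Circle.ext ?_)
  linear_combination (-(τ : ℂ)) * h0 + (ζ : ℂ) * (-1) * circle_mul_conj τ

/-- Non-tangential limits on the level curve. -/
lemma exists_curve_limit {φ : ℂ × ℂ → ℂ} (R : RIFRep φ n p₀ p₁ γ) :
    ∃ Λ : Lp ℂ 2 K.measure →L[ℂ] CircleL2, ∀ h : Lp ℂ 2 K.measure, ∀ᵐ ζ ∂circleMeasure,
      HasNTLimit (fun z => (p₀.eval z.1 + z.2 * p₁.eval z.1) *
        inner ℂ (clarkVec φ α K.measure z) h) (ζ, K.β ζ) (Λ h ζ) := by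
  obtain ⟨A, hA⟩ := K.exists_curveOp
  obtain ⟨L, hL⟩ := K.exists_lineOps
  obtain ⟨N, T, hT, hcase⟩ := K.exists_curve_decomposition hA
  have hc := K.continuous_β
  obtain ⟨M₀, hM₀⟩ := exists_mulOp circleMeasure (ψ := fun ζ : Circle =>
    conj (α : ℂ) * ((nodal K.Z).eval (ζ : ℂ) * K.b₀.eval (ζ : ℂ))) (by fun_prop)
  -- the limit of the part with the factor `nodal K.Z`, given the limits of the sum
  have hmain : ∀ (h : Lp ℂ 2 K.measure) (ζ : Circle) (s : ℂ), ζ ∉ K.Z →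
      (∀ M : ℝ, Tendsto (cauchyInt (A h)) (𝓝[stolz M ζ] (ζ : ℂ)) (𝓝 (riesz (A h) ζ))) →
      HasNTLimit (fun z => ∑ j ∈ Finset.range N, z.1 ^ j * cauchyInt (T j h) z.2) (ζ, K.β ζ) s →
      (∀ τ ∈ K.Z, HasNTLimit (fun z => (K.b₀.eval z.1 + z.2 * K.b₁.eval z.1) *
        cauchyInt (L τ h) z.2) (ζ, K.β ζ) 0) →
      HasNTLimit (fun z => (p₀.eval z.1 + z.2 * p₁.eval z.1) *
        inner ℂ (clarkVec φ α K.measure z) h) (ζ, K.β ζ)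
        (conj (α : ℂ) * ((nodal K.Z).eval (ζ : ℂ) * (K.b₀.eval (ζ : ℂ) * riesz (A h) ζ +
          K.β ζ * s))) := by
    intro h ζ s hζ h1 h2 h3
    have hd : HasNTLimit (fun z => (nodal K.Z).eval z.1) (ζ, K.β ζ) ((nodal K.Z).eval (ζ : ℂ)) :=
      hasNTLimit_of_continuousAt (f := fun z => (nodal K.Z).eval z.1) (by fun_prop)
    have hb : HasNTLimit (fun z => K.b₀.eval z.1) (ζ, K.β ζ) (K.b₀.eval (ζ : ℂ)) :=
      hasNTLimit_of_continuousAt (f := fun z => K.b₀.eval z.1) (by fun_prop)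
    have hz2 : HasNTLimit (fun z => z.2) (ζ, K.β ζ) (K.β ζ) :=
      hasNTLimit_of_continuousAt (f := fun z => z.2) (by fun_prop)
    have hα : HasNTLimit (fun _ => conj (α : ℂ)) (ζ, K.β ζ) (conj (α : ℂ)) :=
      hasNTLimit_of_continuousAt (f := fun _ => conj (α : ℂ)) (by fun_prop)
    have hτ : ∀ τ ∈ K.Z, HasNTLimit (fun z => (K.c τ : ℂ) * ((nodal K.Z).eval z.1 *
        (1 - z.1 * conj (τ : ℂ))⁻¹) * ((K.b₀.eval z.1 + z.2 * K.b₁.eval z.1) *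
          cauchyInt (L τ h) z.2)) (ζ, K.β ζ) 0 := by
      intro τ hτ
      have hne : 1 - (ζ : ℂ) * conj (τ : ℂ) ≠ 0 := circle_ne fun h => hζ (h ▸ hτ)
      have hq : ContinuousAt (fun z : ℂ × ℂ => (K.c τ : ℂ) * ((nodal K.Z).eval z.1 *
        (1 - z.1 * conj (τ : ℂ))⁻¹)) (Torus.pt (ζ, K.β ζ)) := by
        refine continuousAt_const.mul (ContinuousAt.mul (by fun_prop) (ContinuousAt.inv₀ (by fun_prop) ?_))
        exact hne
      have := (hasNTLimit_of_continuousAt hq).mul (h3 τ hτ)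
      rwa [mul_zero] at this
    have hfin := hα.mul ((hd.mul ((hb.mul (hasNTLimit_fst (ζ := (ζ, K.β ζ)) h1)).add (hz2.mul h2))).add
      (HasNTLimit.sum hτ))
    rw [Finset.sum_const_zero, add_zero] at hfin
    exact hfin.congr fun z hz => (K.mul_inner_clarkVec R hL hT h hz).symm
  rcases hcase with hβ | ⟨hN, c, hcc, hb⟩
  · obtain ⟨S, hS⟩ := K.exists_compOp hβ
    choose M₁ hM₁ using fun j : ℕ => exists_mulOp circleMeasure (ψ := fun ζ : Circle =>
      conj (α : ℂ) * ((nodal K.Z).eval (ζ : ℂ) * (K.β ζ * (ζ : ℂ) ^ j))) (by fun_prop)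
    refine ⟨M₀ ∘L riesz ∘L A + ∑ j ∈ Finset.range N, M₁ j ∘L S ∘L riesz ∘L T j, fun h => ?_⟩
    have hall : ∀ᵐ ζ ∂circleMeasure, ∀ j, ∀ M : ℝ, Tendsto (cauchyInt (T j h))
        (𝓝[stolz M (K.β ζ)] (K.β ζ : ℂ)) (𝓝 (riesz (T j h) (K.β ζ))) :=
      ae_all_iff.2 fun j => K.ae_comp_β hβ (ae_tendsto_cauchyInt (T j h))
    have hallL : ∀ᵐ ζ ∂circleMeasure, ∀ τ ∈ K.Z, ∀ M : ℝ, Tendsto (cauchyInt (L τ h))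
        (𝓝[stolz M (K.β ζ)] (K.β ζ : ℂ)) (𝓝 (riesz (L τ h) (K.β ζ))) :=
      (Finset.eventually_all K.Z).2 fun τ _ => K.ae_comp_β hβ (ae_tendsto_cauchyInt (L τ h))
    have hM₁' : ∀ᵐ ζ ∂circleMeasure, ∀ j, M₁ j (S (riesz (T j h))) ζ =
        conj (α : ℂ) * ((nodal K.Z).eval (ζ : ℂ) * (K.β ζ * (ζ : ℂ) ^ j)) *
          S (riesz (T j h)) ζ := ae_all_iff.2 fun j => hM₁ j _
    have hS' : ∀ᵐ ζ ∂circleMeasure, ∀ j, S (riesz (T j h)) ζ = riesz (T j h) (K.β ζ) :=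
      ae_all_iff.2 fun j => hS _
    filter_upwards [ae_notMem_finset K.Z, ae_tendsto_cauchyInt (A h), hall, hallL, hM₁', hS',
      hM₀ (riesz (A h)), Lp.coeFn_add (M₀ (riesz (A h)))
        (∑ j ∈ Finset.range N, M₁ j (S (riesz (T j h)))),
      Lp.coeFn_finsetSum (Finset.range N) (fun j => M₁ j (S (riesz (T j h))))] with
      ζ h1 h2 h3 h4 h5 h6 h7 h8 h9
    have hs : HasNTLimit (fun z => ∑ j ∈ Finset.range N, z.1 ^ j * cauchyInt (T j h) z.2)
        (ζ, K.β ζ) (∑ j ∈ Finset.range N, (ζ : ℂ) ^ j * riesz (T j h) (K.β ζ)) := by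
      refine HasNTLimit.sum fun j _ => HasNTLimit.mul ?_ (hasNTLimit_snd (ζ := (ζ, K.β ζ)) (h3 j))
      exact hasNTLimit_of_continuousAt (f := fun z => z.1 ^ j) (by fun_prop)
    -- The factor `b₀ + z₂ b₁` vanishes on the curve, so the terms coming from the lines disappear
    -- in the limit.
    have hL0 : ∀ τ ∈ K.Z, HasNTLimit (fun z => (K.b₀.eval z.1 + z.2 * K.b₁.eval z.1) *
        cauchyInt (L τ h) z.2) (ζ, K.β ζ) 0 := by
      intro τ hτ
      have hq : ContinuousAt (fun z : ℂ × ℂ => K.b₀.eval z.1 + z.2 * K.b₁.eval z.1)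
        (Torus.pt (ζ, K.β ζ)) := by fun_prop
      have := (hasNTLimit_of_continuousAt hq).mul (hasNTLimit_snd (ζ := (ζ, K.β ζ)) (h4 τ hτ))
      have e : K.b₀.eval (Torus.pt (ζ, K.β ζ)).1 + (Torus.pt (ζ, K.β ζ)).2 *
        K.b₁.eval (Torus.pt (ζ, K.β ζ)).1 = 0 := K.curve ζ
      rwa [e, zero_mul] at this
    have hfin := hmain h ζ _ h1 h2 hs hL0
    convert hfin using 1
    simp only [add_apply, sum_apply,
      ContinuousLinearMap.comp_apply]
    rw [h8, Pi.add_apply, h7, h9, Finset.sum_apply]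
    simp only [h5, h6]
    rw [mul_add, mul_add, Finset.mul_sum, Finset.mul_sum, Finset.mul_sum]
    congr 1
    · ring
    · refine Finset.sum_congr rfl fun j _ => ?_
      ring
  · refine ⟨M₀ ∘L riesz ∘L A, fun h => ?_⟩
    filter_upwards [ae_notMem_finset K.Z, ae_tendsto_cauchyInt (A h), hM₀ (riesz (A h))] with
      ζ h1 h2 h3
    have hs : HasNTLimit (fun z => ∑ j ∈ Finset.range N, z.1 ^ j * cauchyInt (T j h) z.2)
        (ζ, K.β ζ) 0 := by
      simp only [hN, Finset.range_zero, Finset.sum_empty]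
      exact fun M => tendsto_const_nhds
    -- Here every point of the curve has second coordinate `c`, at which the Cauchy integrals need
    -- not converge; the factor `z₂ - c` outweighs their growth.
    have hL0 : ∀ τ ∈ K.Z, HasNTLimit (fun z => (K.b₀.eval z.1 + z.2 * K.b₁.eval z.1) *
        cauchyInt (L τ h) z.2) (ζ, K.β ζ) 0 := by
      intro τ hτ
      have hq : HasNTLimit (fun z => K.b₀.eval z.1 * (-conj (c : ℂ))) (ζ, K.β ζ)
          (K.b₀.eval (ζ : ℂ) * (-conj (c : ℂ))) :=
        hasNTLimit_of_continuousAt (f := fun z => K.b₀.eval z.1 * (-conj (c : ℂ))) (by fun_prop)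
      have hq2 : HasNTLimit (fun z => (z.2 - K.β ζ) * cauchyInt (L τ h) z.2) (ζ, K.β ζ) 0 :=
        hasNTLimit_snd (ζ := (ζ, K.β ζ)) (u := fun x => (x - K.β ζ) * cauchyInt (L τ h) x)
          fun M => tendsto_sub_mul_cauchyInt (L τ h) (K.β ζ) M
      have := hq.mul hq2
      rw [mul_zero] at this
      refine this.congr fun z hz => ?_
      rw [hb z.1 hz.1.le, hcc]
      linear_combination K.b₀.eval z.1 * cauchyInt (L τ h) z.2 * circle_mul_conj c
    have hfin := hmain h ζ 0 h1 h2 hs hL0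
    convert hfin using 1
    simp only [ContinuousLinearMap.comp_apply]
    rw [h3]
    ring

/-- Non-tangential limits on the lines. -/
lemma exists_line_limit {φ : ℂ × ℂ → ℂ} (R : RIFRep φ n p₀ p₁ γ) {τ : Circle} (hτ : τ ∈ K.Z) :
    ∃ Λ : Lp ℂ 2 K.measure →L[ℂ] CircleL2, ∀ h : Lp ℂ 2 K.measure, ∀ᵐ ζ ∂circleMeasure,
      HasNTLimit (fun z => (p₀.eval z.1 + z.2 * p₁.eval z.1) *
        inner ℂ (clarkVec φ α K.measure z) h) (τ, ζ) (Λ h ζ) := by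
  classical
  obtain ⟨A, hA⟩ := K.exists_curveOp
  obtain ⟨L, hL⟩ := K.exists_lineOps
  obtain ⟨N, T, hT, -⟩ := K.exists_curve_decomposition hA
  let q : ℂ := conj (α : ℂ) * ((K.c τ : ℂ) * (-(τ : ℂ) * (nodal (K.Z.erase τ)).eval (τ : ℂ)))
  obtain ⟨M₀, hM₀⟩ := exists_mulOp circleMeasure (ψ := fun ζ : Circle =>
    q * (K.b₀.eval (τ : ℂ) + ζ * K.b₁.eval (τ : ℂ))) (by fun_prop)
  refine ⟨M₀ ∘L riesz ∘L L τ, fun h => ?_⟩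
  have hall : ∀ᵐ ζ : Circle ∂circleMeasure, ∀ j, ∀ M : ℝ, Tendsto (cauchyInt (T j h))
      (𝓝[stolz M ζ] (ζ : ℂ)) (𝓝 (riesz (T j h) ζ)) :=
    ae_all_iff.2 fun j => ae_tendsto_cauchyInt (T j h)
  have hallL : ∀ᵐ ζ : Circle ∂circleMeasure, ∀ σ ∈ K.Z, ∀ M : ℝ, Tendsto (cauchyInt (L σ h))
      (𝓝[stolz M ζ] (ζ : ℂ)) (𝓝 (riesz (L σ h) ζ)) :=
    (Finset.eventually_all K.Z).2 fun σ _ => ae_tendsto_cauchyInt (L σ h)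
  filter_upwards [hall, hallL, hM₀ (riesz (L τ h))] with ζ h1 h2 h3
  have hpoly : ∀ u : ℂ[X], HasNTLimit (fun z => u.eval z.1) (τ, ζ) (u.eval (τ : ℂ)) := fun u =>
    hasNTLimit_of_continuousAt (f := fun z => u.eval z.1) (by fun_prop)
  have hconst : ∀ a : ℂ, HasNTLimit (fun _ => a) (τ, ζ) a := fun a M => tendsto_const_nhds
  have hz2 : HasNTLimit (fun z => z.2) (τ, ζ) (ζ : ℂ) :=
    hasNTLimit_of_continuousAt (f := fun z => z.2) (by fun_prop)
  have hz1 : HasNTLimit (fun z => z.1) (τ, ζ) (τ : ℂ) :=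
    hasNTLimit_of_continuousAt (f := fun z => z.1) (by fun_prop)
  have hd : HasNTLimit (fun z => (nodal K.Z).eval z.1) (τ, ζ) 0 := by
    have := hpoly (nodal K.Z)
    rwa [eval_nodal_eq_zero hτ] at this
  have hde : ∀ z : ℂ, (nodal K.Z).eval z = (z - τ) * (nodal (K.Z.erase τ)).eval z := fun z => by
    rw [nodal_eq_mul_erase hτ, eval_mul]; simp
  -- The first coordinate is fixed at `τ`, where Fatou's theorem says nothing; the zero of `nodal
  -- K.Z` outweighs the growth of the Cauchy integral.
  have hA0 : HasNTLimit (fun z => (nodal K.Z).eval z.1 * cauchyInt (A h) z.1) (τ, ζ) 0 := by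
    have t1 : HasNTLimit (fun z => (z.1 - τ) * cauchyInt (A h) z.1) (τ, ζ) 0 :=
      hasNTLimit_fst (ζ := (τ, ζ)) (u := fun x => (x - τ) * cauchyInt (A h) x)
        fun M => tendsto_sub_mul_cauchyInt (A h) τ M
    have t2 := (hpoly (nodal (K.Z.erase τ))).mul t1
    rw [mul_zero] at t2
    refine t2.congr fun z _ => ?_
    rw [hde]; ring
  have hs : HasNTLimit (fun z => ∑ j ∈ Finset.range N, z.1 ^ j * cauchyInt (T j h) z.2)
      (τ, ζ) (∑ j ∈ Finset.range N, (τ : ℂ) ^ j * riesz (T j h) ζ) := by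
    refine HasNTLimit.sum fun j _ => HasNTLimit.mul ?_ (hasNTLimit_snd (ζ := (τ, ζ)) (h1 j))
    exact hasNTLimit_of_continuousAt (f := fun z => z.1 ^ j) (by fun_prop)
  have hb : HasNTLimit (fun z => K.b₀.eval z.1 + z.2 * K.b₁.eval z.1) (τ, ζ)
      (K.b₀.eval (τ : ℂ) + ζ * K.b₁.eval (τ : ℂ)) := (hpoly _).add (hz2.mul (hpoly _))
  -- Only `σ = τ` survives: there the zero of `nodal K.Z` cancels the pole of the kernel, and for
  -- the other lines it annihilates the term.
  have hterm : ∀ σ ∈ K.Z, HasNTLimit (fun z => (K.c σ : ℂ) * ((nodal K.Z).eval z.1 *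
      (1 - z.1 * conj (σ : ℂ))⁻¹) * ((K.b₀.eval z.1 + z.2 * K.b₁.eval z.1) *
        cauchyInt (L σ h) z.2)) (τ, ζ) (if σ = τ then (K.c τ : ℂ) *
          (-(τ : ℂ) * (nodal (K.Z.erase τ)).eval (τ : ℂ)) *
          ((K.b₀.eval (τ : ℂ) + ζ * K.b₁.eval (τ : ℂ)) * riesz (L τ h) ζ) else 0) := by
    intro σ hσ
    have hlast := hb.mul (hasNTLimit_snd (ζ := (τ, ζ)) (h2 σ hσ))
    split_ifs with hστ
    · subst hστ
      refine (((hconst (K.c σ)).mul ((hconst (-(σ : ℂ))).mul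
        (hpoly (nodal (K.Z.erase σ))))).mul hlast).congr fun z hz => ?_
      have hne : 1 - z.1 * conj (σ : ℂ) ≠ 0 := one_sub_mul_ne_zero hz.1 (by simp [Circle.norm_coe])
      have e : (nodal K.Z).eval z.1 * (1 - z.1 * conj (σ : ℂ))⁻¹ =
          -(σ : ℂ) * (nodal (K.Z.erase σ)).eval z.1 := by
        rw [mul_inv_eq_iff_eq_mul₀ hne, hde]
        linear_combination (-z.1) * (nodal (K.Z.erase σ)).eval z.1 * circle_mul_conj σ
      rw [e]
    · have hne : 1 - (τ : ℂ) * conj (σ : ℂ) ≠ 0 := circle_ne fun h => hστ h.symm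
      have hinv : HasNTLimit (fun z => (1 - z.1 * conj (σ : ℂ))⁻¹) (τ, ζ)
          (1 - (τ : ℂ) * conj (σ : ℂ))⁻¹ :=
        hasNTLimit_of_continuousAt (f := fun z => (1 - z.1 * conj (σ : ℂ))⁻¹)
          (ContinuousAt.inv₀ (by fun_prop) hne)
      have := ((hconst (K.c σ)).mul (hd.mul hinv)).mul hlast
      rwa [zero_mul, mul_zero, zero_mul] at this
  have hfin := (hconst (conj (α : ℂ))).mul ((((hpoly K.b₀).mul hA0).add
    ((hd.mul (hz2.mul hs)))).add (HasNTLimit.sum hterm))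
  rw [Finset.sum_ite_eq' K.Z τ, if_pos hτ] at hfin
  have e : (M₀ ∘L riesz ∘L L τ) h ζ = conj (α : ℂ) * (K.b₀.eval (τ : ℂ) * 0 +
      0 * ((ζ : ℂ) * ∑ j ∈ Finset.range N, (τ : ℂ) ^ j * riesz (T j h) ζ) + (K.c τ : ℂ) *
          (-(τ : ℂ) * (nodal (K.Z.erase τ)).eval (τ : ℂ)) *
          ((K.b₀.eval (τ : ℂ) + ζ * K.b₁.eval (τ : ℂ)) * riesz (L τ h) ζ)) := by
    simp only [ContinuousLinearMap.comp_apply]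
    rw [h3]
    ring
  rw [e]
  refine hfin.congr fun z hz => ?_
  rw [K.mul_inner_clarkVec R hL hT h hz]
  ring

end ClarkData

end

/-! ### Non-tangential limits agree with the embedding -/

section

open Metric Polynomial

lemma continuousAt_bidiskCauchyKernel {w : ℂ × ℂ} (hw : w ∈ bidisk) (ζ : Torus) :
    ContinuousAt (bidiskCauchyKernel w) ζ.pt := by
  have h : ∀ (a : ℂ) (η : Circle), ‖a‖ < 1 → 1 - (η : ℂ) * conj a ≠ 0 := fun a η ha => by
    rw [mul_comm]
    exact one_sub_mul_ne_zero (by simpa using ha) (Circle.norm_coe η).le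
  refine ContinuousAt.div continuousAt_const (by fun_prop) ?_
  exact mul_ne_zero (h _ _ hw.1) (h _ _ hw.2)

lemma HasNTLimit.of_mul {p f : ℂ × ℂ → ℂ} {ζ : Torus} {l : ℂ} (hp : ContinuousAt p ζ.pt)
    (h0 : p ζ.pt ≠ 0) (hne : ∀ z ∈ bidisk, p z ≠ 0)
    (h : HasNTLimit (fun z => p z * f z) ζ (p ζ.pt * l)) : HasNTLimit f ζ l := by
  have h1 := (hasNTLimit_of_continuousAt (hp.inv₀ h0)).mul h
  rw [Pi.inv_apply, inv_mul_cancel_left₀ h0] at h1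
  exact h1.congr fun z hz => inv_mul_cancel_left₀ (hne z hz) _

/-- At a regular boundary point with value `α`, the model kernel tends to the vector of the Clark
embedding. -/
lemma RIFRep.hasNTLimit_modelKernel {φ : ℂ × ℂ → ℂ} {n : ℕ} {p₀ p₁ : ℂ[X]} {γ : Circle}
    (R : RIFRep φ n p₀ p₁ γ) {α : Circle} {ζ : Torus}
    (hp : p₀.eval (ζ.1 : ℂ) + ζ.2 * p₁.eval (ζ.1 : ℂ) ≠ 0)
    (hlev : (level₀ n p₀ p₁ γ α).eval (ζ.1 : ℂ) + ζ.2 * (level₁ n p₀ p₁ γ α).eval (ζ.1 : ℂ) = 0)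
    {w : ℂ × ℂ} (hw : w ∈ bidisk) :
    HasNTLimit (modelKernel φ w) ζ ((1 - (α : ℂ) * conj (φ w)) * bidiskCauchyKernel w ζ.pt) := by
  have h1 := hasNTLimit_of_tendsto (R.tendsto_at_regular (ζ := ζ.pt) hp)
  have e : (γ : ℂ) * (((crev n p₁).eval ζ.pt.1 + ζ.pt.2 * (crev n p₀).eval ζ.pt.1) /
      (p₀.eval ζ.pt.1 + ζ.pt.2 * p₁.eval ζ.pt.1)) = α := by
    simp only [Torus.pt]
    rw [← mul_div_assoc, div_eq_iff hp]
    rw [eval_level] at hlev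
    linear_combination -hlev
  rw [e] at h1
  have hc : ∀ a : ℂ, HasNTLimit (fun _ => a) ζ a := fun a M => tendsto_const_nhds
  have h2 := ((hc 1).add ((hc (-conj (φ w))).mul h1)).mul
    (hasNTLimit_of_continuousAt (continuousAt_bidiskCauchyKernel hw ζ))
  have e2 : (1 + -conj (φ w) * (α : ℂ)) * bidiskCauchyKernel w ζ.pt =
      (1 - (α : ℂ) * conj (φ w)) * bidiskCauchyKernel w ζ.pt := by ring
  rw [e2] at h2
  refine h2.congr fun z hz => ?_
  rw [modelKernel, Set.indicator_of_mem hz]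
  ring

namespace ClarkData

variable {n : ℕ} {p₀ p₁ : ℂ[X]} {γ α : Circle} (K : ClarkData n p₀ p₁ γ α)

lemma level_curve (ζ : Circle) : (level₀ n p₀ p₁ γ α).eval (ζ : ℂ) +
    K.β ζ * (level₁ n p₀ p₁ γ α).eval (ζ : ℂ) = 0 := by
  rw [K.level₀_eq, K.level₁_eq, eval_mul, eval_mul]
  linear_combination (nodal K.Z).eval (ζ : ℂ) * K.curve ζ

lemma level_line {τ : Circle} (hτ : τ ∈ K.Z) (ζ : Circle) : (level₀ n p₀ p₁ γ α).eval (τ : ℂ) +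
    ζ * (level₁ n p₀ p₁ γ α).eval (τ : ℂ) = 0 := by
  rw [K.level₀_eq, K.level₁_eq, eval_mul, eval_mul, eval_nodal_eq_zero hτ]
  ring

/-- A zero of `p` over `ζ` forces `|p₀(ζ)| = |p₁(ζ)|`, and then the density vanishes at `ζ`. -/
lemma p_curve_ne_zero {ζ : Circle} (hζ : ζ ∉ K.Z) (hw : K.w ζ ≠ 0) (η : Circle) :
    p₀.eval (ζ : ℂ) + η * p₁.eval (ζ : ℂ) ≠ 0 := by
  intro h
  have h1 : ‖p₀.eval (ζ : ℂ)‖ = ‖p₁.eval (ζ : ℂ)‖ := by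
    rw [eq_neg_of_add_eq_zero_left h, norm_neg, norm_mul, Circle.norm_coe, one_mul]
  have h2 := K.w_eq ζ hζ
  rw [h1, sub_self] at h2
  rcases mul_eq_zero.1 h2 with h3 | h3
  · exact hw h3
  · exact hζ ((K.mem_Z ζ).2 (norm_eq_zero.1 (pow_eq_zero_iff two_ne_zero |>.1 h3)))

variable {φ : ℂ × ℂ → ℂ} (R : RIFRep φ n p₀ p₁ γ)

include R

lemma hasNTLimit_mul_clarkVec {ζ : Torus}
    (hp : p₀.eval (ζ.1 : ℂ) + ζ.2 * p₁.eval (ζ.1 : ℂ) ≠ 0)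
    (hlev : (level₀ n p₀ p₁ γ α).eval (ζ.1 : ℂ) + ζ.2 * (level₁ n p₀ p₁ γ α).eval (ζ.1 : ℂ) = 0)
    {w : ℂ × ℂ} (hw : w ∈ bidisk) :
    HasNTLimit (fun z => (p₀.eval z.1 + z.2 * p₁.eval z.1) *
      inner ℂ (clarkVec φ α K.measure z) (clarkVec φ α K.measure w)) ζ
      ((p₀.eval (ζ.1 : ℂ) + ζ.2 * p₁.eval (ζ.1 : ℂ)) *
        ((1 - (α : ℂ) * conj (φ w)) * bidiskCauchyKernel w ζ.pt)) := by
  have h1 : HasNTLimit (fun z => p₀.eval z.1 + z.2 * p₁.eval z.1) ζ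
      (p₀.eval (ζ.1 : ℂ) + ζ.2 * p₁.eval (ζ.1 : ℂ)) :=
    hasNTLimit_of_continuousAt (f := fun z => p₀.eval z.1 + z.2 * p₁.eval z.1) (by fun_prop)
  refine (h1.mul (R.hasNTLimit_modelKernel hp hlev hw)).congr fun z hz => ?_
  rw [(K.isClarkMeasure R).inner_clarkVec R hz hw]

/-- The limit of `p(z) ⟨v_z, h⟩`, multiplied by `w`, and the restriction of `w p h` to the curve are
bounded operators of `h`. They agree on the vectors `clarkVec`, because `φ` tends to `α` at regular
points of the level set, hence on their closed span; then `w` and `p` are divided out. -/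
lemma ae_curve_hasNTLimit {h : Lp ℂ 2 K.measure}
    (hh : h ∈ closure (Submodule.span ℂ (clarkVec φ α K.measure '' bidisk) :
      Set (Lp ℂ 2 K.measure))) :
    ∀ᵐ ζ ∂circleMeasure, K.w ζ ≠ 0 →
      HasNTLimit (fun z => inner ℂ (clarkVec φ α K.measure z) h) (ζ, K.β ζ) (h (ζ, K.β ζ)) := by
  obtain ⟨Λ, hΛ⟩ := K.exists_curve_limit R
  obtain ⟨A, hA⟩ := K.exists_curveOp
  have hcβ := K.continuous_β
  have hcw := K.continuous_w
  obtain ⟨M₁, hM₁⟩ := exists_mulOp circleMeasure (ψ := fun ζ : Circle => (K.w ζ : ℂ)) (by fun_prop)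
  obtain ⟨M₂, hM₂⟩ := exists_mulOp circleMeasure (ψ := fun ζ : Circle =>
    p₀.eval (ζ : ℂ) + K.β ζ * p₁.eval (ζ : ℂ)) (by fun_prop)
  have heq : Set.EqOn (M₁ ∘L Λ) (M₂ ∘L A) (clarkVec φ α K.measure '' bidisk) := by
    rintro _ ⟨w, hw, rfl⟩
    simp only [ContinuousLinearMap.comp_apply]
    refine Lp.ext ?_
    filter_upwards [hM₁ (Λ (clarkVec φ α K.measure w)), hM₂ (A (clarkVec φ α K.measure w)),
      hA (clarkVec φ α K.measure w), hΛ (clarkVec φ α K.measure w), ae_notMem_finset K.Z,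
      (K.ae_measure_iff.1 (coeFn_clarkVec φ α K.measure hw)).1] with ζ h1 h2 h3 h4 h5 h6
    rw [h1, h2, h3]
    by_cases h0 : K.w ζ = 0
    · simp [h0]
    · have := h4.unique (K.hasNTLimit_mul_clarkVec R (ζ := (ζ, K.β ζ))
        (K.p_curve_ne_zero h5 h0 _) (K.level_curve ζ) hw)
      rw [this, h6 h0]
      ring
  have heq2 := ContinuousLinearMap.eqOn_closure_span heq hh
  simp only [ContinuousLinearMap.comp_apply] at heq2
  have h2' := hM₂ (A h)
  rw [← heq2] at h2'
  filter_upwards [hM₁ (Λ h), h2', hA h, hΛ h, ae_notMem_finset K.Z] with ζ h1 h2 h3 h4 h5 h0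
  rw [h1, h3] at h2
  have h0' : (K.w ζ : ℂ) ≠ 0 := ofReal_ne_zero.2 h0
  have e : Λ h ζ = (p₀.eval (ζ : ℂ) + K.β ζ * p₁.eval (ζ : ℂ)) * h (ζ, K.β ζ) :=
    mul_left_cancel₀ h0' (by rw [h2]; ring)
  rw [e] at h4
  exact HasNTLimit.of_mul (p := fun z => p₀.eval z.1 + z.2 * p₁.eval z.1) (by fun_prop)
    (K.p_curve_ne_zero h5 h0 _) R.ne_zero h4

/-- Two bounded operators are compared as on the curve. Dividing by `p` is harmless, since it
vanishes at no more than one point of the line. -/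
lemma ae_line_hasNTLimit {h : Lp ℂ 2 K.measure}
    (hh : h ∈ closure (Submodule.span ℂ (clarkVec φ α K.measure '' bidisk) :
      Set (Lp ℂ 2 K.measure))) {τ : Circle} (hτ : τ ∈ K.Z) :
    ∀ᵐ ζ ∂circleMeasure,
      HasNTLimit (fun z => inner ℂ (clarkVec φ α K.measure z) h) (τ, ζ) (h (τ, ζ)) := by
  obtain ⟨Λ, hΛ⟩ := K.exists_line_limit R hτ
  obtain ⟨L, hL⟩ := K.exists_lineOp hτ
  obtain ⟨M, hM⟩ := exists_mulOp circleMeasure (ψ := fun ζ : Circle =>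
    p₀.eval (τ : ℂ) + ζ * p₁.eval (τ : ℂ)) (by fun_prop)
  have hne : ∀ᵐ ζ : Circle ∂circleMeasure, p₀.eval (τ : ℂ) + ζ * p₁.eval (τ : ℂ) ≠ 0 := by
    refine Set.Subsingleton.measure_zero (fun a ha b hb => ?_) _
    have ha : p₀.eval (τ : ℂ) + a * p₁.eval (τ : ℂ) = 0 := not_not.1 ha
    have hb : p₀.eval (τ : ℂ) + b * p₁.eval (τ : ℂ) = 0 := not_not.1 hb
    have hp : p₁.eval (τ : ℂ) ≠ 0 := fun h => by
      rw [h, mul_zero, add_zero] at ha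
      exact R.p₀_ne_zero (Circle.norm_coe τ).le ha
    exact Circle.ext (mul_right_cancel₀ hp (by linear_combination ha - hb))
  have heq : Set.EqOn Λ (M ∘L L) (clarkVec φ α K.measure '' bidisk) := by
    rintro _ ⟨w, hw, rfl⟩
    simp only [ContinuousLinearMap.comp_apply]
    refine Lp.ext ?_
    filter_upwards [hM (L (clarkVec φ α K.measure w)), hL (clarkVec φ α K.measure w),
      hΛ (clarkVec φ α K.measure w), hne,
      (K.ae_measure_iff.1 (coeFn_clarkVec φ α K.measure hw)).2 τ hτ] with ζ h1 h2 h3 h4 h5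
    rw [h1, h2, h5]
    exact h3.unique (K.hasNTLimit_mul_clarkVec R (ζ := (τ, ζ)) h4 (K.level_line hτ ζ) hw)
  have heq2 := ContinuousLinearMap.eqOn_closure_span heq hh
  simp only [ContinuousLinearMap.comp_apply] at heq2
  have h2' := hM (L h)
  rw [← heq2] at h2'
  filter_upwards [h2', hL h, hΛ h, hne] with ζ h1 h2 h3 h4
  rw [h1, h2] at h3
  exact HasNTLimit.of_mul (p := fun z => p₀.eval z.1 + z.2 * p₁.eval z.1) (by fun_prop) h4
    R.ne_zero h3

lemma ae_hasNTLimit {J : modelSpace φ →ₗ[ℂ] Lp ℂ 2 K.measure}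
    (hJ : IsClarkEmbedding φ α K.measure J) (f : modelSpace φ) :
    ∀ᵐ ζ ∂K.measure, HasNTLimit (f : ℂ × ℂ → ℂ) ζ (J f ζ) := by
  have hmem : J f ∈ closure (Submodule.span ℂ (clarkVec φ α K.measure '' bidisk) :
      Set (Lp ℂ 2 K.measure)) := by
    rw [← hJ.range_eq R]
    exact ⟨f, rfl⟩
  have h : ∀ᵐ ζ ∂K.measure,
      HasNTLimit (fun z => inner ℂ (clarkVec φ α K.measure z) (J f)) ζ (J f ζ) :=
    K.ae_measure_iff.2 ⟨K.ae_curve_hasNTLimit R hmem, fun τ hτ => K.ae_line_hasNTLimit R hmem hτ⟩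
  filter_upwards [h] with ζ hζ
  exact hζ.congr fun z hz => (hJ.eval_eq R f hz).symm

end ClarkData

end

section

open Metric Polynomial

/-! ### Uniform approximation on the level curve -/

/-- The inclusion of the circle in the plane. -/
def circleCoe : C(Circle, ℂ) := ⟨fun ζ => (ζ : ℂ), by fun_prop⟩

lemma aeval_circleCoe_apply (q : ℂ[X]) (ζ : Circle) : aeval circleCoe q ζ = q.eval (ζ : ℂ) := by
  rw [Polynomial.aeval_continuousMap_apply]; rfl

/-- The inverse is a Neumann series in `ζ / r`, whose partial sums lie in the closed algebra. -/
lemma exists_inv_sub_mem {A : Subalgebra ℂ C(Circle, ℂ)} (hA : IsClosed (A : Set C(Circle, ℂ)))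
    (hmem : circleCoe ∈ A) {r : ℂ} (hr : 1 < ‖r‖) :
    ∃ v ∈ A, v * aeval circleCoe (X - C r) = 1 := by
  have hr0 : r ≠ 0 := norm_pos_iff.1 (one_pos.trans hr)
  set x : C(Circle, ℂ) := r⁻¹ • circleCoe
  have hx : ‖x‖ < 1 := by
    have h1 : ‖circleCoe‖ ≤ 1 :=
      (ContinuousMap.norm_le _ zero_le_one).2 fun ζ => (Circle.norm_coe ζ).le
    calc ‖x‖ = ‖r‖⁻¹ * ‖circleCoe‖ := by rw [norm_smul, norm_inv]
      _ ≤ ‖r‖⁻¹ * 1 := by gcongr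
      _ < 1 := by rw [mul_one]; exact inv_lt_one_of_one_lt₀ hr
  have hxA : x ∈ A := A.smul_mem hmem _
  have hs : (∑' i : ℕ, x ^ i) ∈ A := by
    have h := (summable_geometric_of_norm_lt_one hx).hasSum.tendsto_sum_nat
    exact hA.mem_of_tendsto h (Eventually.of_forall fun N =>
      A.sum_mem fun i _ => A.pow_mem hxA i)
  refine ⟨(-r⁻¹) • ∑' i : ℕ, x ^ i, A.smul_mem hs _, ?_⟩
  have h := geom_series_mul_neg x hx
  have e : aeval circleCoe (X - C r) = (-r) • (1 - x) := by
    ext ζ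
    rw [aeval_circleCoe_apply]
    simp only [eval_sub, eval_X, eval_C, x, ContinuousMap.smul_apply, ContinuousMap.sub_apply,
      ContinuousMap.one_apply, smul_eq_mul]
    change (ζ : ℂ) - r = -r * (1 - r⁻¹ * ζ)
    field_simp
    ring
  rw [e, smul_mul_smul_comm, h]
  simp [hr0]

/-- Polynomials without zeros in the closed disk are invertible in closed subalgebras. -/
lemma exists_inv_mem {A : Subalgebra ℂ C(Circle, ℂ)} (hA : IsClosed (A : Set C(Circle, ℂ)))
    (hmem : circleCoe ∈ A) (N : ℕ) : ∀ q : ℂ[X], q.natDegree ≤ N →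
      (∀ z : ℂ, ‖z‖ ≤ 1 → q.eval z ≠ 0) → ∃ v ∈ A, v * aeval circleCoe q = 1 := by
  induction N with
  | zero =>
    intro q hq hne
    obtain ⟨c, rfl⟩ := natDegree_eq_zero.1 (Nat.le_zero.1 hq)
    have hc : c ≠ 0 := by simpa using hne 0 (by simp)
    refine ⟨c⁻¹ • 1, A.smul_mem A.one_mem _, ?_⟩
    rw [aeval_C, Algebra.algebraMap_eq_smul_one, smul_mul_smul_comm, inv_mul_cancel₀ hc]
    simp
  | succ N ih =>
    intro q hq hne
    rcases Nat.lt_or_ge q.natDegree (N + 1) with hlt | hge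
    · exact ih q (Nat.lt_succ_iff.1 hlt) hne
    · have hq0 : q ≠ 0 := fun h => by simpa [h] using hne 0 (by simp)
      obtain ⟨r, hr⟩ := IsAlgClosed.exists_root q (fun h => by
        have := natDegree_eq_zero_iff_degree_le_zero.2 h.le
        omega)
      obtain ⟨q', rfl⟩ := dvd_iff_isRoot.2 hr
      have hr1 : 1 < ‖r‖ := by
        by_contra h
        exact hne r (not_lt.1 h) hr
      have hd : q'.natDegree ≤ N := by
        have hq' : q' ≠ 0 := fun h => hq0 (by rw [h, mul_zero])
        rw [natDegree_mul (X_sub_C_ne_zero r) hq', natDegree_X_sub_C] at hq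
        omega
      obtain ⟨v, hv, hv1⟩ := ih q' hd fun z hz h => hne z hz (by rw [eval_mul, h, mul_zero])
      obtain ⟨u, hu, hu1⟩ := exists_inv_sub_mem hA hmem hr1
      refine ⟨u * v, A.mul_mem hu hv, ?_⟩
      rw [map_mul, mul_mul_mul_comm, hu1, hv1, mul_one]

lemma aeval_mem_of_mem {A : Subalgebra ℂ C(Circle, ℂ)} (hmem : circleCoe ∈ A) (q : ℂ[X]) :
    aeval circleCoe q ∈ A :=
  Algebra.adjoin_le (Set.singleton_subset_iff.2 hmem) (aeval_mem_adjoin_singleton ℂ circleCoe)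

/-- The functions `ζ` and `β = -b₀ / b₁` generate the continuous functions on the circle if `b₀` has
no zeros in the closed disk and `b₁` has a zero in the disk. -/
lemma adjoin_dense {b₀ b₁ : ℂ[X]} (h₀ : ∀ z : ℂ, ‖z‖ ≤ 1 → b₀.eval z ≠ 0) {a : ℂ} (ha : ‖a‖ < 1)
    (hroot : b₁.eval a = 0) {β : C(Circle, ℂ)}
    (hβ : ∀ ζ : Circle, b₀.eval (ζ : ℂ) + β ζ * b₁.eval (ζ : ℂ) = 0) :
    (Algebra.adjoin ℂ {circleCoe, β}).topologicalClosure = ⊤ := by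
  set A := (Algebra.adjoin ℂ {circleCoe, β}).topologicalClosure with hAdef
  have hA : IsClosed (A : Set C(Circle, ℂ)) := Subalgebra.isClosed_topologicalClosure _
  have hsub : ∀ x ∈ ({circleCoe, β} : Set C(Circle, ℂ)), x ∈ A := fun x hx =>
    Subalgebra.le_topologicalClosure _ (Algebra.subset_adjoin hx)
  have hmem : circleCoe ∈ A := hsub _ (by simp)
  have hβA : β ∈ A := hsub _ (by simp)
  obtain ⟨v, hv, hv1⟩ := exists_inv_mem hA hmem _ b₀ le_rfl h₀
  have hq : ∀ z : ℂ, ‖z‖ ≤ 1 → (1 - C (conj a) * X : ℂ[X]).eval z ≠ 0 := fun z hz => by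
    simpa using one_sub_mul_ne_zero (z := conj a) (by simpa using ha) hz
  obtain ⟨u, hu, hu1⟩ := exists_inv_mem hA hmem _ _ le_rfl hq
  obtain ⟨b₂, hb₂⟩ := dvd_iff_isRoot.2 (show b₁.IsRoot a from hroot)
  -- The Blaschke factor with zero `a`: unimodular and injective on the circle.
  set m : C(Circle, ℂ) := aeval circleCoe (X - C a) * u
  have hm : m ∈ A := A.mul_mem (aeval_mem_of_mem hmem _) hu
  have hvζ : ∀ ζ : Circle, v ζ * b₀.eval (ζ : ℂ) = 1 := fun ζ => by
    have := congrArg (fun F : C(Circle, ℂ) => F ζ) hv1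
    simpa only [ContinuousMap.mul_apply, aeval_circleCoe_apply, ContinuousMap.one_apply] using this
  have huζ : ∀ ζ : Circle, u ζ * (1 - conj a * ζ) = 1 := fun ζ => by
    have := congrArg (fun F : C(Circle, ℂ) => F ζ) hu1
    simpa only [ContinuousMap.mul_apply, aeval_circleCoe_apply, ContinuousMap.one_apply, eval_sub,
      eval_one, eval_mul, eval_C, eval_X] using this
  have hmζ : ∀ ζ : Circle, m ζ = (ζ - a) * u ζ := fun ζ => by
    simp only [m, ContinuousMap.mul_apply, aeval_circleCoe_apply, eval_sub, eval_X, eval_C]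
  have hane : ∀ ζ : Circle, (ζ : ℂ) - a ≠ 0 := fun ζ => circle_sub_ne_zero ha ζ
  -- On the circle `conj m = 1 / m = (1 - conj a ζ) / (ζ - a)`. With `b₁ = (ζ - a) b₂`, the curve
  -- equation gives `1 / (ζ - a) = -β b₂ / b₀`, so the conjugate lies in the algebra and
  -- Stone–Weierstrass applies to `m` alone.
  have hstar : star m = -(β * aeval circleCoe (1 - C (conj a) * X) * aeval circleCoe b₂ * v) := by
    ext ζ
    simp only [ContinuousMap.star_apply, RCLike.star_def, ContinuousMap.neg_apply,
      ContinuousMap.mul_apply, aeval_circleCoe_apply, hmζ, eval_sub, eval_one, eval_mul, eval_C,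
      eval_X]
    simp only [map_mul, map_sub]
    have h1 := huζ ζ
    have h2 : conj (u ζ) * (1 - a * conj (ζ : ℂ)) = 1 := by
      have := congrArg conj h1
      simpa using this
    have h3 := hvζ ζ
    have h4 := hβ ζ
    rw [hb₂, eval_mul, eval_sub, eval_X, eval_C] at h4
    have h5 := circle_mul_conj ζ
    have h6 : conj (u ζ) * (ζ - a) = ζ := by
      linear_combination (ζ : ℂ) * h2 + a * conj (u ζ) * h5
    refine mul_left_cancel₀ (hane ζ) ?_
    linear_combination (conj (ζ : ℂ) - conj a) * h6 + h5 +
      (1 - conj a * ζ) * v ζ * h4 - (1 - conj a * ζ) * h3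
  have hstarA : star m ∈ A := by
    rw [hstar]
    exact A.neg_mem (A.mul_mem (A.mul_mem (A.mul_mem hβA (aeval_mem_of_mem hmem _))
      (aeval_mem_of_mem hmem _)) hv)
  have hsep : (StarAlgebra.adjoin ℂ {m}).SeparatesPoints := by
    intro ζ η hne
    refine ⟨m, ⟨m, StarAlgebra.subset_adjoin ℂ {m} rfl, rfl⟩, fun h => hne (Circle.ext ?_)⟩
    rw [hmζ, hmζ] at h
    have h1 := huζ ζ
    have h2 := huζ η
    have h3 : ((ζ : ℂ) - a) * (1 - conj a * η) = (η - a) * (1 - conj a * ζ) := by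
      linear_combination (1 - conj a * ζ) * (1 - conj a * η) * h -
        ((ζ : ℂ) - a) * (1 - conj a * η) * h1 + (η - a) * (1 - conj a * ζ) * h2
    have h4 : (1 : ℂ) - a * conj a ≠ 0 := one_sub_mul_ne_zero ha (by simpa using ha.le)
    refine mul_right_cancel₀ h4 ?_
    linear_combination h3
  have htop := ContinuousMap.starSubalgebra_topologicalClosure_eq_top_of_separatesPoints _ hsep
  have hle : (StarAlgebra.adjoin ℂ {m}).toSubalgebra ≤ A := by
    rw [StarAlgebra.adjoin_toSubalgebra]
    refine Algebra.adjoin_le ?_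
    rintro x (rfl | hx)
    · exact hm
    · rw [Set.mem_star, Set.mem_singleton_iff] at hx
      have : x = star m := by rw [← hx, star_star]
      rw [this]
      exact hstarA
  rw [eq_top_iff]
  intro x _
  have hx : x ∈ (StarAlgebra.adjoin ℂ {m}).topologicalClosure := by rw [htop]; trivial
  exact closure_minimal (fun y hy => hle hy) hA hx

/-! ### Moments -/

/-- A function that is orthogonal to all the Cauchy kernels has vanishing analytic moments. -/
lemma moment_eq_zero {σ : Measure Torus} [IsFiniteMeasure σ] {e : Lp ℂ 2 σ}
    (h : ∀ w ∈ bidisk, ∫ ζ, e ζ * cauchyMap w ζ ∂σ = 0) (i : ℕ × ℕ) :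
    ∫ ζ, e ζ * conj (mono i ζ.pt) ∂σ = 0 := by
  have hc : ∀ i : ℕ × ℕ, Continuous fun ζ : Torus => conj (mono i ζ.pt) := fun i => by
    have := continuous_pt
    have := continuous_mono i
    fun_prop
  -- Expanding the Cauchy kernel shows the moments to be Taylor coefficients of a function that is
  -- identically zero.
  have hT : HasTaylor (fun _ => 0) fun i => ∫ ζ, e ζ * conj (mono i ζ.pt) ∂σ := by
    intro w hw
    have hs := hasSum_integral_of_summable_integral_norm (μ := σ)
      (F := fun i ζ => mono i w * (e ζ * conj (mono i ζ.pt)))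
      (fun i => (integrable_mul_continuous e (hc i)).const_mul _) (by
        have hn : ∀ i, ∫ ζ, ‖mono i w * (e ζ * conj (mono i ζ.pt))‖ ∂σ =
            ‖mono i w‖ * ∫ ζ, ‖e ζ‖ ∂σ := fun i => by
          rw [← integral_const_mul]
          refine integral_congr_ae (Eventually.of_forall fun ζ => ?_)
          simp only [norm_mul, RCLike.norm_conj, norm_mono_pt, mul_one]
        simp_rw [hn]
        exact (summable_norm_mono hw).mul_right _)
    have e2 : ∫ ζ, ∑' i, mono i w * (e ζ * conj (mono i ζ.pt)) ∂σ = 0 := by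
      rw [← h w hw]
      refine integral_congr_ae (Eventually.of_forall fun ζ => ?_)
      simp only
      rw [cauchyMap_apply hw, ← (hasSum_cauchy hw ζ).tsum_eq, ← tsum_mul_left]
      refine tsum_congr fun i => ?_
      ring
    rw [e2] at hs
    refine hs.congr_fun fun i => ?_
    rw [integral_const_mul, mul_comm]
  have h0 : HasTaylor (fun _ => 0) fun _ : ℕ × ℕ => (0 : ℂ) := fun w _ => by
    simp
  exact congrFun (hT.unique h0) i

namespace ClarkData

variable {n : ℕ} {p₀ p₁ : ℂ[X]} {γ α : Circle} (K : ClarkData n p₀ p₁ γ α)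
  {φ : ℂ × ℂ → ℂ} (R : RIFRep φ n p₀ p₁ γ)

include R

/-- Without lines, `b₁` has a zero in the disk. -/
lemma exists_root (hn : 1 ≤ n) (hZ : K.Z = ∅) : ∃ a : ℂ, ‖a‖ < 1 ∧ K.b₁.eval a = 0 := by
  have h0 := K.level₀_eq
  have h1 := K.level₁_eq
  have hnod : nodal K.Z = 1 := by rw [hZ, nodal, Finset.prod_empty]
  rw [hnod, one_mul] at h0 h1
  have h2 := R.level₁_eq γ α
  rw [h0, h1] at h2
  have hd : K.b₀.natDegree ≤ n := h0 ▸ R.natDegree_level₀ γ α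
  have hαγ : -(α * γ : ℂ) ≠ 0 := neg_ne_zero.2 (mul_ne_zero α.coe_ne_zero γ.coe_ne_zero)
  -- Without lines `b₁` is a multiple of the reflection of `b₀`, and its coefficient of degree `n`
  -- is a multiple of `conj (b₀(0)) ≠ 0`. As `n ≥ 1` there is a root; one outside the open disk
  -- would reflect to a zero of `b₀` in the closed disk.
  have hcoeff : K.b₁.coeff n ≠ 0 := by
    rw [h2, coeff_C_mul, coeff_crev, if_pos le_rfl, Nat.sub_self]
    refine mul_ne_zero hαγ ((_root_.map_ne_zero _).2 ?_)
    rw [coeff_zero_eq_eval_zero]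
    exact K.b₀_ne_zero 0 (by simp)
  obtain ⟨a, ha⟩ := IsAlgClosed.exists_root K.b₁ (fun h => by
    have h3 := natDegree_eq_zero_iff_degree_le_zero.2 h.le
    exact hcoeff (coeff_eq_zero_of_natDegree_lt (by omega)))
  refine ⟨a, ?_, ha⟩
  by_contra hge
  have ha1 : 1 ≤ ‖a‖ := not_lt.1 hge
  have ha0 : a ≠ 0 := norm_pos_iff.1 (one_pos.trans_le ha1)
  have h3 : K.b₁.eval a = 0 := ha
  rw [h2, eval_mul, eval_C, eval_crev hd ha0] at h3
  rcases mul_eq_zero.1 h3 with h4 | h4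
  · exact hαγ h4
  rcases mul_eq_zero.1 h4 with h5 | h5
  · exact pow_ne_zero n ha0 h5
  · refine K.b₀_ne_zero _ ?_ ((_root_.map_eq_zero _).1 h5)
    rw [norm_inv, RCLike.norm_conj]
    exact inv_le_one_of_one_le₀ ha1

/-- A vector orthogonal to the range has vanishing analytic moments. The measure lives on the graph
of `β`, where these moments pair it with polynomials in `ζ` and `β`; by `adjoin_dense` it is
orthogonal to all continuous functions. -/
lemma surjective_of_empty (hn : 1 ≤ n) (hZ : K.Z = ∅) {J : modelSpace φ →ₗ[ℂ] Lp ℂ 2 K.measure}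
    (hJ : IsClarkEmbedding φ α K.measure J) : Function.Surjective J := by
  rw [← Set.range_eq_univ, hJ.range_eq R]
  suffices h : (Submodule.span ℂ (clarkVec φ α K.measure '' bidisk)).topologicalClosure = ⊤ by
    have := congrArg (fun S : Submodule ℂ (Lp ℂ 2 K.measure) => (S : Set (Lp ℂ 2 K.measure))) h
    simpa using this
  rw [Submodule.topologicalClosure_eq_top_iff, Submodule.eq_bot_iff]
  intro e he
  have horth : ∀ w ∈ bidisk, ∫ ζ, e ζ * cauchyMap w ζ ∂K.measure = 0 := by
    intro w hw
    have h1 := (Submodule.mem_orthogonal _ _).1 he _ (Submodule.subset_span ⟨w, hw, rfl⟩)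
    rw [inner_clarkVec_eq φ α K.measure hw] at h1
    exact (mul_eq_zero.1 h1).resolve_left (R.one_sub_ne_zero α hw)
  obtain ⟨a, ha, hroot⟩ := K.exists_root R hn hZ
  let β' : C(Circle, ℂ) := ⟨fun ζ => (K.β ζ : ℂ), by have := K.continuous_β; fun_prop⟩
  have hdense := adjoin_dense (β := β') K.b₀_ne_zero ha hroot K.curve
  have hcurve : ∀ F : Torus → ℂ, Continuous F → ∫ ζ, e ζ * F ζ ∂K.measure =
      ∫ ζ, (K.w ζ : ℂ) * e (ζ, K.β ζ) * F (ζ, K.β ζ) ∂circleMeasure := by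
    intro F hF
    rw [K.integral_eq (integrable_mul_continuous e hF), hZ, Finset.sum_empty, add_zero]
    refine integral_congr_ae (Eventually.of_forall fun ζ => ?_)
    simp only
    ring
  obtain ⟨A, hA⟩ := K.exists_curveOp
  have hAi : Integrable (fun ζ => conj (A e ζ)) circleMeasure :=
    conjCLE.toContinuousLinearMap.integrable_comp ((Lp.memLp (A e)).integrable (by norm_num))
  let Φ := integralCLM circleMeasure (fun ζ => conj (A e ζ)) hAi
  have hΦ : ∀ F : Torus → ℂ, Continuous F → ∀ u : C(Circle, ℂ),
      (∀ ζ, u ζ = F (ζ, K.β ζ)) → Φ u = conj (∫ ζ, e ζ * conj (F ζ) ∂K.measure) := by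
    intro F hF u hu
    rw [hcurve (fun ζ => conj (F ζ)) (continuous_conj.comp hF), ← integral_conj]
    refine integral_congr_ae ?_
    filter_upwards [hA e] with ζ h1
    rw [h1, hu]
    simp
  have hzero : ∀ u ∈ Algebra.adjoin ℂ {circleCoe, β'}, Φ u = 0 := by
    intro u hu
    have hu' : u ∈ Subalgebra.toSubmodule (Algebra.adjoin ℂ {circleCoe, β'}) := hu
    rw [Algebra.adjoin_eq_span] at hu'
    induction hu' using Submodule.span_induction with
    | mem x hx =>
      obtain ⟨j, k, rfl⟩ := (Submonoid.mem_closure_pair _ _ _).1 hx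
      rw [hΦ (fun ζ => mono (j, k) ζ.pt) ((continuous_mono _).comp continuous_pt) _ fun ζ => rfl,
        moment_eq_zero horth, map_zero]
    | zero => simp
    | add x y hx hy h1 h2 =>
      rw [← Algebra.adjoin_eq_span] at hx hy
      rw [map_add, h1 hx, h2 hy, add_zero]
    | smul c x hx h1 =>
      rw [← Algebra.adjoin_eq_span] at hx
      rw [map_smul, h1 hx, smul_zero]
  have hall : ∀ u : C(Circle, ℂ), Φ u = 0 := by
    intro u
    have hu : u ∈ (Algebra.adjoin ℂ {circleCoe, β'}).topologicalClosure := by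
      rw [hdense]; trivial
    exact closure_minimal (s := (Algebra.adjoin ℂ {circleCoe, β'} : Set C(Circle, ℂ)))
      (t := {u | Φ u = 0}) hzero (isClosed_eq Φ.continuous continuous_const) hu
  have hinner : ∀ F : C(Torus, ℂ),
      inner ℂ (ContinuousMap.toLp (E := ℂ) 2 K.measure ℂ F) e = 0 := by
    intro F
    have hc := K.continuous_β
    have h1 := hall ⟨fun ζ => F (ζ, K.β ζ), by fun_prop⟩
    rw [hΦ F F.continuous _ fun ζ => rfl, _root_.map_eq_zero] at h1
    rw [L2.inner_def, ← h1]
    refine integral_congr_ae ?_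
    filter_upwards [ContinuousMap.coeFn_toLp (𝕜 := ℂ) (p := 2) K.measure F] with ζ h2
    rw [h2, RCLike.inner_apply]
  have hd := ContinuousMap.toLp_denseRange ℂ K.measure (p := 2) ℂ (by norm_num)
  have hself : inner ℂ e e = (0 : ℂ) := by
    have : (fun x : Lp ℂ 2 K.measure => inner ℂ x e) = fun _ => (0 : ℂ) :=
      hd.equalizer (by fun_prop) continuous_const (funext hinner)
    exact congrFun this e
  exact inner_self_eq_zero.1 hself

/-- The functional taking `h` to the mean of `h(τ, ζ) ζ` is bounded, because the line has positive
mass. On each vector `clarkVec` it is the mean of an analytic function with a zero at the origin,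
hence `0`, but it equals `1` on `conj ζ₂`. -/
lemma not_surjective_of_mem {τ : Circle} (hτ : τ ∈ K.Z)
    {J : modelSpace φ →ₗ[ℂ] Lp ℂ 2 K.measure} (hJ : IsClarkEmbedding φ α K.measure J) :
    ¬ Function.Surjective J := by
  intro hs
  obtain ⟨L, hL⟩ := K.exists_lineOp hτ
  let q : C(Circle, ℂ) := ⟨fun ζ => conj (ζ : ℂ), by fun_prop⟩
  let Φ : Lp ℂ 2 K.measure →L[ℂ] ℂ :=
    innerSL ℂ (ContinuousMap.toLp (E := ℂ) 2 circleMeasure ℂ q) ∘L L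
  have hΦ : ∀ h : Lp ℂ 2 K.measure, Φ h = ∫ ζ : Circle, h (τ, ζ) * ζ ∂circleMeasure := by
    intro h
    simp only [Φ, ContinuousLinearMap.comp_apply, innerSL_apply_apply]
    rw [L2.inner_def]
    refine integral_congr_ae ?_
    filter_upwards [ContinuousMap.coeFn_toLp (𝕜 := ℂ) (p := 2) circleMeasure q, hL h] with ζ h1 h2
    rw [h1, h2, RCLike.inner_apply]
    simp [q]
  have hzero : Set.EqOn Φ (0 : Lp ℂ 2 K.measure →L[ℂ] ℂ) (clarkVec φ α K.measure '' bidisk) := by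
    rintro _ ⟨w, hw, rfl⟩
    rw [hΦ, zero_apply]
    have hd : DiffContOnCl ℂ (fun ζ : ℂ => (1 - (α : ℂ) * conj (φ w)) *
        (1 - (τ : ℂ) * conj w.1)⁻¹ * ((1 - conj w.2 * ζ)⁻¹ * ζ)) (ball 0 1) := by
      refine DifferentiableOn.diffContOnCl ?_
      rw [closure_ball _ one_ne_zero]
      refine (differentiableOn_const _).mul (DifferentiableOn.mul ?_ (by fun_prop))
      refine DifferentiableOn.inv (by fun_prop) fun ζ hζ => ?_
      exact one_sub_mul_ne_zero (by simpa using hw.2) (by simpa using hζ)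
    have h1 := integral_circle_eq hd
    simp only [mul_zero] at h1
    rw [← h1]
    refine integral_congr_ae ?_
    filter_upwards [(K.ae_measure_iff.1 (coeFn_clarkVec φ α K.measure hw)).2 τ hτ] with ζ h2
    rw [h2, bidiskCauchyKernel, one_div, mul_inv]
    simp only [Torus.pt]
    rw [mul_comm (ζ : ℂ) (conj w.2)]
    ring
  have hall : ∀ h : Lp ℂ 2 K.measure, Φ h = 0 := by
    intro h
    have hm : h ∈ Set.range J := hs h
    rw [hJ.range_eq R] at hm
    exact ContinuousLinearMap.eqOn_closure_span hzero hm
  let Q : C(Torus, ℂ) := ⟨fun ζ => conj (ζ.2 : ℂ), by fun_prop⟩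
  have h1 := hall (ContinuousMap.toLp (E := ℂ) 2 K.measure ℂ Q)
  rw [hΦ] at h1
  have h2 : ∫ ζ : Circle, (ContinuousMap.toLp (E := ℂ) 2 K.measure ℂ Q) (τ, ζ) * ζ ∂circleMeasure =
      ∫ _ : Circle, (1 : ℂ) ∂circleMeasure := by
    refine integral_congr_ae ?_
    filter_upwards [(K.ae_measure_iff.1 (ContinuousMap.coeFn_toLp (𝕜 := ℂ) (p := 2) K.measure Q)).2
      τ hτ] with ζ h3
    rw [h3]
    simp only [Q, ContinuousMap.coe_mk]
    rw [mul_comm, circle_mul_conj]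
  rw [h2] at h1
  simp at h1

/-- At the points of the lines over `Z` the non-tangential limit of `φ` is `α`. -/
lemma hasNTLimit_of_mem {τ : Circle} (hτ : τ ∈ K.Z) (η : Circle) : HasNTLimit φ (τ, η) α := by
  have hc := K.c_pos τ
  -- Of the Clark formula only the mass on this line is kept: `c P(z₁, τ) ≤ (1 - |φ|²) / |α - φ|² ≤
  -- 1 / |α - φ|²`.
  have hbound : ∀ z ∈ bidisk, ‖(α : ℂ) - φ z‖ ^ 2 * (1 - ‖z.1‖) ≤ (K.c τ)⁻¹ * ‖(τ : ℂ) - z.1‖ ^ 2 := by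
    intro z hz
    have h1 := K.poisson_eq z hz
    rw [← R.clark_ratio α hz] at h1
    have h2 : K.c τ * poisson z.1 τ ≤ ∑ τ ∈ K.Z, K.c τ * poisson z.1 τ :=
      Finset.single_le_sum (f := fun τ => K.c τ * poisson z.1 τ)
        (fun σ _ => mul_nonneg (K.c_pos σ).le (poisson_pos hz.1 σ).le) hτ
    have h3 : 0 ≤ ∫ ζ, K.w ζ * (poisson z.1 ζ * poisson z.2 (K.β ζ)) ∂circleMeasure :=
      integral_nonneg fun ζ => mul_nonneg (K.w_nonneg ζ)
        (mul_nonneg (poisson_pos hz.1 ζ).le (poisson_pos hz.2 _).le)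
    have hα : 0 < ‖(α : ℂ) - φ z‖ := norm_pos_iff.2 (R.sub_ne_zero α hz)
    have hτz : 0 < ‖(τ : ℂ) - z.1‖ := norm_pos_iff.2 (circle_sub_ne_zero hz.1 τ)
    have h4 : K.c τ * poisson z.1 τ ≤ 1 / ‖(α : ℂ) - φ z‖ ^ 2 := by
      have : (1 - ‖φ z‖ ^ 2) / ‖(α : ℂ) - φ z‖ ^ 2 ≤ 1 / ‖(α : ℂ) - φ z‖ ^ 2 := by
        gcongr
        linarith [sq_nonneg ‖φ z‖]
      linarith
    rw [poisson, ← mul_div_assoc, div_le_div_iff₀ (by positivity) (by positivity), one_mul] at h4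
    rw [inv_mul_eq_div, le_div_iff₀ hc]
    have h5 : 1 - ‖z.1‖ ≤ 1 - ‖z.1‖ ^ 2 := by nlinarith [norm_nonneg z.1, hz.1]
    calc ‖(α : ℂ) - φ z‖ ^ 2 * (1 - ‖z.1‖) * K.c τ
        ≤ ‖(α : ℂ) - φ z‖ ^ 2 * (1 - ‖z.1‖ ^ 2) * K.c τ := by gcongr
      _ = K.c τ * (1 - ‖z.1‖ ^ 2) * ‖(α : ℂ) - φ z‖ ^ 2 := by ring
      _ ≤ _ := h4
  rw [hasNTLimit_iff]
  intro M
  have hlim : Tendsto (fun z : ℂ × ℂ => Real.sqrt ((K.c τ)⁻¹ * M ^ 2 * (1 - ‖z.1‖)))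
      (𝓝[stolzProd M (τ, η)] (Torus.pt (τ, η))) (𝓝 0) := by
    have hcont : Continuous fun z : ℂ × ℂ => Real.sqrt ((K.c τ)⁻¹ * M ^ 2 * (1 - ‖z.1‖)) := by
      fun_prop
    have := (hcont.tendsto (Torus.pt (τ, η))).mono_left
      (nhdsWithin_le_nhds (s := stolzProd M (τ, η)))
    simpa [Torus.pt, Circle.norm_coe] using this
  rw [tendsto_iff_norm_sub_tendsto_zero]
  refine squeeze_zero' (Eventually.of_forall fun _ => norm_nonneg _) ?_ hlim
  filter_upwards [self_mem_nhdsWithin] with z hz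
  have h0 : 0 < 1 - ‖z.1‖ := sub_pos.2 hz.1.1
  refine Real.le_sqrt_of_sq_le ?_
  rw [norm_sub_rev]
  have h1 := hbound z hz.1
  have h2 : ‖(τ : ℂ) - z.1‖ ^ 2 ≤ (M * (1 - ‖z.1‖)) ^ 2 := by
    rw [norm_sub_rev]
    have := hz.2.1.le
    gcongr
  refine le_of_mul_le_mul_right ?_ h0
  calc _ ≤ (K.c τ)⁻¹ * ‖(τ : ℂ) - z.1‖ ^ 2 := h1
    _ ≤ (K.c τ)⁻¹ * (M * (1 - ‖z.1‖)) ^ 2 := by gcongr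
    _ = _ := by ring

/-- Both a singularity over `τ` and a line over `τ` amount to `|p₀(τ)| = |p₁(τ)|`, the line being
one for a single value of `α`; that value is the limit of `φ` at every point of the line. -/
lemma exists_exceptional_iff : (∃ τ : Torus, p₀.eval (τ.1 : ℂ) + τ.2 * p₁.eval (τ.1 : ℂ) = 0 ∧
    HasNTLimit φ τ α) ↔ K.Z.Nonempty := by
  constructor
  · rintro ⟨⟨τ, η⟩, hp, hlim⟩
    simp only at hp
    have hp0 := R.p₀_ne_zero (Circle.norm_coe τ).le
    have hn : ‖p₁.eval (τ : ℂ)‖ = ‖p₀.eval (τ : ℂ)‖ := by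
      rw [eq_neg_of_add_eq_zero_left hp, norm_neg, norm_mul, Circle.norm_coe, one_mul]
    -- `l` is the value of `γ p̃ / p` at `(τ, 0)`. It is unimodular, and its level set contains the
    -- line over `τ`, so uniqueness of limits identifies it with `α`.
    obtain ⟨l, hl⟩ := exists_circle (z := γ * ((crev n p₁).eval (τ : ℂ) / p₀.eval (τ : ℂ))) (by
      rw [norm_mul, Circle.norm_coe, one_mul, norm_div, eval_crev_circle R.deg₁, norm_mul, norm_pow,
        Circle.norm_coe, one_pow, one_mul, RCLike.norm_conj, hn, div_self (norm_ne_zero_iff.2 hp0)])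
    obtain ⟨K'⟩ := R.exists_clarkData γ l
    have hmem : τ ∈ K'.Z := by
      rw [K'.mem_Z, level₀, eval_sub, eval_mul, eval_mul, eval_C, eval_C, hl]
      field_simp
      ring
    have hal : (α : ℂ) = l := hlim.unique (K'.hasNTLimit_of_mem R hmem η)
    refine ⟨τ, ?_⟩
    rw [K.mem_Z, Circle.ext hal, ← K'.mem_Z]
    exact hmem
  · rintro ⟨τ, hτ⟩
    have h0 := (K.mem_Z τ).1 hτ
    rw [level₀, eval_sub, eval_mul, eval_mul, eval_C, eval_C, sub_eq_zero,
      eval_crev_circle R.deg₁] at h0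
    have hn : ‖p₀.eval (τ : ℂ)‖ = ‖p₁.eval (τ : ℂ)‖ := by
      have := congrArg norm h0
      simpa [Circle.norm_coe] using this
    have hp0 := R.p₀_ne_zero (Circle.norm_coe τ).le
    have hp1 : p₁.eval (τ : ℂ) ≠ 0 := by
      rw [← norm_ne_zero_iff, ← hn, norm_ne_zero_iff]
      exact hp0
    -- The singularity on the line is the root of `p(τ, ·)`, which is unimodular because `|p₀| =
    -- |p₁|` at `τ`.
    obtain ⟨η, hη⟩ := exists_circle (z := -p₀.eval (τ : ℂ) / p₁.eval (τ : ℂ)) (by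
      rw [norm_div, norm_neg, hn, div_self (norm_ne_zero_iff.2 hp1)])
    refine ⟨(τ, η), ?_, K.hasNTLimit_of_mem R hτ η⟩
    simp only [hη]
    field_simp
    ring

end ClarkData

end

end ClarkBidisk

end

theorem theorem1p3 (n : ℕ) (hn : 1 ≤ n) (φ : ℂ × ℂ → ℂ) (p : MvPolynomial (Fin 2) ℂ)
    (hφ : IsRIF φ p n 1) (α : Circle) :
    (∃! σ : Measure Torus, IsClarkMeasure φ α σ) ∧
    ∀ σ : Measure Torus, IsClarkMeasure φ α σ →
      (∃! J : modelSpace φ →ₗ[ℂ] Lp ℂ 2 σ, IsClarkEmbedding φ α σ J) ∧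
      ∀ J : modelSpace φ →ₗ[ℂ] Lp ℂ 2 σ, IsClarkEmbedding φ α σ J →
        (∀ f : modelSpace φ, ∀ᵐ ζ ∂σ, HasNTLimit (f : ℂ × ℂ → ℂ) ζ (J f ζ)) ∧
        (IsUnitaryMap J ↔ IsGeneric φ p α) := by
  obtain ⟨γ, R⟩ := hφ.exists_rifRep
  have hex := R.existsUnique_clarkMeasure α
  refine ⟨hex, fun σ hσ => ?_⟩
  obtain ⟨K⟩ := R.exists_clarkData γ α
  -- Uniqueness lets the explicit measure replace an arbitrary Clark measure from here on.
  obtain rfl : σ = K.measure := hex.unique hσ (K.isClarkMeasure R)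
  refine ⟨?_, fun J hJ => ⟨K.ae_hasNTLimit R hJ, ?_⟩⟩
  · obtain ⟨J, hJ⟩ := hσ.exists_embedding R
    exact ⟨J, hJ, fun J' hJ' => hJ'.unique R hJ⟩
  · have hexc : IsExceptional φ p α ↔ K.Z.Nonempty := by
      rw [← K.exists_exceptional_iff R]
      simp only [IsExceptional, evalAt_eq_sndCoeff hφ.degree_snd, Torus.pt]
    rw [IsGeneric, hexc, Finset.not_nonempty_iff_eq_empty]
    constructor
    · rintro ⟨-, hs⟩
      rw [Finset.eq_empty_iff_forall_notMem]
      exact fun τ hτ => K.not_surjective_of_mem R hτ hJ hs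
    · exact fun hZ => ⟨hJ.isometric, K.surjective_of_empty R hn hZ hJ⟩
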